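/- Let $\mathcal H,\mathcal H'$ be separable complex Hilbert spaces and let $G$, $G'$ be positive semidefinite densely defined self-adjoint operators on $\mathcal H$, $\mathcal H'$ such that $\inf\{\|G\varphi\| : \varphi\in\mathcal D(G),\ \|\varphi\|=1\}=0$, and likewise for $G'$. A state is a positive trace-class operator of unit trace; $\operatorname{Tr}G\rho\in[0,+\infty]$ denotes $\sum_i\|\sqrt G\varphi_i\|^2$ for any decomposition $\rho=\sum_i|\varphi_i\rangle\langle\varphi_i|$ (with the value $+\infty$ if some $\varphi_i\notin\mathcal D(\sqrt G)$). Let $\mathfrak B_G(\mathcal H)$ be the space of $\sqrt G$-bounded operators, i.e. linear operators $A:\mathcal D(\sqrt G)\to\mathcal H$ with $\|A\varphi\|^2\le a^2\|\varphi\|^2+b^2\|\sqrt G\varphi\|^2$ for all $\varphi\in\mathcal D(\sqrt G)$ and some $a,b\ge0$ (bounded operators are identified with their restrictions to $\mathcal D(\sqrt G)$); the $\sqrt G$-bound $b_{\sqrt G}(A)$ is the infimum of the admissible $b$. For $E\ge 0$ put $$\|A\|_E^G=\sup\Big\{\sqrt{\operatorname{Tr}A\rho A^*}\ :\ \rho\text{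 a state},\ \operatorname{Tr}G\rho\le E\Big\},\qquad \operatorname{Tr}A\rho A^*=\sum_i\|A\varphi_i\|^2 ,$$ with $\sup\emptyset=0$. For $E>0$ these are equivalent norms on $\mathfrak B_G(\mathcal H)$. Use the same notation for $G'$. Let $\Phi:\mathfrak B(\mathcal H)\to\mathfrak B(\mathcal H')$ be a normal completely positive linear map with $\Phi(I_{\mathcal H})\le I_{\mathcal H'}$, with predual $\Phi_*$ given by $\operatorname{Tr}\Phi_*(\rho)A=\operatorname{Tr}\Phi(A)\rho$. Put $Y_\Phi(E)=\sup\{\operatorname{Tr}G\Phi_*(\rho):\rho\text{ a state on }\mathcal H',\ \operatorname{Tr}G'\rho\le E\}$. The map $\Phi$ is called $GG'$-limited if $\operatorname{Tr}G\Phi_*(\rho)<+\infty$ for every state $\rho$ on $\mathcal H'$ with $\operatorname{Tr}G'\rho<+\infty$. A Stinespring representation of $\Phi$ is a separable Hilbert space $\mathcal K$ with a bounded $V:\mathcal H'\to\mathcal H\otimes\mathcal K$ such that $\Phi(A)=V^*(A\otimes I_{\mathcal K})V$ for all $A\in\mathfrak B(\mathcal H)$; it is minimal if the vectors $(A\otimes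 I_{\mathcal K})V\varphi$ span a dense subspace, and then $\dim\mathcal K$ is the Choi rank of $\Phi$. For $A\in\mathfrak B_G(\mathcal H)$, $A\otimes I_{\mathcal K}$ denotes the unique $\sqrt G\otimes I_{\mathcal K}$-bounded linear operator on $\mathcal D(\sqrt G\otimes I_{\mathcal K})$ with $\varphi\otimes\psi\mapsto A\varphi\otimes\psi$ for $\varphi\in\mathcal D(\sqrt G)$, $\psi\in\mathcal K$. The operator $G$ is called discrete if $G=\sum_{k\ge0}E_k|\tau_k\rangle\langle\tau_k|$ with $\mathcal D(G)=\{\varphi:\sum_kE_k^2|\langle\tau_k|\varphi\rangle|^2<\infty\}$ for an orthonormal basis $(\tau_k)_{k\ge0}$ and a nondecreasing sequence $E_k\to+\infty$. **A)** If $\Phi$ is $GG'$-limited, then for every $E>0$ it is continuous from $(\mathfrak B(\mathcal H),\|\cdot\|_E^G)$ to $(\mathfrak B(\mathcal H'),\|\cdot\|_E^{G'})$ and $Y_\Phi(E)<+\infty$. Moreover, $\Phi$ has a Stinespring representation, every Stinespring representation $(\mathcal K,V)$ satisfies $V\mathcal D(\sqrt{G'})\subseteq\mathcal D(\sqrt G\otimes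 I_{\mathcal K})$, and all of them define, by $$\Phi(A)\varphi=V^*(A\otimes I_{\mathcal K})V\varphi,\qquad A\in\mathfrak B_G(\mathcal H),\ \varphi\in\mathcal D(\sqrt{G'}),$$ one and the same linear operator $\Phi:\mathfrak B_G(\mathcal H)\to\mathfrak B_{G'}(\mathcal H')$. It extends the original map and is bounded: for all $A\in\mathfrak B_G(\mathcal H)$ and $E>0$, $$\|\Phi(A)\|_E^{G'}\le\sqrt{\|\Phi(I_{\mathcal H})\|}\,\|A\|^G_{Y_\Phi(E)}\le\sqrt{\max\{1,Y_\Phi(E)/E\}\,\|\Phi(I_{\mathcal H})\|}\,\|A\|_E^G .$$ The limit $k_\Phi=\lim_{E\to+\infty}Y_\Phi(E)/E$ exists and is finite, and $$b_{\sqrt{G'}}(\Phi(A))\le\sqrt{k_\Phi\|\Phi(I_{\mathcal H})\|}\;b_{\sqrt G}(A)\qquad\text{for all }A\in\mathfrak B_G(\mathcal H);$$ in particular $b_{\sqrt G}(A)=0$ implies $b_{\sqrt{G'}}(\Phi(A))=0$. **B)** Let $G'$ be discrete, and suppose that either a) $\Phi$ has finite Choi rank, or b) $G$ is discrete and $\Phi(I_{\mathcal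 H})=\Phi(P)$ for some finite-rank projector $P\in\mathfrak B(\mathcal H)$. If for some $E>0$ the map $\Phi$ is continuous from $(\mathfrak B(\mathcal H),\|\cdot\|_E^G)$ to $(\mathfrak B(\mathcal H'),\|\cdot\|_E^{G'})$, then $\Phi$ is $GG'$-limited. -/

import Mathlib

open scoped InnerProductSpace TensorProduct ENNReal NNReal CStarAlgebra Topology

universe u v w

noncomputable section

/-! ## Positive self-adjoint operators and their square roots -/

/-- A positive semidefinite, densely defined, self-adjoint (in general unbounded) operator. -/
structure PosOp (H : Type*) [NormedAddCommGroup H] [InnerProductSpace ℂ H] [CompleteSpace H] where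
  op : H →ₗ.[ℂ] H
  dense_domain : Dense (op.domain : Set H)
  selfAdjoint : IsSelfAdjoint op
  nonneg : ∀ x : op.domain, 0 ≤ (⟪(x : H), op x⟫_ℂ).re

namespace PosOp

variable {H : Type*} [NormedAddCommGroup H] [InnerProductSpace ℂ H] [CompleteSpace H]

theorem mem_graph_iff_adjoint (G : PosOp H) (y z : H) :
    (y, z) ∈ G.op.graph ↔ ∀ a b, (a, b) ∈ G.op.graph → ⟪b, y⟫_ℂ = ⟪a, z⟫_ℂ := by
  have h : G.op.adjoint.graph = G.op.graph.adjoint :=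
    LinearPMap.adjoint_graph_eq_graph_adjoint G.dense_domain
  rw [LinearPMap.isSelfAdjoint_def.1 G.selfAdjoint] at h
  conv_lhs => rw [h]
  simp [Submodule.mem_adjoint_iff, sub_eq_zero]

theorem graph_inner_symm (G : PosOp H) {x y x' y' : H} (h : (x, y) ∈ G.op.graph)
    (h' : (x', y') ∈ G.op.graph) : ⟪y, x'⟫_ℂ = ⟪x, y'⟫_ℂ :=
  (G.mem_graph_iff_adjoint x' y').1 h' x y h

theorem graph_inner_nonneg (G : PosOp H) {x y : H} (h : (x, y) ∈ G.op.graph) :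
    0 ≤ (⟪x, y⟫_ℂ).re := by
  rw [LinearPMap.mem_graph_iff] at h
  obtain ⟨u, rfl, rfl⟩ := h
  exact G.nonneg u

theorem graph_norm_le (G : PosOp H) {x y : H} (h : (x, y) ∈ G.op.graph) :
    ‖x‖ ≤ ‖x + y‖ ∧ ‖y‖ ≤ ‖x + y‖ := by
  have h1 := G.graph_inner_nonneg h
  have h2 : ‖x + y‖ ^ 2 = ‖x‖ ^ 2 + 2 * (⟪x, y⟫_ℂ).re + ‖y‖ ^ 2 := by
    simpa using norm_add_sq (𝕜 := ℂ) x y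
  constructor
  · exact le_of_sq_le_sq (by nlinarith [sq_nonneg ‖y‖]) (norm_nonneg _)
  · exact le_of_sq_le_sq (by nlinarith [sq_nonneg ‖x‖]) (norm_nonneg _)

/-- The resolvent `(1 + G)⁻¹`. -/
theorem exists_resolvent (G : PosOp H) : ∃ R : H →L[ℂ] H,
    ∀ x y, (x, y) ∈ G.op.graph ↔ R (x + y) = x := by
  have hcl : IsClosed (G.op.graph : Set (H × H)) := IsSelfAdjoint.isClosed G.selfAdjoint
  have : CompleteSpace G.op.graph := hcl.completeSpace_coe
  let f : G.op.graph →L[ℂ] H :=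
    (ContinuousLinearMap.fst ℂ H H + ContinuousLinearMap.snd ℂ H H).comp G.op.graph.subtypeL
  have hf : ∀ p : G.op.graph, f p = p.1.1 + p.1.2 := fun p => rfl
  have hanti : AntilipschitzWith 1 f := by
    refine AddMonoidHomClass.antilipschitz_of_bound f fun p => ?_
    obtain ⟨⟨x, y⟩, hp⟩ := p
    have := G.graph_norm_le hp
    simpa [hf, Prod.norm_def] using this
  have hclr : IsClosed (Set.range f) := hanti.isClosed_range f.uniformContinuous
  have hrange : (f : G.op.graph →ₗ[ℂ] H).range = ⊤ := by
    have hc : ((f : G.op.graph →ₗ[ℂ] H).range).topologicalClosure = (f : G.op.graph →ₗ[ℂ] H).range :=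
      IsClosed.submodule_topologicalClosure_eq (by rw [LinearMap.coe_range]; exact hclr)
    rw [← hc, Submodule.topologicalClosure_eq_top_iff, Submodule.eq_bot_iff]
    intro z hz
    rw [Submodule.mem_orthogonal] at hz
    have hzg : (z, -z) ∈ G.op.graph := by
      rw [mem_graph_iff_adjoint]
      intro a b hab
      have := hz (a + b) ⟨⟨(a, b), hab⟩, rfl⟩
      rw [inner_add_left] at this
      rw [inner_neg_right]
      linear_combination this
    have h1 := G.graph_inner_nonneg hzg
    rw [inner_neg_right, Complex.neg_re] at h1
    have h2 : (⟪z, z⟫_ℂ).re = ‖z‖ ^ 2 := by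
      simpa using inner_self_eq_norm_sq (𝕜 := ℂ) z
    have : ‖z‖ ^ 2 ≤ 0 := by linarith
    simpa using this
  have hker : (f : G.op.graph →ₗ[ℂ] H).ker = ⊥ := LinearMap.ker_eq_bot.2 hanti.injective
  let e := ContinuousLinearEquiv.ofBijective f hker hrange
  have he : ∀ p : G.op.graph, e p = f p := fun p => rfl
  refine ⟨(ContinuousLinearMap.fst ℂ H H).comp (G.op.graph.subtypeL.comp
    (e.symm : H →L[ℂ] G.op.graph)), fun x y => ?_⟩
  have hval : ((ContinuousLinearMap.fst ℂ H H).comp (G.op.graph.subtypeL.comp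
    (e.symm : H →L[ℂ] G.op.graph))) (x + y) = (e.symm (x + y)).1.1 := rfl
  rw [hval]
  have h1 : (e.symm (x + y)).1.1 + (e.symm (x + y)).1.2 = x + y := by
    rw [← hf, ← he, e.apply_symm_apply]
  constructor
  · intro h
    have : e.symm (x + y) = ⟨(x, y), h⟩ := by
      rw [ContinuousLinearEquiv.symm_apply_eq, he, hf]
    rw [this]
  · intro h
    have h2 : (e.symm (x + y)).1.2 = y := by
      rw [h] at h1; exact add_left_cancel h1
    have h3 : ((e.symm (x + y)).1.1, (e.symm (x + y)).1.2) ∈ G.op.graph := (e.symm (x + y)).2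
    rwa [h, h2] at h3

/-- Existence of the positive self-adjoint square root. -/
theorem exists_sqrt (G : PosOp H) : ∃ S : PosOp H, ∀ x y : H,
    (x, y) ∈ G.op.graph ↔ ∃ z, (x, z) ∈ S.op.graph ∧ (z, y) ∈ S.op.graph := by
  obtain ⟨R, hR⟩ := G.exists_resolvent
  have hRg : ∀ h, (R h, h - R h) ∈ G.op.graph := fun h => by rw [hR]; simp
  have real_of_symm : ∀ x y : H, ⟪x, y⟫_ℂ = ⟪y, x⟫_ℂ → (((⟪x, y⟫_ℂ).re : ℝ) : ℂ) = ⟪x, y⟫_ℂ := by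
    intro x y h
    rw [← Complex.conj_eq_iff_re, inner_conj_symm, h]
  have hself : ∀ x : H, (⟪x, x⟫_ℂ).re = ‖x‖ ^ 2 := fun x => by
    simpa using inner_self_eq_norm_sq (𝕜 := ℂ) x
  have hRpos : 0 ≤ R := by
    rw [ContinuousLinearMap.nonneg_iff_isPositive, ContinuousLinearMap.isPositive_iff_complex]
    intro h
    have hg := hRg h
    have e1 : ⟪R h, h⟫_ℂ = ⟪R h, R h⟫_ℂ + ⟪R h, h - R h⟫_ℂ := by
      rw [← inner_add_right]; simp
    have e2 : ⟪h, R h⟫_ℂ = ⟪R h, R h⟫_ℂ + ⟪h - R h, R h⟫_ℂ := by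
      rw [← inner_add_left]; simp
    refine ⟨real_of_symm _ _ ?_, ?_⟩
    · rw [e1, e2, G.graph_inner_symm hg hg]
    · change 0 ≤ (⟪R h, h⟫_ℂ).re
      rw [e1, Complex.add_re, hself]
      have := G.graph_inner_nonneg hg
      positivity
  have hRpos' : 0 ≤ 1 - R := by
    rw [ContinuousLinearMap.nonneg_iff_isPositive, ContinuousLinearMap.isPositive_iff_complex]
    intro h
    have hg := hRg h
    have e0 : (1 - R) h = h - R h := rfl
    rw [e0]
    have e1 : ⟪h - R h, h⟫_ℂ = ⟪h - R h, h - R h⟫_ℂ + ⟪h - R h, R h⟫_ℂ := by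
      rw [← inner_add_right, sub_add_cancel]
    have e2 : ⟪h, h - R h⟫_ℂ = ⟪h - R h, h - R h⟫_ℂ + ⟪R h, h - R h⟫_ℂ := by
      rw [← inner_add_left, sub_add_cancel]
    refine ⟨real_of_symm _ _ ?_, ?_⟩
    · rw [e1, e2, G.graph_inner_symm hg hg]
    · change 0 ≤ (⟪h - R h, h⟫_ℂ).re
      rw [e1, G.graph_inner_symm hg hg, Complex.add_re, hself]
      have := G.graph_inner_nonneg hg
      positivity
  set r := CFC.sqrt R with hr
  set c := CFC.sqrt (1 - R) with hc
  set q := CFC.sqrt r with hq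
  have hr0 : 0 ≤ r := CFC.sqrt_nonneg R
  have hc0 : 0 ≤ c := CFC.sqrt_nonneg _
  have hq0 : 0 ≤ q := CFC.sqrt_nonneg _
  have hrr : r * r = R := CFC.sqrt_mul_sqrt_self R hRpos
  have hcc : c * c = 1 - R := CFC.sqrt_mul_sqrt_self _ hRpos'
  have hqq : q * q = r := CFC.sqrt_mul_sqrt_self r hr0
  have comm_sqrt : ∀ a b : H →L[ℂ] H, Commute a b → Commute (CFC.sqrt a) b :=
    fun a b h => Commute.cfcₙ_nnreal h _
  have hcomm0 : Commute (1 - R) R := (Commute.one_left R).sub_left (Commute.refl R)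
  have hcomm : Commute r c := comm_sqrt _ _ (comm_sqrt _ _ hcomm0).symm
  have hcommq : Commute q c := comm_sqrt _ _ hcomm
  have sym : ∀ a : H →L[ℂ] H, 0 ≤ a → ∀ x y, ⟪a x, y⟫_ℂ = ⟪x, a y⟫_ℂ := fun a ha x y =>
    ((ContinuousLinearMap.nonneg_iff_isPositive a).1 ha).isSymmetric x y
  have hrrx : ∀ x, r (r x) = R x := fun x => congrArg (fun T : H →L[ℂ] H => T x) hrr
  have hccx : ∀ x, c (c x) = x - R x := fun x => congrArg (fun T : H →L[ℂ] H => T x) hcc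
  have hrcx : ∀ x, r (c x) = c (r x) := fun x => congrArg (fun T : H →L[ℂ] H => T x) hcomm.eq
  have hqcx : ∀ x, q (c x) = c (q x) := fun x => congrArg (fun T : H →L[ℂ] H => T x) hcommq.eq
  have hqqx : ∀ x, q (q x) = r x := fun x => congrArg (fun T : H →L[ℂ] H => T x) hqq
  have hRinj : ∀ x, R x = 0 → x = 0 := fun x hx => by
    have := hRg x
    rw [hx, sub_zero] at this
    exact G.op.graph_fst_eq_zero_snd this rfl
  have hrinj : ∀ x, r x = 0 → x = 0 := fun x hx => hRinj x (by rw [← hrrx, hx, map_zero])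
  let g : Submodule ℂ (H × H) := ((r.prod c : H →L[ℂ] H × H) : H →ₗ[ℂ] H × H).range
  have hg : ∀ x y, (x, y) ∈ g ↔ ∃ w, r w = x ∧ c w = y := fun x y => by
    simp [g, LinearMap.mem_range]
  have hgf : g.toLinearPMap.graph = g := by
    refine Submodule.toLinearPMap_graph_eq g ?_
    rintro ⟨x, y⟩ hxy hx
    obtain ⟨w, hw1, hw2⟩ := (hg x y).1 hxy
    simp only at hx
    have : w = 0 := hrinj w (hw1.trans hx)
    rw [← hw2, this, map_zero]
  have hdense : Dense (g.toLinearPMap.domain : Set H) := by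
    rw [Submodule.dense_iff_topologicalClosure_eq_top, Submodule.topologicalClosure_eq_top_iff,
      Submodule.eq_bot_iff]
    intro z hz
    rw [Submodule.mem_orthogonal] at hz
    have hmem : r (r z) ∈ g.toLinearPMap.domain := by
      rw [Submodule.toLinearPMap_domain]
      exact ⟨(r (r z), c (r z)), (hg _ _).2 ⟨r z, rfl, rfl⟩, rfl⟩
    have h1 := hz _ hmem
    rw [sym r hr0, inner_self_eq_zero] at h1
    exact hrinj z h1
  let S : PosOp H :=
    { op := g.toLinearPMap
      dense_domain := hdense
      selfAdjoint := by
        rw [LinearPMap.isSelfAdjoint_def]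
        apply LinearPMap.eq_of_eq_graph
        rw [LinearPMap.adjoint_graph_eq_graph_adjoint hdense, hgf]
        ext ⟨y, z⟩
        rw [Submodule.mem_adjoint_iff, hg]
        constructor
        · intro h
          have h1 : c y = r z := by
            refine ext_inner_left ℂ fun x => ?_
            have := h (r x) (c x) ((hg _ _).2 ⟨x, rfl, rfl⟩)
            rw [sub_eq_zero, sym c hc0, sym r hr0] at this
            exact this
          refine ⟨r y + c z, ?_, ?_⟩
          · rw [map_add, hrrx, hrcx, ← h1, hccx]; simp
          · rw [map_add, ← hrcx, h1, hrrx, hccx]; simp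
        · rintro ⟨w, rfl, rfl⟩ a b hab
          obtain ⟨v, rfl, rfl⟩ := (hg _ _).1 hab
          rw [sym c hc0, sym r hr0, hrcx, sub_self]
      nonneg := by
        intro x
        have hx : ((x : H), g.toLinearPMap x) ∈ g := hgf.le (LinearPMap.mem_graph _ x)
        obtain ⟨w, hw1, hw2⟩ := (hg _ _).1 hx
        rw [← hw1, ← hw2, ← hqqx, sym q hq0, hqcx]
        have := ((ContinuousLinearMap.nonneg_iff_isPositive c).1 hc0).re_inner_nonneg_right (q w)
        exact this }
  have hS : S.op.graph = g := hgf
  refine ⟨S, fun x y => ?_⟩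
  rw [hS, hR]
  constructor
  · intro h
    refine ⟨c (r (x + y)), (hg _ _).2 ⟨r (x + y), by rw [hrrx, h], rfl⟩,
      (hg _ _).2 ⟨c (x + y), by rw [hrcx], ?_⟩⟩
    rw [hccx, h]; simp
  · rintro ⟨z, h1, h2⟩
    obtain ⟨u, rfl, rfl⟩ := (hg _ _).1 h1
    obtain ⟨v, hv1, rfl⟩ := (hg _ _).1 h2
    have hu : u = r (r u + c v) := by
      rw [map_add, hrrx, hrcx, hv1, hccx]; simp
    have hv : v = c (r u + c v) := by
      rw [map_add, ← hrcx, ← hv1, hrrx, hccx]; simp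
    have hR2 : R (r u + c v) = r u := by
      rw [← hrrx, ← hu]
    exact hR2

/-- The square root `√G`: the positive self-adjoint operator `S` with `S² = G`
(as operators with domains). -/
def sqrt (G : PosOp H) : PosOp H := G.exists_sqrt.choose

theorem sqrt_spec (G : PosOp H) (x y : H) :
    (x, y) ∈ G.op.graph ↔ ∃ z, (x, z) ∈ G.sqrt.op.graph ∧ (z, y) ∈ G.sqrt.op.graph :=
  G.exists_sqrt.choose_spec x y

/-- `inf {‖G φ‖ : φ ∈ D(G), ‖φ‖ = 1} = 0`. -/
def InfZero (G : PosOp H) : Prop :=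
  IsGLB {t : ℝ | ∃ x : G.op.domain, ‖(x : H)‖ = 1 ∧ t = ‖G.op x‖} 0

/-- `G` is discrete: `G = ∑ₖ Eₖ |τₖ⟩⟨τₖ|` with its natural domain, for an orthonormal basis `τ`
and a nondecreasing sequence `E` tending to `+∞`. -/
def IsDiscrete (G : PosOp H) : Prop :=
  ∃ (τ : HilbertBasis ℕ ℂ H) (E : ℕ → ℝ), Monotone E ∧ Filter.Tendsto E Filter.atTop Filter.atTop ∧
    (∀ x : H, x ∈ G.op.domain ↔ Summable fun k => E k ^ 2 * ‖⟪τ k, x⟫_ℂ‖ ^ 2) ∧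
    ∀ x : G.op.domain, HasSum (fun k => ((E k : ℂ) * ⟪τ k, (x : H)⟫_ℂ) • τ k) (G.op x)

end PosOp

/-! ## Relatively bounded operators -/

section RelBounded

variable {X Y : Type*} [NormedAddCommGroup X] [InnerProductSpace ℂ X]
  [NormedAddCommGroup Y] [InnerProductSpace ℂ Y]

/-- `‖A φ‖² ≤ a² ‖φ‖² + b² ‖S φ‖²` for all `φ ∈ D(S)`. -/
def RelBoundWith (S : X →ₗ.[ℂ] X) (A : S.domain →ₗ[ℂ] Y) (a b : ℝ) : Prop :=
  ∀ x : S.domain, ‖A x‖ ^ 2 ≤ a ^ 2 * ‖(x : X)‖ ^ 2 + b ^ 2 * ‖S x‖ ^ 2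

/-- `A`, defined on `D(S)`, is relatively bounded with respect to `S`. -/
def IsRelBounded (S : X →ₗ.[ℂ] X) (A : S.domain →ₗ[ℂ] Y) : Prop :=
  ∃ a b : ℝ, 0 ≤ a ∧ 0 ≤ b ∧ RelBoundWith S A a b

/-- The relative bound of `A` with respect to `S`. -/
def relBound (S : X →ₗ.[ℂ] X) (A : S.domain →ₗ[ℂ] Y) : ℝ :=
  sInf {b : ℝ | 0 ≤ b ∧ ∃ a : ℝ, 0 ≤ a ∧ RelBoundWith S A a b}

/-- The space of `S`-bounded operators on `X`; operators that coincide on `D(S)` are identified. -/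
def relBoundedOps (S : X →ₗ.[ℂ] X) : Submodule ℂ (S.domain →ₗ[ℂ] X) where
  carrier := {A | IsRelBounded S A}
  zero_mem' := ⟨0, 0, le_rfl, le_rfl, fun x => by simp⟩
  add_mem' := by
    rintro A B ⟨a, b, ha, hb, hA⟩ ⟨a', b', ha', hb', hB⟩
    refine ⟨2 * (a + a'), 2 * (b + b'), by positivity, by positivity, fun x => ?_⟩
    have h1 := hA x
    have h2 := hB x
    have h3 : ‖(A + B) x‖ ^ 2 ≤ 2 * ‖A x‖ ^ 2 + 2 * ‖B x‖ ^ 2 := by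
      have h4 : ‖(A + B) x‖ ≤ ‖A x‖ + ‖B x‖ := norm_add_le _ _
      have h5 := norm_nonneg ((A + B) x)
      nlinarith [sq_nonneg (‖A x‖ - ‖B x‖)]
    have h6 : 2 * (a ^ 2 + a' ^ 2) ≤ (2 * (a + a')) ^ 2 := by nlinarith [mul_nonneg ha ha']
    have h7 : 2 * (b ^ 2 + b' ^ 2) ≤ (2 * (b + b')) ^ 2 := by nlinarith [mul_nonneg hb hb']
    have h8 := mul_le_mul_of_nonneg_right h6 (sq_nonneg ‖(x : X)‖)
    have h9 := mul_le_mul_of_nonneg_right h7 (sq_nonneg ‖S x‖)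
    linarith
  smul_mem' := by
    rintro t A ⟨a, b, ha, hb, hA⟩
    refine ⟨‖t‖ * a, ‖t‖ * b, by positivity, by positivity, fun x => ?_⟩
    have h1 := mul_le_mul_of_nonneg_left (hA x) (sq_nonneg ‖t‖)
    have h2 : ‖(t • A) x‖ = ‖t‖ * ‖A x‖ := by rw [LinearMap.smul_apply, norm_smul]
    rw [h2]
    linarith

/-- A bounded operator, restricted to `D(S)`. -/
def boundedRestrict (S : X →ₗ.[ℂ] X) (A : X →L[ℂ] X) : relBoundedOps S :=
  ⟨(A : X →ₗ[ℂ] X).domRestrict S.domain, ‖A‖, 0, norm_nonneg A, le_rfl, fun x => by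
    have h : ‖A (x : X)‖ ≤ ‖A‖ * ‖(x : X)‖ := A.le_opNorm x
    have h' := pow_le_pow_left₀ (norm_nonneg _) h 2
    rw [mul_pow] at h'
    simpa using h'⟩

end RelBounded

/-! ## Traces and states -/

section States

variable {H : Type*} [NormedAddCommGroup H] [InnerProductSpace ℂ H] [CompleteSpace H]

/-- An index set of a fixed orthonormal basis of `H`. -/
def onbIndex (H : Type*) [NormedAddCommGroup H] [InnerProductSpace ℂ H] [CompleteSpace H] : Set H :=
  (exists_hilbertBasis ℂ H).choose

/-- A fixed orthonormal basis of `H`. The traces below do not depend on it. -/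
def onb (H : Type*) [NormedAddCommGroup H] [InnerProductSpace ℂ H] [CompleteSpace H] :
    HilbertBasis (onbIndex H) ℂ H :=
  (exists_hilbertBasis ℂ H).choose_spec.choose

/-- The trace; used for trace-class operators only. -/
def opTrace (T : H →L[ℂ] H) : ℂ := ∑' i, ⟪onb H i, T (onb H i)⟫_ℂ

/-- The trace (finite or infinite) of a positive operator. -/
def posTrace (ρ : H →L[ℂ] H) : ℝ≥0∞ := ∑' i, ENNReal.ofReal (⟪onb H i, ρ (onb H i)⟫_ℂ).re

/-- A positive trace-class operator. -/
def IsPosTraceClass (ρ : H →L[ℂ] H) : Prop := ρ.IsPositive ∧ posTrace ρ ≠ ⊤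

/-- A state (density operator): a positive trace-class operator with unit trace. -/
def IsState (ρ : H →L[ℂ] H) : Prop := ρ.IsPositive ∧ posTrace ρ = 1

open Classical in
/-- `‖A φ‖²`, with the value `+∞` if `φ` is not in the domain of `A`. -/
def sqNormOp (A : H →ₗ.[ℂ] H) (x : H) : ℝ≥0∞ :=
  if h : x ∈ A.domain then ENNReal.ofReal (‖A ⟨x, h⟩‖ ^ 2) else ⊤

/-- `Tr A ρ A*`, computed as `∑ᵢ ‖A φᵢ‖²` from the decomposition `ρ = ∑ᵢ |φᵢ⟩⟨φᵢ|` with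
`φᵢ = ρ^{1/2} eᵢ`. -/
def trConj (A : H →ₗ.[ℂ] H) (ρ : H →L[ℂ] H) : ℝ≥0∞ :=
  ∑' i, sqNormOp A (CFC.sqrt ρ (onb H i))

namespace PosOp

/-- `Tr G ρ = Tr √G ρ √G`, finite or infinite. -/
def energy (G : PosOp H) (ρ : H →L[ℂ] H) : ℝ≥0∞ := trConj G.sqrt.op ρ

/-- The space of `√G`-bounded operators on `H`. -/
abbrev BG (G : PosOp H) : Submodule ℂ (G.sqrt.op.domain →ₗ[ℂ] H) := relBoundedOps G.sqrt.op

/-- The inclusion of the bounded operators into the `√G`-bounded ones. -/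
abbrev incl (G : PosOp H) (A : H →L[ℂ] H) : G.BG := boundedRestrict G.sqrt.op A

/-- The operator `E`-norm `sup {√(Tr A ρ A*) : ρ a state, Tr G ρ ≤ E}`. -/
def eNorm (G : PosOp H) (E : ℝ≥0∞) (A : G.BG) : ℝ≥0∞ :=
  ⨆ (ρ : H →L[ℂ] H) (_ : IsState ρ) (_ : G.energy ρ ≤ E),
    (trConj ⟨G.sqrt.op.domain, A.1⟩ ρ) ^ (1 / 2 : ℝ)

/-- The `√G`-bound of a `√G`-bounded operator. -/
def bound (G : PosOp H) (A : G.BG) : ℝ := relBound G.sqrt.op A.1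

end PosOp

end States

/-! ## Maps between algebras of bounded operators -/

section Maps

variable {H H' : Type*} [NormedAddCommGroup H] [InnerProductSpace ℂ H] [CompleteSpace H]
  [NormedAddCommGroup H'] [InnerProductSpace ℂ H'] [CompleteSpace H']

/-- Normality: suprema of increasing nets are preserved. -/
def IsNormalMap (Φ : (H →L[ℂ] H) →CP (H' →L[ℂ] H')) : Prop :=
  ∀ s : Set (H →L[ℂ] H), s.Nonempty → DirectedOn (· ≤ ·) s →
    ∀ A, IsLUB s A → IsLUB (Φ '' s) (Φ A)

open Classical in
/-- The predual map on positive trace-class operators: `Φ_*(ρ)` is the positive trace-class operator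
`σ` with `Tr σ A = Tr Φ(A) ρ` for all bounded `A`. For normal completely positive `Φ` it exists
and is unique. -/
def predual (Φ : (H →L[ℂ] H) →CP (H' →L[ℂ] H')) (ρ : H' →L[ℂ] H') : H →L[ℂ] H :=
  if h : ∃ σ : H →L[ℂ] H, IsPosTraceClass σ ∧ ∀ A : H →L[ℂ] H, opTrace (σ * A) = opTrace (Φ A * ρ)
  then h.choose else 0

/-- `Tr G Φ_*(ρ) < ∞` for every state `ρ` with `Tr G' ρ < ∞`. -/
def IsLimited (G : PosOp H) (G' : PosOp H') (Φ : (H →L[ℂ] H) →CP (H' →L[ℂ] H')) : Prop :=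
  ∀ ρ : H' →L[ℂ] H', IsState ρ → G'.energy ρ < ⊤ → G.energy (predual Φ ρ) < ⊤

/-- `Y_Φ(E) = sup {Tr G Φ_*(ρ) : ρ a state, Tr G' ρ ≤ E}`. -/
def outEnergy (G : PosOp H) (G' : PosOp H') (Φ : (H →L[ℂ] H) →CP (H' →L[ℂ] H')) (E : ℝ≥0) :
    ℝ≥0∞ :=
  ⨆ (ρ : H' →L[ℂ] H') (_ : IsState ρ) (_ : G'.energy ρ ≤ E), G.energy (predual Φ ρ)

/-- Continuity of `Φ` from `(B(H), ‖·‖_E^G)` to `(B(H'), ‖·‖_E^{G'})`. -/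
def IsENormContinuous (G : PosOp H) (G' : PosOp H') (Φ : (H →L[ℂ] H) →CP (H' →L[ℂ] H'))
    (E : ℝ≥0) : Prop :=
  ∀ A : H →L[ℂ] H, ∀ ε : ℝ≥0∞, 0 < ε → ∃ δ : ℝ≥0∞, 0 < δ ∧ ∀ B : H →L[ℂ] H,
    G.eNorm E (G.incl (B - A)) < δ → G'.eNorm E (G'.incl (Φ B - Φ A)) < ε

/-! ### Stinespring representations -/

/-- The Hilbert space tensor product `H ⊗ K`. -/
abbrev HTensor (H K : Type*) [NormedAddCommGroup H] [InnerProductSpace ℂ H]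
    [NormedAddCommGroup K] [InnerProductSpace ℂ K] : Type _ :=
  UniformSpace.Completion (H ⊗[ℂ] K)

variable {K : Type*} [NormedAddCommGroup K] [InnerProductSpace ℂ K]

/-- The vector `x ⊗ y`. -/
def tens (x : H) (y : K) : HTensor H K := ((x ⊗ₜ[ℂ] y : H ⊗[ℂ] K) : HTensor H K)

variable (K) in
/-- `A ⊗ I_K` for a bounded operator `A`. -/
def ampl (A : H →L[ℂ] H) : HTensor H K →L[ℂ] HTensor H K := (A.rTensor K).completion

/-- `Φ(A) = V* (A ⊗ I_K) V` for all bounded `A`. -/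
def IsStinespring (Φ : (H →L[ℂ] H) →CP (H' →L[ℂ] H')) (V : H' →L[ℂ] HTensor H K) : Prop :=
  ∀ A : H →L[ℂ] H, Φ A = (ContinuousLinearMap.adjoint V).comp ((ampl K A).comp V)

/-- The vectors `(A ⊗ I_K) V φ` span a dense subspace. -/
def IsMinimalDilation (V : H' →L[ℂ] HTensor H K) : Prop :=
  Dense (Submodule.span ℂ {ξ : HTensor H K | ∃ (A : H →L[ℂ] H) (x : H'), ξ = ampl K A (V x)} :
    Set (HTensor H K))

/-- `Φ` has finite Choi rank: the space `K` of a minimal Stinespring representation is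
finite-dimensional. -/
def HasFiniteChoiRank (Φ : (H →L[ℂ] H) →CP (H' →L[ℂ] H')) : Prop :=
  ∃ (K : Type) (_ : NormedAddCommGroup K) (_ : InnerProductSpace ℂ K)
    (V : H' →L[ℂ] HTensor H K),
    FiniteDimensional ℂ K ∧ IsStinespring Φ V ∧ IsMinimalDilation V

variable (K) in
/-- The unbounded operator `S ⊗ I_K`: its graph is the closure of the span of the pairs
`(x ⊗ y, S x ⊗ y)`, `x ∈ D(S)`, `y ∈ K`. -/
def amplPMap (S : H →ₗ.[ℂ] H) : HTensor H K →ₗ.[ℂ] HTensor H K :=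
  (Submodule.span ℂ {p : HTensor H K × HTensor H K |
    ∃ (x : S.domain) (y : K), p = (tens (x : H) y, tens (S x) y)}).topologicalClosure.toLinearPMap

/-- `T` is the `S ⊗ I_K`-bounded extension to `D(S ⊗ I_K)` of the operator `A ⊗ I_K`, which is
defined on the algebraic tensor product of `D(S)` and `K`. -/
def IsAmplExtension (S : H →ₗ.[ℂ] H) (A : S.domain →ₗ[ℂ] H)
    (T : (amplPMap K S).domain →ₗ[ℂ] HTensor H K) : Prop :=
  IsRelBounded (amplPMap K S) T ∧
    ∀ (x : S.domain) (y : K) (h : tens (x : H) y ∈ (amplPMap K S).domain),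
      T ⟨tens (x : H) y, h⟩ = tens (A x) y

/-- `Ψ(A) φ = V* (A ⊗ I_K) V φ` for every `√G`-bounded `A` and `φ ∈ D(√G')`; in particular `V`
maps `D(√G')` into `D(√G ⊗ I_K)`. -/
def IsInducedBy (G : PosOp H) (G' : PosOp H') (V : H' →L[ℂ] HTensor H K)
    (Ψ : G.BG →ₗ[ℂ] G'.BG) : Prop :=
  ∀ A : G.BG, ∃ T : (amplPMap K G.sqrt.op).domain →ₗ[ℂ] HTensor H K,
    IsAmplExtension G.sqrt.op A.1 T ∧
    ∀ x : G'.sqrt.op.domain, ∃ h : V (x : H') ∈ (amplPMap K G.sqrt.op).domain,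
      (Ψ A).1 x = ContinuousLinearMap.adjoint V (T ⟨V (x : H'), h⟩)

end Maps

end

/-!
The resolvent `(1 + G)⁻¹` replaces the spectral theorem: with `D := (1 - (1 + G)⁻¹)^(1/2)`, a
positive contraction, `‖√G x‖² = ∑ⱼ ‖D ^ (j + 1) x‖²`, and the bounded operators
`A (1 - D ^ (2 n))` converge strongly on `D(√G)` to a `√G`-bounded operator `A`.

An orthonormal basis `f` of the environment of a Stinespring representation `V` gives slices
`V_k := (I ⊗ ⟨f_k|) V` with `Φ_* ρ = ∑ₖ V_k ρ V_k*`, so that the output energy of a family of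
vectors `φᵢ` is `∑ᵢₖ ‖√G V_k φᵢ‖²`. For a limited map it is bounded on states of bounded energy,
since states violating every bound could be mixed into one of infinite output energy; hence
`V D(√G') ⊆ D(√G ⊗ I)`, and the induced map is controlled by `Y_Φ`. It does not depend on `V`,
being the limit of `Φ` on bounded truncations.

Conversely, applying a continuous `Φ` to the operators `|η⟩⟨√G d|`, whose `E`-norm is at most
`‖η‖ ‖d‖ √E`, shows by duality that a slice along any vector reached by `V` maps `D(√G')`
boundedly into `D(√G)`. Finitely many such slices, or slices with values in a fixed
finite-dimensional space, suffice for a finite output energy.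
-/

noncomputable section

section SqNorm

variable {H : Type*} [NormedAddCommGroup H]

theorem ofReal_norm_sq (x : H) : ENNReal.ofReal (‖x‖ ^ 2) = ‖x‖ₑ ^ 2 := by
  rw [ENNReal.ofReal_pow (norm_nonneg _), ofReal_norm]

variable [InnerProductSpace ℂ H] {A : H →ₗ.[ℂ] H} {x y : H}

theorem re_inner_self_eq_norm_sq (x : H) : (⟪x, x⟫_ℂ).re = ‖x‖ ^ 2 := by
  simpa using inner_self_eq_norm_sq (𝕜 := ℂ) x

theorem sqNormOp_of_mem (h : x ∈ A.domain) : sqNormOp A x = ‖A ⟨x, h⟩‖ₑ ^ 2 := by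
  rw [sqNormOp, dif_pos h, ofReal_norm_sq]

theorem sqNormOp_of_notMem (h : x ∉ A.domain) : sqNormOp A x = ⊤ := dif_neg h

theorem sqNormOp_of_mem_graph (h : (x, y) ∈ A.graph) : sqNormOp A x = ‖y‖ₑ ^ 2 := by
  have hx := LinearPMap.mem_domain_of_mem_graph h
  rw [sqNormOp_of_mem hx, (LinearPMap.image_iff hx).2 h]

theorem mem_domain_of_sqNormOp_ne_top (h : sqNormOp A x ≠ ⊤) : x ∈ A.domain :=
  not_imp_comm.1 sqNormOp_of_notMem h

theorem sqNormOp_ne_top_of_mem (h : x ∈ A.domain) : sqNormOp A x ≠ ⊤ := by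
  simp [sqNormOp_of_mem h]

theorem sqNormOp_zero (A : H →ₗ.[ℂ] H) : sqNormOp A 0 = 0 := by
  rw [sqNormOp_of_mem_graph A.graph.zero_mem]; simp

theorem sqNormOp_add_le (A : H →ₗ.[ℂ] H) (x y : H) :
    sqNormOp A (x + y) ≤ 2 * (sqNormOp A x + sqNormOp A y) := by
  by_cases hx : x ∈ A.domain
  · by_cases hy : y ∈ A.domain
    · have h : A ⟨x + y, add_mem hx hy⟩ = A ⟨x, hx⟩ + A ⟨y, hy⟩ := A.map_add ⟨x, hx⟩ ⟨y, hy⟩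
      rw [sqNormOp_of_mem (add_mem hx hy), sqNormOp_of_mem hx, sqNormOp_of_mem hy, h]
      have hnorm := (pow_le_pow_left₀ zero_le (nnnorm_add_le (A ⟨x, hx⟩) (A ⟨y, hy⟩)) 2).trans
        add_sq_le
      simp only [enorm_eq_nnnorm]
      exact_mod_cast hnorm
    · simp [sqNormOp_of_notMem hy]
  · simp [sqNormOp_of_notMem hx]

theorem sqNormOp_smul (A : H →ₗ.[ℂ] H) (c : ℂ) (x : H) :
    sqNormOp A (c • x) = ‖c‖ₑ ^ 2 * sqNormOp A x := by
  rcases eq_or_ne c 0 with rfl | hc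
  · simp [sqNormOp_zero]
  by_cases hx : x ∈ A.domain
  · have h : (c • x, c • A ⟨x, hx⟩) ∈ A.graph :=
      A.graph.smul_mem c (A.mem_graph ⟨x, hx⟩)
    rw [sqNormOp_of_mem_graph h, sqNormOp_of_mem hx, enorm_smul, mul_pow]
  · have hx' : c • x ∉ A.domain := fun h => hx (by
      simpa [smul_smul, inv_mul_cancel₀ hc] using A.domain.smul_mem c⁻¹ h)
    rw [sqNormOp_of_notMem hx', sqNormOp_of_notMem hx, ENNReal.mul_top]
    simpa using hc

end SqNorm

/-! ## Bounded truncations of a positive operator -/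

namespace PosOp

variable {H : Type*} [NormedAddCommGroup H] [InnerProductSpace ℂ H] [CompleteSpace H]

theorem mem_domain_of_norm_inner_le (S : PosOp H) {x : H} {c : ℝ}
    (h : ∀ d : S.op.domain, ‖⟪S.op d, x⟫_ℂ‖ ≤ c * ‖(d : H)‖) : x ∈ S.op.domain := by
  rw [← LinearPMap.isSelfAdjoint_def.1 S.selfAdjoint, LinearPMap.mem_adjoint_domain_iff]
  refine AddMonoidHomClass.continuous_of_bound ((innerₛₗ ℂ x).comp S.op.toFun) c fun d => ?_
  exact (norm_inner_symm _ _).trans_le (h d)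

theorem sqNormOp_le_of_norm_inner_le (S : PosOp H) {x : H} {c : ℝ≥0}
    (h : ∀ d : S.op.domain, ‖⟪S.op d, x⟫_ℂ‖ ≤ c * ‖(d : H)‖) : sqNormOp S.op x ≤ c ^ 2 := by
  have hx := S.mem_domain_of_norm_inner_le h
  set z := S.op ⟨x, hx⟩ with hz
  have hclosed : IsClosed {d : H | ‖⟪d, z⟫_ℂ‖ ≤ c * ‖d‖} :=
    isClosed_le (by fun_prop) (by fun_prop)
  have hdomain : (S.op.domain : Set H) ⊆ {d : H | ‖⟪d, z⟫_ℂ‖ ≤ c * ‖d‖} := by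
    intro d hd
    have hsymm := S.graph_inner_symm (S.op.mem_graph ⟨d, hd⟩) (S.op.mem_graph ⟨x, hx⟩)
    exact (congrArg norm hsymm).symm.trans_le (h ⟨d, hd⟩)
  have hself : ‖⟪z, z⟫_ℂ‖ ≤ c * ‖z‖ := closure_minimal hdomain hclosed (S.dense_domain z)
  have hnorm : ‖z‖ ≤ c := by
    rw [inner_self_eq_norm_sq_to_K] at hself
    norm_num at hself
    by_contra! hlt
    nlinarith [c.coe_nonneg]
  rw [sqNormOp_of_mem hx, ← hz]
  gcongr
  exact enorm_le_coe.2 hnorm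

/-- The resolvent `(1 + G)⁻¹`. -/
def resolvent (G : PosOp H) : H →L[ℂ] H := G.exists_resolvent.choose

theorem mem_graph_iff_resolvent (G : PosOp H) (x y : H) :
    (x, y) ∈ G.op.graph ↔ G.resolvent (x + y) = x :=
  G.exists_resolvent.choose_spec x y

theorem resolvent_mem_graph (G : PosOp H) (x : H) :
    (G.resolvent x, x - G.resolvent x) ∈ G.op.graph := by
  rw [mem_graph_iff_resolvent, add_sub_cancel]

theorem re_inner_sub_resolvent_nonneg (G : PosOp H) (x : H) :
    0 ≤ (⟪x, x - G.resolvent x⟫_ℂ).re := by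
  have h : ⟪x, x - G.resolvent x⟫_ℂ = ⟪x - G.resolvent x, x - G.resolvent x⟫_ℂ +
      ⟪G.resolvent x, x - G.resolvent x⟫_ℂ := by
    rw [← inner_add_left, sub_add_cancel]
  rw [h, Complex.add_re, re_inner_self_eq_norm_sq]
  have := G.graph_inner_nonneg (G.resolvent_mem_graph x)
  positivity

theorem one_sub_resolvent_nonneg (G : PosOp H) : 0 ≤ 1 - G.resolvent := by
  rw [ContinuousLinearMap.nonneg_iff_isPositive, ContinuousLinearMap.isPositive_def]
  refine ⟨fun x y => ?_, fun x => ?_⟩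
  · change ⟪x - G.resolvent x, y⟫_ℂ = ⟪x, y - G.resolvent y⟫_ℂ
    have h := G.graph_inner_symm (G.resolvent_mem_graph x) (G.resolvent_mem_graph y)
    calc ⟪x - G.resolvent x, y⟫_ℂ
        = ⟪x - G.resolvent x, G.resolvent y⟫_ℂ +
          ⟪x - G.resolvent x, y - G.resolvent y⟫_ℂ := by rw [← inner_add_right, add_sub_cancel]
      _ = ⟪x, y - G.resolvent y⟫_ℂ := by rw [h, ← inner_add_left, add_sub_cancel]
  · change 0 ≤ (⟪x - G.resolvent x, x⟫_ℂ).re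
    rw [← inner_conj_symm, Complex.conj_re]
    exact G.re_inner_sub_resolvent_nonneg x

/-- The positive contraction `D` with `D ^ 2 = 1 - (1 + G)⁻¹`. Its powers take the place of a
spectral resolution of `G`: formally `G = ∑ⱼ D ^ (2 * (j + 1))`, and `1 - D ^ (2 * n)` maps into
the domain of `G`. -/
def root (G : PosOp H) : H →L[ℂ] H := CFC.sqrt (1 - G.resolvent)

theorem root_mul_self (G : PosOp H) : G.root * G.root = 1 - G.resolvent :=
  CFC.sqrt_mul_sqrt_self _ G.one_sub_resolvent_nonneg

theorem root_isSelfAdjoint (G : PosOp H) : IsSelfAdjoint G.root :=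
  IsSelfAdjoint.of_nonneg (CFC.sqrt_nonneg _)

theorem inner_root_pow (G : PosOp H) (m n : ℕ) (x : H) :
    ⟪(G.root ^ m) x, (G.root ^ n) x⟫_ℂ = ⟪x, (G.root ^ (m + n)) x⟫_ℂ := by
  rw [pow_add]
  exact ((G.root_isSelfAdjoint.pow m).isSymmetric) x ((G.root ^ n) x)

theorem re_inner_root_pow (G : PosOp H) {m n k : ℕ} (h : m + n = 2 * k) (x : H) :
    (⟪(G.root ^ m) x, (G.root ^ n) x⟫_ℂ).re = ‖(G.root ^ k) x‖ ^ 2 := by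
  rw [inner_root_pow, h, two_mul, ← inner_root_pow, re_inner_self_eq_norm_sq]

theorem norm_root_apply_le (G : PosOp H) (x : H) : ‖G.root x‖ ≤ ‖x‖ := by
  have hsq : ‖G.root x‖ ^ 2 = (⟪x, x - G.resolvent x⟫_ℂ).re := by
    have h := G.re_inner_root_pow (m := 0) (n := 2) (k := 1) rfl x
    rw [pow_one, sq, root_mul_self] at h
    exact h.symm
  have hle : ‖x - G.resolvent x‖ ≤ ‖x‖ := by
    simpa using (G.graph_norm_le (G.resolvent_mem_graph x)).2
  refine le_of_sq_le_sq ?_ (norm_nonneg x)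
  calc ‖G.root x‖ ^ 2 ≤ ‖x‖ * ‖x - G.resolvent x‖ :=
        hsq.trans_le (re_inner_le_norm (𝕜 := ℂ) x _)
    _ ≤ ‖x‖ * ‖x‖ := by gcongr
    _ = ‖x‖ ^ 2 := (sq _).symm

theorem norm_root_pow_apply_le (G : PosOp H) (n : ℕ) (x : H) : ‖(G.root ^ n) x‖ ≤ ‖x‖ := by
  induction n with
  | zero => simp
  | succ n ih =>
    rw [pow_succ']
    exact (G.norm_root_apply_le _).trans ih

theorem root_pow_mem_graph (G : PosOp H) (n : ℕ) (x : H) :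
    (x - (G.root ^ (2 * n)) x, ∑ j ∈ Finset.range n, (G.root ^ (2 * (j + 1))) x) ∈ G.op.graph := by
  have htele : x - (G.root ^ (2 * n)) x + ∑ j ∈ Finset.range n, (G.root ^ (2 * (j + 1))) x =
      ∑ j ∈ Finset.range n, (G.root ^ (2 * j)) x := by
    have h := Finset.sum_range_succ' (fun j => (G.root ^ (2 * j)) x) n
    rw [Finset.sum_range_succ] at h
    simp only [mul_zero, pow_zero, one_apply_eq_self] at h
    rw [eq_sub_of_add_eq h]
    abel
  have hgeom : G.resolvent * ∑ j ∈ Finset.range n, (G.root ^ 2) ^ j = 1 - G.root ^ (2 * n) := by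
    rw [show G.resolvent = 1 - G.root ^ 2 by rw [sq, root_mul_self, sub_sub_cancel],
      mul_neg_geom_sum, pow_mul]
  rw [mem_graph_iff_resolvent, htele]
  simpa [pow_mul] using congrArg (fun T : H →L[ℂ] H => T x) hgeom

theorem re_inner_eq_norm_sqrt_sq (G : PosOp H) {x y z : H} (h : (x, y) ∈ G.op.graph)
    (hz : (x, z) ∈ G.sqrt.op.graph) : (⟪x, y⟫_ℂ).re = ‖z‖ ^ 2 := by
  obtain ⟨z', h1, h2⟩ := (G.sqrt_spec x y).1 h
  obtain rfl : z' = z := LinearPMap.mem_graph_snd_inj _ h1 hz rfl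
  rw [← G.sqrt.graph_inner_symm h1 h2, re_inner_self_eq_norm_sq]

/-- The increasing approximations of the quadratic form `‖√G x‖²` by bounded ones. -/
def truncForm (G : PosOp H) (n : ℕ) (x : H) : ℝ :=
  ∑ j ∈ Finset.range n, ‖(G.root ^ (j + 1)) x‖ ^ 2

theorem ofReal_truncForm (G : PosOp H) (n : ℕ) (x : H) :
    ENNReal.ofReal (G.truncForm n x) = ∑ j ∈ Finset.range n, ‖(G.root ^ (j + 1)) x‖ₑ ^ 2 := by
  rw [truncForm, ENNReal.ofReal_sum_of_nonneg fun _ _ => by positivity]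
  simp_rw [ofReal_norm_sq]

theorem truncForm_le_mul_norm_sq (G : PosOp H) (n : ℕ) (x : H) :
    G.truncForm n x ≤ n * ‖x‖ ^ 2 := by
  refine (Finset.sum_le_card_nsmul _ _ (‖x‖ ^ 2) fun j _ => ?_).trans (by simp)
  exact pow_le_pow_left₀ (norm_nonneg _) (G.norm_root_pow_apply_le _ x) 2

/-- The bounded operator `1 - D ^ (2 * n)`, where `D = G.root`, as a map into `D(√G)`; it tends
to the identity as `n` grows. -/
def truncation (G : PosOp H) (n : ℕ) : H →ₗ[ℂ] G.sqrt.op.domain :=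
  ((1 - G.root ^ (2 * n) : H →L[ℂ] H) : H →ₗ[ℂ] H).codRestrict _ fun x => by
    obtain ⟨z, hz, -⟩ := (G.sqrt_spec _ _).1 (G.root_pow_mem_graph n x)
    exact LinearPMap.mem_domain_of_mem_graph hz

theorem coe_truncation (G : PosOp H) (n : ℕ) (x : H) :
    (G.truncation n x : H) = x - (G.root ^ (2 * n)) x := rfl

theorem re_inner_sum_root_pow (G : PosOp H) (n : ℕ) (x : H) :
    (⟪x, ∑ j ∈ Finset.range n, (G.root ^ (2 * (j + 1))) x⟫_ℂ).re = G.truncForm n x := by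
  rw [inner_sum, Complex.re_sum]
  refine Finset.sum_congr rfl fun j _ => ?_
  simpa using G.re_inner_root_pow (m := 0) (n := 2 * (j + 1)) (k := j + 1) (zero_add _) x

theorem norm_sqrt_truncation_sq_le (G : PosOp H) (n : ℕ) (x : H) :
    ‖G.sqrt.op (G.truncation n x)‖ ^ 2 ≤ G.truncForm n x := by
  rw [← G.re_inner_eq_norm_sqrt_sq (G.root_pow_mem_graph n x)
    (G.sqrt.op.mem_graph (G.truncation n x)), inner_sub_left, Complex.sub_re, re_inner_sum_root_pow]
  refine sub_le_self _ ?_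
  rw [inner_sum, Complex.re_sum]
  refine Finset.sum_nonneg fun j _ => ?_
  rw [G.re_inner_root_pow (k := n + (j + 1)) (by ring)]
  positivity

theorem re_inner_sqrt_truncation (G : PosOp H) (n : ℕ) (x : G.sqrt.op.domain) :
    (⟪G.sqrt.op x, G.sqrt.op (G.truncation n x)⟫_ℂ).re = G.truncForm n x := by
  obtain ⟨z, h1, h2⟩ := (G.sqrt_spec _ _).1 (G.root_pow_mem_graph n x)
  obtain rfl : z = G.sqrt.op (G.truncation n x) :=
    LinearPMap.mem_graph_snd_inj _ h1 (G.sqrt.op.mem_graph _) rfl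
  rw [G.sqrt.graph_inner_symm (G.sqrt.op.mem_graph x) h2, re_inner_sum_root_pow]

theorem truncForm_le (G : PosOp H) (n : ℕ) (x : G.sqrt.op.domain) :
    G.truncForm n x ≤ ‖G.sqrt.op x‖ ^ 2 := by
  have hle := G.norm_sqrt_truncation_sq_le n x
  have hcs := re_inner_le_norm (𝕜 := ℂ) (G.sqrt.op x) (G.sqrt.op (G.truncation n x))
  rw [RCLike.re_eq_complex_re, re_inner_sqrt_truncation] at hcs
  nlinarith [sq_nonneg (‖G.sqrt.op x‖ - ‖G.sqrt.op (G.truncation n x)‖)]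

theorem tendsto_root_pow_of_tsum_ne_top (G : PosOp H) {x : H}
    (h : ∑' j : ℕ, ‖(G.root ^ (j + 1)) x‖ₑ ^ 2 ≠ ⊤) :
    Filter.Tendsto (fun n => (G.root ^ (2 * n)) x) Filter.atTop (𝓝 0) := by
  have hsq : Filter.Tendsto (fun n => ‖(G.root ^ n) x‖ₑ ^ 2) Filter.atTop (𝓝 0) :=
    (Filter.tendsto_add_atTop_iff_nat 1).1 (ENNReal.tendsto_atTop_zero_of_tsum_ne_top h)
  have hnorm : Filter.Tendsto (fun n => ‖(G.root ^ n) x‖) Filter.atTop (𝓝 0) := by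
    simpa using ((ENNReal.tendsto_toReal ENNReal.zero_ne_top).comp hsq).sqrt
  exact (tendsto_zero_iff_norm_tendsto_zero.2 hnorm).comp
    (Filter.tendsto_id.const_mul_atTop' zero_lt_two)

theorem sqNormOp_sqrt_le_tsum (G : PosOp H) (x : H) :
    sqNormOp G.sqrt.op x ≤ ∑' j : ℕ, ‖(G.root ^ (j + 1)) x‖ₑ ^ 2 := by
  obtain htop | htop := eq_or_ne (∑' j : ℕ, ‖(G.root ^ (j + 1)) x‖ₑ ^ 2) ⊤
  · exact htop ▸ le_top
  lift ∑' j : ℕ, ‖(G.root ^ (j + 1)) x‖ₑ ^ 2 to ℝ≥0 using htop with t ht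
  have hnorm : ∀ n, ‖G.sqrt.op (G.truncation n x)‖ ≤ NNReal.sqrt t := fun n => by
    have h : ENNReal.ofReal (G.truncForm n x) ≤ t := by
      rw [ofReal_truncForm, ht]
      exact ENNReal.sum_le_tsum _
    rw [Real.coe_sqrt]
    exact Real.le_sqrt_of_sq_le ((G.norm_sqrt_truncation_sq_le n x).trans
      (Real.toNNReal_le_iff_le_coe.1 (ENNReal.coe_le_coe.1 h)))
  have hlim : Filter.Tendsto (fun n => (G.truncation n x : H)) Filter.atTop (𝓝 x) := by
    simpa [coe_truncation] using (G.tendsto_root_pow_of_tsum_ne_top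
      (ht ▸ ENNReal.coe_ne_top)).const_sub x
  have h : sqNormOp G.sqrt.op x ≤ (NNReal.sqrt t : ℝ≥0∞) ^ 2 := by
    refine G.sqrt.sqNormOp_le_of_norm_inner_le fun d => ?_
    refine le_of_tendsto (tendsto_const_nhds.inner hlim).norm (.of_forall fun n => ?_)
    rw [G.sqrt.graph_inner_symm (G.sqrt.op.mem_graph d) (G.sqrt.op.mem_graph (G.truncation n x)),
      mul_comm]
    exact (norm_inner_le_norm _ _).trans (by gcongr; exact hnorm n)
  rwa [← ENNReal.coe_pow, NNReal.sq_sqrt] at h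

theorem sqNormOp_sqrt_eq_tsum (G : PosOp H) (x : H) :
    sqNormOp G.sqrt.op x = ∑' j : ℕ, ‖(G.root ^ (j + 1)) x‖ₑ ^ 2 := by
  refine (G.sqNormOp_sqrt_le_tsum x).antisymm ?_
  by_cases hx : x ∈ G.sqrt.op.domain
  · rw [sqNormOp_of_mem hx, ENNReal.tsum_eq_iSup_nat, ← ofReal_norm_sq]
    refine iSup_le fun n => ?_
    rw [← ofReal_truncForm]
    exact ENNReal.ofReal_le_ofReal (G.truncForm_le n ⟨x, hx⟩)
  · exact sqNormOp_of_notMem hx ▸ le_top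

theorem sqNormOp_sqrt_root_pow (G : PosOp H) (x : H) (n : ℕ) :
    sqNormOp G.sqrt.op ((G.root ^ (2 * n)) x) =
      ∑' j : ℕ, ‖(G.root ^ (j + 2 * n + 1)) x‖ₑ ^ 2 := by
  rw [sqNormOp_sqrt_eq_tsum]
  refine tsum_congr fun j => ?_
  rw [add_right_comm, pow_add _ (j + 1)]
  rfl

theorem sqNormOp_sqrt_root_pow_le (G : PosOp H) (x : H) (n : ℕ) :
    sqNormOp G.sqrt.op ((G.root ^ (2 * n)) x) ≤ sqNormOp G.sqrt.op x := by
  rw [sqNormOp_sqrt_root_pow, sqNormOp_sqrt_eq_tsum]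
  exact ENNReal.tsum_comp_le_tsum_of_injective (add_left_injective (2 * n))
    fun j => ‖(G.root ^ (j + 1)) x‖ₑ ^ 2

/-- The bounded operator `D ^ (2 * n)`, where `D = G.root`, as a map from `D(√G)` to itself; it is
the error of the truncation `1 - D ^ (2 * n)`. -/
def remainder (G : PosOp H) (n : ℕ) (x : G.sqrt.op.domain) : G.sqrt.op.domain :=
  ⟨(G.root ^ (2 * n)) x, by simpa [coe_truncation] using
    G.sqrt.op.domain.sub_mem x.2 (G.truncation n x).2⟩

variable (G : PosOp H) (n : ℕ) (x : G.sqrt.op.domain)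

theorem norm_remainder_le : ‖(G.remainder n x : H)‖ ≤ ‖(x : H)‖ :=
  G.norm_root_pow_apply_le _ _

theorem norm_sqrt_remainder_le : ‖G.sqrt.op (G.remainder n x)‖ ≤ ‖G.sqrt.op x‖ := by
  have h : sqNormOp G.sqrt.op (G.remainder n x : H) ≤ sqNormOp G.sqrt.op x :=
    G.sqNormOp_sqrt_root_pow_le x n
  rw [sqNormOp_of_mem (G.remainder n x).2, sqNormOp_of_mem x.2] at h
  exact enorm_le_iff_norm_le.1 ((ENNReal.pow_le_pow_left_iff two_ne_zero).1 h)

theorem tendsto_remainder :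
    Filter.Tendsto (fun n => (G.remainder n x : H)) Filter.atTop (𝓝 0) :=
  G.tendsto_root_pow_of_tsum_ne_top (G.sqNormOp_sqrt_eq_tsum x ▸ sqNormOp_ne_top_of_mem x.2)

theorem tendsto_sqrt_remainder :
    Filter.Tendsto (fun n => G.sqrt.op (G.remainder n x)) Filter.atTop (𝓝 0) := by
  have hne := G.sqNormOp_sqrt_eq_tsum x ▸ sqNormOp_ne_top_of_mem x.2
  have hsq : Filter.Tendsto (fun n => ‖G.sqrt.op (G.remainder n x)‖ₑ ^ 2) Filter.atTop (𝓝 0) :=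
    ((ENNReal.tendsto_sum_nat_add _ hne).comp
      (Filter.tendsto_id.const_mul_atTop' zero_lt_two)).congr fun n => by
        rw [← sqNormOp_of_mem (G.remainder n x).2]
        exact (G.sqNormOp_sqrt_root_pow x n).symm
  rw [tendsto_zero_iff_norm_tendsto_zero]
  simpa using ((ENNReal.tendsto_toReal ENNReal.zero_ne_top).comp hsq).sqrt

theorem exists_norm_apply_truncation_le (A : G.BG) (n : ℕ) :
    ∃ c : ℝ, ∀ x, ‖(A.1 ∘ₗ G.truncation n) x‖ ≤ c * ‖x‖ := by
  obtain ⟨a, b, -, -, hA⟩ := A.2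
  refine ⟨√(a ^ 2 * 2 ^ 2 + b ^ 2 * n), fun x => ?_⟩
  have hnorm : ‖(G.truncation n x : H)‖ ≤ 2 * ‖x‖ := by
    rw [coe_truncation]
    linarith [norm_sub_le x ((G.root ^ (2 * n)) x), G.norm_root_pow_apply_le (2 * n) x]
  have hsqrt := (G.norm_sqrt_truncation_sq_le n x).trans (G.truncForm_le_mul_norm_sq n x)
  refine le_of_sq_le_sq ?_ (by positivity)
  calc ‖A.1 (G.truncation n x)‖ ^ 2
      ≤ a ^ 2 * (2 * ‖x‖) ^ 2 + b ^ 2 * (n * ‖x‖ ^ 2) := (hA _).trans (by gcongr)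
    _ = (√(a ^ 2 * 2 ^ 2 + b ^ 2 * n) * ‖x‖) ^ 2 := by
      rw [mul_pow (√_), Real.sq_sqrt (by positivity)]; ring

/-- The bounded operators `A (1 - D ^ (2 * n))`, where `D = G.root`, approximating a `√G`-bounded
operator `A`. -/
def cutoff (A : G.BG) (n : ℕ) : H →L[ℂ] H :=
  (A.1 ∘ₗ G.truncation n).mkContinuousOfExistsBound (G.exists_norm_apply_truncation_le A n)

theorem sub_cutoff_apply (A : G.BG) : A.1 x - G.cutoff A n x = A.1 (G.remainder n x) := by
  change A.1 x - A.1 (G.truncation n x) = _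
  rw [← map_sub]
  congr 1
  ext
  simp [coe_truncation, remainder]

theorem norm_sub_cutoff_sq_le {A : G.BG} {a b : ℝ} (h : RelBoundWith G.sqrt.op A.1 a b) :
    ‖A.1 x - G.cutoff A n x‖ ^ 2 ≤ a ^ 2 * ‖(x : H)‖ ^ 2 + b ^ 2 * ‖G.sqrt.op x‖ ^ 2 := by
  rw [sub_cutoff_apply]
  refine (h _).trans ?_
  gcongr
  · exact G.norm_remainder_le n x
  · exact G.norm_sqrt_remainder_le n x

theorem tendsto_cutoff (A : G.BG) :
    Filter.Tendsto (fun n => G.cutoff A n x) Filter.atTop (𝓝 (A.1 x)) := by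
  obtain ⟨a, b, -, -, hA⟩ := A.2
  have hlim : Filter.Tendsto (fun n => √(a ^ 2 * ‖(G.remainder n x : H)‖ ^ 2 +
      b ^ 2 * ‖G.sqrt.op (G.remainder n x)‖ ^ 2)) Filter.atTop (𝓝 0) := by
    simpa using ((((G.tendsto_remainder x).norm.pow 2).const_mul (a ^ 2)).add
      (((G.tendsto_sqrt_remainder x).norm.pow 2).const_mul (b ^ 2))).sqrt
  rw [tendsto_iff_norm_sub_tendsto_zero]
  refine squeeze_zero (fun _ => norm_nonneg _) (fun n => ?_) hlim
  rw [norm_sub_rev, sub_cutoff_apply]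
  exact Real.le_sqrt_of_sq_le (hA _)

end PosOp

/-! ## Families of vectors with the same quadratic form -/

section SquareSums

variable {ι : Type*} {F : Type*} [NormedAddCommGroup F]

theorem summable_norm_sq_of_tsum_enorm_ne_top {ψ : ι → F} (h : ∑' i, ‖ψ i‖ₑ ^ 2 ≠ ⊤) :
    Summable fun i => ‖ψ i‖ ^ 2 := by
  simpa using ENNReal.summable_toReal h

theorem ofReal_tsum_norm_sq {ψ : ι → F} (h : Summable fun i => ‖ψ i‖ ^ 2) :
    ENNReal.ofReal (∑' i, ‖ψ i‖ ^ 2) = ∑' i, ‖ψ i‖ₑ ^ 2 := by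
  rw [ENNReal.ofReal_tsum_of_nonneg (fun _ => by positivity) h]
  simp_rw [ofReal_norm_sq]

theorem tendsto_tsum_enorm_sq_of_dominated {f : ℕ → ι → F} {g : ι → F} {bound : ι → ℝ}
    (hbound : Summable bound) (hle : ∀ n i, ‖f n i‖ ^ 2 ≤ bound i)
    (hlim : ∀ i, Filter.Tendsto (fun n => f n i) Filter.atTop (𝓝 (g i))) :
    Filter.Tendsto (fun n => ∑' i, ‖f n i‖ₑ ^ 2) Filter.atTop (𝓝 (∑' i, ‖g i‖ₑ ^ 2)) := by
  have hf : ∀ n, Summable fun i => ‖f n i‖ ^ 2 := fun n =>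
    hbound.of_nonneg_of_le (fun _ => by positivity) (hle n)
  have hg : Summable fun i => ‖g i‖ ^ 2 := hbound.of_nonneg_of_le (fun _ => by positivity)
    fun i => le_of_tendsto ((hlim i).norm.pow 2) (.of_forall fun n => hle n i)
  simp_rw [← ofReal_tsum_norm_sq (hf _), ← ofReal_tsum_norm_sq hg]
  refine ENNReal.tendsto_ofReal (tendsto_tsum_of_dominated_convergence hbound
    (fun i => (hlim i).norm.pow 2) (.of_forall fun n i => ?_))
  simpa using hle n i

theorem tsum_enorm_clm_ne_top {𝕜 E : Type*} [NontriviallyNormedField 𝕜] [NormedAddCommGroup E]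
    [NormedSpace 𝕜 E] [NormedSpace 𝕜 F] {ψ : ι → E} (hψ : ∑' i, ‖ψ i‖ₑ ^ 2 ≠ ⊤)
    (T : E →L[𝕜] F) : ∑' i, ‖T (ψ i)‖ₑ ^ 2 ≠ ⊤ := by
  have h : ∑' i, ‖T (ψ i)‖ₑ ^ 2 ≤ ‖T‖ₑ ^ 2 * ∑' i, ‖ψ i‖ₑ ^ 2 := by
    rw [← ENNReal.tsum_mul_left]
    refine ENNReal.tsum_le_tsum fun i => ?_
    rw [← mul_pow]
    exact pow_le_pow_left₀ zero_le (T.le_opENorm _) 2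
  exact ne_top_of_le_ne_top (ENNReal.mul_ne_top (by simp) hψ) h

end SquareSums

section QuadraticForms

variable {H : Type*} [NormedAddCommGroup H] [InnerProductSpace ℂ H]

theorem enorm_inner_symm (x y : H) : ‖⟪x, y⟫_ℂ‖ₑ = ‖⟪y, x⟫_ℂ‖ₑ := by
  rw [← ofReal_norm, ← ofReal_norm, norm_inner_symm]

theorem inner_mul_inner_symm (x y : H) : ⟪x, y⟫_ℂ * ⟪y, x⟫_ℂ = ((‖⟪y, x⟫_ℂ‖ ^ 2 : ℝ) : ℂ) := by
  rw [← inner_conj_symm, mul_comm, Complex.mul_conj, Complex.normSq_eq_norm_sq]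

theorem enorm_sq_eq_tsum_enorm_inner {κ : Type*} (b : HilbertBasis κ ℂ H) (x : H) :
    ‖x‖ₑ ^ 2 = ∑' k, ‖⟪b k, x⟫_ℂ‖ₑ ^ 2 := by
  have h : HasSum (fun k => ‖⟪b k, x⟫_ℂ‖ ^ 2) (‖x‖ ^ 2) := by
    rw [← Complex.hasSum_ofReal]
    simpa [inner_mul_inner_symm, inner_self_eq_norm_sq_to_K] using b.hasSum_inner_mul_inner x x
  rw [← ofReal_tsum_norm_sq h.summable, h.tsum_eq, ofReal_norm_sq]

theorem norm_coe_sqrt_sq (t : ℝ≥0) : ‖((NNReal.sqrt t : ℝ) : ℂ)‖ₑ ^ 2 = t := by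
  rw [← ofReal_norm_sq, Complex.norm_real, Real.norm_of_nonneg (NNReal.coe_nonneg _),
    ← NNReal.coe_pow, NNReal.sq_sqrt, ENNReal.ofReal_coe_nnreal]

theorem sqNormOp_sqrt_smul (A : H →ₗ.[ℂ] H) (t : ℝ≥0) (x : H) :
    sqNormOp A (((NNReal.sqrt t : ℝ) : ℂ) • x) = t * sqNormOp A x := by
  rw [sqNormOp_smul, norm_coe_sqrt_sq]

theorem enorm_sqrt_smul (t : ℝ≥0) (x : H) :
    ‖((NNReal.sqrt t : ℝ) : ℂ) • x‖ₑ ^ 2 = t * ‖x‖ₑ ^ 2 := by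
  rw [enorm_smul, mul_pow, norm_coe_sqrt_sq]

theorem tsum_enorm_sqrt_smul {ι : Type*} (t : ℝ≥0) (ψ : ι → H) :
    ∑' i, ‖((NNReal.sqrt t : ℝ) : ℂ) • ψ i‖ₑ ^ 2 = t * ∑' i, ‖ψ i‖ₑ ^ 2 := by
  simp_rw [enorm_sqrt_smul]
  exact ENNReal.tsum_mul_left

theorem tsum_sqNormOp_sqrt_smul {ι : Type*} (A : H →ₗ.[ℂ] H) (t : ℝ≥0) (ψ : ι → H) :
    ∑' i, sqNormOp A (((NNReal.sqrt t : ℝ) : ℂ) • ψ i) = t * ∑' i, sqNormOp A (ψ i) := by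
  simp_rw [sqNormOp_sqrt_smul]
  exact ENNReal.tsum_mul_left

variable {ι κ : Type*} {ψ : ι → H} {φ : κ → H} {σ : H →L[ℂ] H}

theorem hasSum_inner_rankOne (h : HasSum (fun i => InnerProductSpace.rankOne ℂ (ψ i) (ψ i)) σ)
    (x y : H) : HasSum (fun i => ⟪x, ψ i⟫_ℂ * ⟪ψ i, y⟫_ℂ) ⟪x, σ y⟫_ℂ := by
  simpa [inner_smul_right, mul_comm] using
    h.mapL ((innerSL ℂ x).comp (ContinuousLinearMap.apply ℂ H y))

/-- The families `ψ` and `φ` define the same quadratic form `∑ᵢ |⟪ψᵢ, h⟫|²`; all traces used below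
depend on a family only through this form. -/
def SameForm (ψ : ι → H) (φ : κ → H) : Prop :=
  ∀ h, ∑' i, ‖⟪ψ i, h⟫_ℂ‖ₑ ^ 2 = ∑' k, ‖⟪φ k, h⟫_ℂ‖ₑ ^ 2

/-- The decomposition `σ = ∑ᵢ |ψᵢ⟩⟨ψᵢ|` in the sense of quadratic forms, so that no convergence of
the operator sum is presupposed. -/
def Decomposes (ψ : ι → H) (σ : H →L[ℂ] H) : Prop :=
  ∀ h, ∑' i, ‖⟪ψ i, h⟫_ℂ‖ₑ ^ 2 = ENNReal.ofReal (⟪h, σ h⟫_ℂ).re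

theorem Decomposes.sameForm (h : Decomposes ψ σ) (h' : Decomposes φ σ) : SameForm ψ φ :=
  fun x => by rw [h, h']

theorem decomposes_of_hasSum
    (h : HasSum (fun i => InnerProductSpace.rankOne ℂ (ψ i) (ψ i)) σ) : Decomposes ψ σ := by
  intro x
  have hsum := Complex.hasSum_re (hasSum_inner_rankOne h x x)
  simp only [inner_mul_inner_symm, Complex.ofReal_re] at hsum
  rw [← hsum.tsum_eq, ofReal_tsum_norm_sq hsum.summable]

theorem Decomposes.eq {τ : H →L[ℂ] H} (h : Decomposes ψ σ) (h' : Decomposes ψ τ)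
    (hσ : σ.IsPositive) (hτ : τ.IsPositive) : σ = τ := by
  refine ContinuousLinearMap.coe_inj.1 ((ext_inner_map _ _).1 fun x => ?_)
  have hre : (⟪σ x, x⟫_ℂ).re = (⟪τ x, x⟫_ℂ).re := by
    have hform := (h x).symm.trans (h' x)
    rw [← inner_conj_symm x, ← inner_conj_symm x, Complex.conj_re, Complex.conj_re] at hform
    exact (ENNReal.ofReal_eq_ofReal_iff (hσ.re_inner_nonneg_left x)
      (hτ.re_inner_nonneg_left x)).1 hform
  have hσx := ((ContinuousLinearMap.isPositive_iff_complex σ).1 hσ x).1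
  have hτx := ((ContinuousLinearMap.isPositive_iff_complex τ).1 hτ x).1
  exact hσx.symm.trans ((congrArg _ hre).trans hτx)

variable [CompleteSpace H]

theorem SameForm.tsum_enorm_sq (h : SameForm ψ φ) (T : H →L[ℂ] H) :
    ∑' i, ‖T (ψ i)‖ₑ ^ 2 = ∑' k, ‖T (φ k)‖ₑ ^ 2 := by
  simp_rw [enorm_sq_eq_tsum_enorm_inner (onb H) (T _)]
  rw [ENNReal.tsum_comm, ENNReal.tsum_comm (α := κ)]
  refine tsum_congr fun n => ?_
  simp_rw [← ContinuousLinearMap.adjoint_inner_left, enorm_inner_symm _ (ψ _),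
    enorm_inner_symm _ (φ _)]
  exact h _

theorem SameForm.tsum_enorm_sq_self (h : SameForm ψ φ) : ∑' i, ‖ψ i‖ₑ ^ 2 = ∑' k, ‖φ k‖ₑ ^ 2 :=
  h.tsum_enorm_sq (ContinuousLinearMap.id ℂ H)

theorem SameForm.tsum_sqNormOp_sqrt (h : SameForm ψ φ) (G : PosOp H) :
    ∑' i, sqNormOp G.sqrt.op (ψ i) = ∑' k, sqNormOp G.sqrt.op (φ k) := by
  simp_rw [G.sqNormOp_sqrt_eq_tsum]
  rw [ENNReal.tsum_comm, ENNReal.tsum_comm (α := κ)]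
  exact tsum_congr fun n => h.tsum_enorm_sq _

/-- A `√G`-bounded operator, regarded as a partially defined operator on `H`. -/
abbrev PosOp.toPMap (G : PosOp H) (A : G.BG) : H →ₗ.[ℂ] H := ⟨G.sqrt.op.domain, A.1⟩

theorem mem_sqrt_domain_of_tsum_ne_top {G : PosOp H}
    (hS : ∑' i, sqNormOp G.sqrt.op (ψ i) ≠ ⊤) (i : ι) : ψ i ∈ G.sqrt.op.domain :=
  mem_domain_of_sqNormOp_ne_top (ENNReal.ne_top_of_tsum_ne_top hS i)

theorem summable_norm_sqrt_sq (G : PosOp H) (hS : ∑' i, sqNormOp G.sqrt.op (ψ i) ≠ ⊤)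
    (hmem : ∀ i, ψ i ∈ G.sqrt.op.domain) :
    Summable fun i => ‖G.sqrt.op ⟨ψ i, hmem i⟩‖ ^ 2 := by
  simp_rw [fun i => sqNormOp_of_mem (hmem i)] at hS
  exact summable_norm_sq_of_tsum_enorm_ne_top hS

theorem PosOp.norm_cutoff_sq_le (G : PosOp H) {A : G.BG} {a b : ℝ}
    (hA : RelBoundWith G.sqrt.op A.1 a b) (n : ℕ) (x : G.sqrt.op.domain) :
    ‖G.cutoff A n x‖ ^ 2 ≤ 4 * (a ^ 2 * ‖(x : H)‖ ^ 2 + b ^ 2 * ‖G.sqrt.op x‖ ^ 2) := by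
  have htri := norm_sub_le (A.1 x) (A.1 x - G.cutoff A n x)
  rw [sub_sub_cancel] at htri
  nlinarith [G.norm_sub_cutoff_sq_le n x hA, hA x, norm_nonneg (G.cutoff A n x),
    sq_nonneg (‖A.1 x‖ - ‖A.1 x - G.cutoff A n x‖)]

theorem tendsto_tsum_cutoff (G : PosOp H) (A : G.BG) (h1 : ∑' i, ‖ψ i‖ₑ ^ 2 ≠ ⊤)
    (hS : ∑' i, sqNormOp G.sqrt.op (ψ i) ≠ ⊤) :
    Filter.Tendsto (fun n => ∑' i, ‖G.cutoff A n (ψ i)‖ₑ ^ 2) Filter.atTop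
      (𝓝 (∑' i, sqNormOp (G.toPMap A) (ψ i))) := by
  have hmem := mem_sqrt_domain_of_tsum_ne_top hS
  obtain ⟨a, b, -, -, hA⟩ := A.2
  have hbound := (((summable_norm_sq_of_tsum_enorm_ne_top h1).mul_left (a ^ 2)).add
    ((summable_norm_sqrt_sq G hS hmem).mul_left (b ^ 2))).mul_left 4
  simp_rw [fun i => sqNormOp_of_mem (A := G.toPMap A) (hmem i)]
  exact tendsto_tsum_enorm_sq_of_dominated hbound
    (fun n i => G.norm_cutoff_sq_le hA n ⟨ψ i, hmem i⟩) fun i => G.tendsto_cutoff ⟨ψ i, hmem i⟩ A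

theorem SameForm.tsum_sqNormOp (h : SameForm ψ φ) (G : PosOp H) (A : G.BG)
    (h1 : ∑' i, ‖ψ i‖ₑ ^ 2 ≠ ⊤) (hS : ∑' i, sqNormOp G.sqrt.op (ψ i) ≠ ⊤) :
    ∑' i, sqNormOp (G.toPMap A) (ψ i) = ∑' k, sqNormOp (G.toPMap A) (φ k) := by
  refine tendsto_nhds_unique (tendsto_tsum_cutoff G A h1 hS) ?_
  simp_rw [h.tsum_enorm_sq]
  exact tendsto_tsum_cutoff G A (h.tsum_enorm_sq_self ▸ h1) (h.tsum_sqNormOp_sqrt G ▸ hS)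

theorem Decomposes.posTrace_eq (h : Decomposes ψ σ) : posTrace σ = ∑' i, ‖ψ i‖ₑ ^ 2 := by
  simp_rw [enorm_sq_eq_tsum_enorm_inner (onb H), enorm_inner_symm _ (ψ _)]
  rw [ENNReal.tsum_comm, posTrace]
  exact tsum_congr fun n => (h _).symm

theorem decomposes_sqrt (hσ : σ.IsPositive) : Decomposes (fun i => CFC.sqrt σ (onb H i)) σ := by
  intro x
  have hsymm : ∀ y z, ⟪CFC.sqrt σ y, z⟫_ℂ = ⟪y, CFC.sqrt σ z⟫_ℂ :=
    ((ContinuousLinearMap.nonneg_iff_isPositive _).1 (CFC.sqrt_nonneg σ)).isSymmetric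
  have hsq : σ x = CFC.sqrt σ (CFC.sqrt σ x) := congrArg (fun T : H →L[ℂ] H => T x)
    (CFC.sqrt_mul_sqrt_self σ ((ContinuousLinearMap.nonneg_iff_isPositive σ).2 hσ)).symm
  simp_rw [hsymm]
  rw [← enorm_sq_eq_tsum_enorm_inner, hsq, ← hsymm, re_inner_self_eq_norm_sq, ofReal_norm_sq]

theorem Decomposes.energy_eq (h : Decomposes ψ σ) (hσ : σ.IsPositive) (G : PosOp H) :
    G.energy σ = ∑' i, sqNormOp G.sqrt.op (ψ i) :=
  ((decomposes_sqrt hσ).sameForm h).tsum_sqNormOp_sqrt G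

theorem Decomposes.trConj_eq (h : Decomposes ψ σ) (hσ : σ.IsPositive) (G : PosOp H) (A : G.BG)
    (h1 : ∑' i, ‖ψ i‖ₑ ^ 2 ≠ ⊤) (hS : ∑' i, sqNormOp G.sqrt.op (ψ i) ≠ ⊤) :
    trConj (G.toPMap A) σ = ∑' i, sqNormOp (G.toPMap A) (ψ i) :=
  ((h.sameForm (decomposes_sqrt hσ)).tsum_sqNormOp G A h1 hS).symm

theorem isPositive_of_hasSum
    (h : HasSum (fun i => InnerProductSpace.rankOne ℂ (ψ i) (ψ i)) σ) : σ.IsPositive :=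
  (ContinuousLinearMap.nonneg_iff_isPositive σ).1 (h.nonneg fun _ =>
    (ContinuousLinearMap.nonneg_iff_isPositive _).2 (InnerProductSpace.isPositive_rankOne_self _))

theorem summable_rankOne (h : ∑' i, ‖ψ i‖ₑ ^ 2 ≠ ⊤) :
    Summable fun i => InnerProductSpace.rankOne ℂ (ψ i) (ψ i) := by
  refine Summable.of_norm_bounded (summable_norm_sq_of_tsum_enorm_ne_top h) fun i => ?_
  rw [InnerProductSpace.norm_rankOne, sq]

theorem exists_decomposes (h : ∑' i, ‖ψ i‖ₑ ^ 2 ≠ ⊤) :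
    ∃ σ : H →L[ℂ] H, σ.IsPositive ∧ Decomposes ψ σ :=
  ⟨_, isPositive_of_hasSum (summable_rankOne h).hasSum,
    decomposes_of_hasSum (summable_rankOne h).hasSum⟩

theorem Decomposes.hasSum_rankOne (h : Decomposes ψ σ) (hσ : σ.IsPositive)
    (h1 : ∑' i, ‖ψ i‖ₑ ^ 2 ≠ ⊤) :
    HasSum (fun i => InnerProductSpace.rankOne ℂ (ψ i) (ψ i)) σ := by
  have hsum := (summable_rankOne h1).hasSum
  rwa [(decomposes_of_hasSum hsum).eq h (isPositive_of_hasSum hsum) hσ] at hsum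

end QuadraticForms

section Traces

variable {H : Type*} [NormedAddCommGroup H] [InnerProductSpace ℂ H]

theorem summable_inner_mul_inner {ι κ : Type*} (b : HilbertBasis κ ℂ H) {ψ χ : ι → H}
    (hψ : ∑' i, ‖ψ i‖ₑ ^ 2 ≠ ⊤) (hχ : ∑' i, ‖χ i‖ₑ ^ 2 ≠ ⊤) :
    Summable (Function.uncurry fun n i => ⟪b n, χ i⟫_ℂ * ⟪ψ i, b n⟫_ℂ) := by
  have hs : ∀ {φ : ι → H}, ∑' i, ‖φ i‖ₑ ^ 2 ≠ ⊤ →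
      Summable fun p : κ × ι => ‖⟪b p.1, φ p.2⟫_ℂ‖ ^ 2 := fun {φ} hφ => by
    refine summable_norm_sq_of_tsum_enorm_ne_top ?_
    rw [ENNReal.tsum_prod (f := fun n i => ‖⟪b n, φ i⟫_ℂ‖ₑ ^ 2), ENNReal.tsum_comm]
    simpa only [← enorm_sq_eq_tsum_enorm_inner b] using hφ
  refine Summable.of_norm_bounded ((hs hχ).add (hs hψ)) fun p => ?_
  simp only [Function.uncurry, norm_mul]
  rw [norm_inner_symm (ψ p.2)]
  nlinarith [sq_nonneg (‖⟪b p.1, χ p.2⟫_ℂ‖ - ‖⟪b p.1, ψ p.2⟫_ℂ‖),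
    sq_nonneg ‖⟪b p.1, χ p.2⟫_ℂ‖, sq_nonneg ‖⟪b p.1, ψ p.2⟫_ℂ‖]

theorem tsum_tsum_inner_mul_inner {ι κ : Type*} (b : HilbertBasis κ ℂ H) {ψ χ : ι → H}
    (hψ : ∑' i, ‖ψ i‖ₑ ^ 2 ≠ ⊤) (hχ : ∑' i, ‖χ i‖ₑ ^ 2 ≠ ⊤) :
    ∑' n, ∑' i, ⟪b n, χ i⟫_ℂ * ⟪ψ i, b n⟫_ℂ = ∑' i, ⟪ψ i, χ i⟫_ℂ := by
  rw [← (summable_inner_mul_inner b hψ hχ).tsum_comm]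
  refine tsum_congr fun i => ?_
  rw [← b.tsum_inner_mul_inner]
  simp_rw [mul_comm]

variable [CompleteSpace H] {ι : Type*} {ψ : ι → H} {σ : H →L[ℂ] H}

theorem Decomposes.opTrace_mul_left (h : Decomposes ψ σ) (hσ : σ.IsPositive)
    (h1 : ∑' i, ‖ψ i‖ₑ ^ 2 ≠ ⊤) (T : H →L[ℂ] H) :
    opTrace (T * σ) = ∑' i, ⟪ψ i, T (ψ i)⟫_ℂ := by
  rw [← tsum_tsum_inner_mul_inner (onb H) h1 (tsum_enorm_clm_ne_top h1 T), opTrace]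
  refine tsum_congr fun n => ?_
  have hsum := (hasSum_inner_rankOne (h.hasSum_rankOne hσ h1)
    (ContinuousLinearMap.adjoint T (onb H n)) (onb H n)).tsum_eq
  simp_rw [ContinuousLinearMap.adjoint_inner_left] at hsum
  exact hsum.symm

theorem Decomposes.opTrace_mul_right (h : Decomposes ψ σ) (hσ : σ.IsPositive)
    (h1 : ∑' i, ‖ψ i‖ₑ ^ 2 ≠ ⊤) (T : H →L[ℂ] H) :
    opTrace (σ * T) = ∑' i, ⟪ψ i, T (ψ i)⟫_ℂ := by
  simp_rw [← ContinuousLinearMap.adjoint_inner_left]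
  rw [← tsum_tsum_inner_mul_inner (onb H)
    (tsum_enorm_clm_ne_top h1 (ContinuousLinearMap.adjoint T)) h1, opTrace]
  refine tsum_congr fun n => ?_
  simp_rw [ContinuousLinearMap.adjoint_inner_left]
  exact (hasSum_inner_rankOne (h.hasSum_rankOne hσ h1) (onb H n) (T (onb H n))).tsum_eq.symm

theorem opTrace_rankOne (x y : H) : opTrace (InnerProductSpace.rankOne ℂ x y) = ⟪y, x⟫_ℂ := by
  rw [opTrace, ← (onb H).tsum_inner_mul_inner]
  simp

theorem eq_of_opTrace_mul_eq {σ τ : H →L[ℂ] H} (h : ∀ A, opTrace (σ * A) = opTrace (τ * A)) :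
    σ = τ := by
  refine ContinuousLinearMap.ext fun x => ext_inner_left ℂ fun y => ?_
  simpa only [ContinuousLinearMap.mul_def, InnerProductSpace.comp_rankOne, opTrace_rankOne] using
    h (InnerProductSpace.rankOne ℂ x y)

end Traces

/-! ## Energy norms -/

theorem tsum_sumElim_unit {ι α : Type*} (f : α → ℝ≥0∞) (ψ : ι → α) (χ : α) :
    ∑' s : ι ⊕ Unit, f (Sum.elim ψ (fun _ => χ) s) = ∑' i, f (ψ i) + f χ := by
  rw [Summable.tsum_sum ENNReal.summable ENNReal.summable]
  simp

namespace PosOp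

variable {H : Type*} [NormedAddCommGroup H] [InnerProductSpace ℂ H] [CompleteSpace H]

theorem InfZero.exists_low_energy {G : PosOp H} (hG : G.InfZero) {δ : ℝ≥0∞} (hδ : 0 < δ) :
    ∃ χ : H, ‖χ‖ = 1 ∧ sqNormOp G.sqrt.op χ ≤ δ := by
  obtain ⟨ε, hε, hεδ⟩ : ∃ ε : ℝ, 0 < ε ∧ ENNReal.ofReal ε ≤ δ := by
    obtain ⟨r, hr0, hr⟩ := ENNReal.lt_iff_exists_nnreal_btwn.1 hδ
    exact ⟨r, by simpa using hr0, by simpa using hr.le⟩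
  have hlt : ∃ t ∈ {t : ℝ | ∃ x : G.op.domain, ‖(x : H)‖ = 1 ∧ t = ‖G.op x‖}, t < ε := by
    by_contra! hcon
    exact absurd (hG.2 (fun t ht => hcon t ht)) (not_le.2 hε)
  obtain ⟨t, ⟨x, hx1, rfl⟩, ht⟩ := hlt
  obtain ⟨z, hz1, -⟩ := (G.sqrt_spec _ _).1 (G.op.mem_graph x)
  refine ⟨x, hx1, le_trans ?_ hεδ⟩
  rw [sqNormOp_of_mem_graph hz1, ← ofReal_norm_sq,
    ← G.re_inner_eq_norm_sqrt_sq (G.op.mem_graph x) hz1]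
  refine ENNReal.ofReal_le_ofReal (le_trans (re_inner_le_norm (𝕜 := ℂ) _ _) ?_)
  rw [hx1, one_mul]
  exact ht.le

theorem InfZero.exists_completion {G : PosOp H} (hG : G.InfZero) {c e E : ℝ≥0∞} (hc : c ≤ 1)
    (he : e < E) : ∃ χ : H, c + ‖χ‖ₑ ^ 2 = 1 ∧ e + sqNormOp G.sqrt.op χ ≤ E := by
  obtain ⟨χ, h1, h2⟩ := hG.exists_low_energy (tsub_pos_of_lt he)
  have hχ : ‖χ‖ₑ = 1 := by rw [← ofReal_norm, h1]; simp
  obtain ⟨t, ht⟩ : ∃ t : ℝ≥0, (t : ℝ≥0∞) = 1 - c :=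
    ⟨(1 - c).toNNReal, ENNReal.coe_toNNReal (ne_top_of_le_ne_top ENNReal.one_ne_top tsub_le_self)⟩
  refine ⟨((NNReal.sqrt t : ℝ) : ℂ) • χ, ?_, ?_⟩
  · rw [enorm_sqrt_smul, hχ, ht, one_pow, mul_one, add_tsub_cancel_of_le hc]
  · have h3 : sqNormOp G.sqrt.op (((NNReal.sqrt t : ℝ) : ℂ) • χ) ≤ E - e := by
      rw [sqNormOp_sqrt_smul, ht]
      calc (1 - c) * sqNormOp G.sqrt.op χ ≤ 1 * (E - e) := by gcongr; exact tsub_le_self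
        _ = E - e := one_mul _
    calc e + _ ≤ e + (E - e) := by gcongr
      _ = E := add_tsub_cancel_of_le he.le

theorem InfZero.exists_normalized {ι : Type*} {ψ : ι → H} {G : PosOp H} (hG : G.InfZero)
    {E : ℝ≥0∞} (h1 : ∑' i, ‖ψ i‖ₑ ^ 2 ≤ 1) (hE : ∑' i, sqNormOp G.sqrt.op (ψ i) < E) :
    ∃ χ : H, ∑' s : ι ⊕ Unit, ‖Sum.elim ψ (fun _ => χ) s‖ₑ ^ 2 = 1 ∧
      ∑' s : ι ⊕ Unit, sqNormOp G.sqrt.op (Sum.elim ψ (fun _ => χ) s) ≤ E := by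
  obtain ⟨χ, hχ1, hχ2⟩ := hG.exists_completion h1 hE
  refine ⟨χ, ?_, ?_⟩
  · rw [tsum_sumElim_unit (fun x => ‖x‖ₑ ^ 2), hχ1]
  · rwa [tsum_sumElim_unit (sqNormOp G.sqrt.op)]

theorem tsum_sqNormOp_le_eNorm_sq_of_eq_one {ι : Type*} {ψ : ι → H} {G : PosOp H} (A : G.BG)
    {E : ℝ≥0∞} (h1 : ∑' i, ‖ψ i‖ₑ ^ 2 = 1) (hE : ∑' i, sqNormOp G.sqrt.op (ψ i) ≤ E)
    (hS : ∑' i, sqNormOp G.sqrt.op (ψ i) ≠ ⊤) :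
    ∑' i, sqNormOp (G.toPMap A) (ψ i) ≤ G.eNorm E A ^ 2 := by
  have h1' : ∑' i, ‖ψ i‖ₑ ^ 2 ≠ ⊤ := by rw [h1]; exact ENNReal.one_ne_top
  obtain ⟨σ, hσ, hd⟩ := exists_decomposes h1'
  have hst : IsState σ := ⟨hσ, by rw [hd.posTrace_eq, h1]⟩
  have hen : G.energy σ ≤ E := by rw [hd.energy_eq hσ]; exact hE
  have hle : (trConj (G.toPMap A) σ) ^ (1 / 2 : ℝ) ≤ G.eNorm E A :=
    le_iSup₂_of_le σ hst (le_iSup_of_le hen le_rfl)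
  rw [← hd.trConj_eq hσ G A h1' hS]
  calc trConj (G.toPMap A) σ = ((trConj (G.toPMap A) σ) ^ (1 / 2 : ℝ)) ^ 2 := by
        rw [← ENNReal.rpow_natCast, ← ENNReal.rpow_mul]; norm_num
    _ ≤ _ := pow_le_pow_left₀ zero_le hle 2

theorem tsum_sqNormOp_le_eNorm_sq_of_energy_eq_zero {ι : Type*} {ψ : ι → H} {G : PosOp H}
    (A : G.BG) (E : ℝ≥0∞) (h1 : ∑' i, ‖ψ i‖ₑ ^ 2 ≤ 1)
    (h0 : ∑' i, sqNormOp G.sqrt.op (ψ i) = 0) :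
    ∑' i, sqNormOp (G.toPMap A) (ψ i) ≤ G.eNorm E A ^ 2 := by
  lift ∑' i, ‖ψ i‖ₑ ^ 2 to ℝ≥0 using ne_top_of_le_ne_top ENNReal.one_ne_top h1 with c hc
  rcases eq_or_ne c 0 with rfl | hc0
  · have hψ : ∀ i, ψ i = 0 := fun i => by simpa using ENNReal.tsum_eq_zero.1 hc.symm i
    simp [hψ, sqNormOp_zero]
  have hnorm : ∑' i, ‖((NNReal.sqrt c⁻¹ : ℝ) : ℂ) • ψ i‖ₑ ^ 2 = 1 := by
    rw [tsum_enorm_sqrt_smul, ← hc, ← ENNReal.coe_mul, inv_mul_cancel₀ hc0, ENNReal.coe_one]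
  have henergy : ∑' i, sqNormOp G.sqrt.op (((NNReal.sqrt c⁻¹ : ℝ) : ℂ) • ψ i) = 0 := by
    rw [tsum_sqNormOp_sqrt_smul, h0, mul_zero]
  have hc1 : 1 ≤ c⁻¹ := (one_le_inv₀ (pos_iff_ne_zero.2 hc0)).2 (by exact_mod_cast h1)
  calc ∑' i, sqNormOp (G.toPMap A) (ψ i)
      ≤ c⁻¹ * ∑' i, sqNormOp (G.toPMap A) (ψ i) := le_mul_of_one_le_left' (by exact_mod_cast hc1)
    _ = ∑' i, sqNormOp (G.toPMap A) (((NNReal.sqrt c⁻¹ : ℝ) : ℂ) • ψ i) :=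
        (tsum_sqNormOp_sqrt_smul _ _ ψ).symm
    _ ≤ G.eNorm E A ^ 2 :=
        tsum_sqNormOp_le_eNorm_sq_of_eq_one A hnorm (henergy.trans_le zero_le)
          (henergy ▸ ENNReal.zero_ne_top)

theorem InfZero.tsum_sqNormOp_le_eNorm_sq {ι : Type*} {ψ : ι → H} {G : PosOp H} (hG : G.InfZero)
    (A : G.BG) {E : ℝ≥0∞} (h1 : ∑' i, ‖ψ i‖ₑ ^ 2 ≤ 1)
    (hE : ∑' i, sqNormOp G.sqrt.op (ψ i) ≤ E) (hS : ∑' i, sqNormOp G.sqrt.op (ψ i) ≠ ⊤) :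
    ∑' i, sqNormOp (G.toPMap A) (ψ i) ≤ G.eNorm E A ^ 2 := by
  rcases eq_or_ne (∑' i, sqNormOp G.sqrt.op (ψ i)) 0 with he | he
  · exact tsum_sqNormOp_le_eNorm_sq_of_energy_eq_zero A E h1 he
  -- Shrinking the family by `t < 1` leaves room for the energy of the completing vector.
  refine ENNReal.le_of_forall_lt_one_mul_le fun t ht => ?_
  lift t to ℝ≥0 using ne_top_of_lt ht
  set e := ∑' i, sqNormOp G.sqrt.op (ψ i)
  have hte : (t : ℝ≥0∞) * e < e := by
    simpa using ENNReal.mul_lt_mul_left he hS ht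
  obtain ⟨χ, hχ1, hχ2⟩ := hG.exists_normalized (E := e)
    (ψ := fun i => ((NNReal.sqrt t : ℝ) : ℂ) • ψ i)
    (by rw [tsum_enorm_sqrt_smul]; exact mul_le_one' ht.le h1)
    (by rwa [tsum_sqNormOp_sqrt_smul])
  calc t * ∑' i, sqNormOp (G.toPMap A) (ψ i)
      = ∑' i, sqNormOp (G.toPMap A) (((NNReal.sqrt t : ℝ) : ℂ) • ψ i) :=
        (tsum_sqNormOp_sqrt_smul _ _ ψ).symm
    _ ≤ ∑' s, sqNormOp (G.toPMap A)
          (Sum.elim (fun i => ((NNReal.sqrt t : ℝ) : ℂ) • ψ i) (fun _ : Unit => χ) s) := by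
        rw [tsum_sumElim_unit (sqNormOp (G.toPMap A))]
        exact le_self_add
    _ ≤ G.eNorm E A ^ 2 :=
        tsum_sqNormOp_le_eNorm_sq_of_eq_one A hχ1 (hχ2.trans hE) (ne_top_of_le_ne_top hS hχ2)

theorem InfZero.tsum_sqNormOp_le_mul_eNorm_sq {ι : Type*} {ψ : ι → H} {G : PosOp H}
    (hG : G.InfZero) (A : G.BG) {E : ℝ≥0∞} {N : ℝ≥0} (hN : N ≠ 0)
    (h1 : ∑' i, ‖ψ i‖ₑ ^ 2 ≤ N) (hE : ∑' i, sqNormOp G.sqrt.op (ψ i) ≤ N * E)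
    (hS : ∑' i, sqNormOp G.sqrt.op (ψ i) ≠ ⊤) :
    ∑' i, sqNormOp (G.toPMap A) (ψ i) ≤ N * G.eNorm E A ^ 2 := by
  have hN' : (N : ℝ≥0∞) ≠ 0 := ENNReal.coe_ne_zero.2 hN
  have key := hG.tsum_sqNormOp_le_eNorm_sq (ψ := fun i => ((NNReal.sqrt N⁻¹ : ℝ) : ℂ) • ψ i) A
    (E := E)
  rw [tsum_enorm_sqrt_smul, tsum_sqNormOp_sqrt_smul, tsum_sqNormOp_sqrt_smul,
    ENNReal.coe_inv hN, ENNReal.inv_mul_le_iff hN' ENNReal.coe_ne_top, mul_one,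
    ENNReal.inv_mul_le_iff hN' ENNReal.coe_ne_top,
    ENNReal.inv_mul_le_iff hN' ENNReal.coe_ne_top] at key
  exact key h1 hE (ENNReal.mul_ne_top (ENNReal.inv_ne_top.2 hN') hS)

theorem eNorm_le {G : PosOp H} {A : G.BG} {E : ℝ≥0∞} {c : ℝ≥0∞}
    (h : ∀ ψ : onbIndex H → H, ∑' i, ‖ψ i‖ₑ ^ 2 = 1 → ∑' i, sqNormOp G.sqrt.op (ψ i) ≤ E →
      ∑' i, sqNormOp (G.toPMap A) (ψ i) ≤ c ^ 2) : G.eNorm E A ≤ c := by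
  refine iSup_le fun ρ => iSup₂_le fun hρ hE => ?_
  have hd := decomposes_sqrt hρ.1
  have := h _ (by rw [← hd.posTrace_eq, hρ.2]) hE
  calc (trConj (G.toPMap A) ρ) ^ (1 / 2 : ℝ) ≤ (c ^ 2) ^ (1 / 2 : ℝ) :=
        ENNReal.rpow_le_rpow this (by norm_num)
    _ = c := by rw [← ENNReal.rpow_natCast, ← ENNReal.rpow_mul]; norm_num

theorem tsum_sqNormOp_le_of_relBoundWith {ι : Type*} {ψ : ι → H} {G : PosOp H} {A : G.BG}
    {a b : ℝ} (h : RelBoundWith G.sqrt.op A.1 a b) (hψ : ∀ i, ψ i ∈ G.sqrt.op.domain) :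
    ∑' i, sqNormOp (G.toPMap A) (ψ i) ≤ ENNReal.ofReal (a ^ 2) * ∑' i, ‖ψ i‖ₑ ^ 2 +
      ENNReal.ofReal (b ^ 2) * ∑' i, sqNormOp G.sqrt.op (ψ i) := by
  rw [← ENNReal.tsum_mul_left, ← ENNReal.tsum_mul_left, ← ENNReal.tsum_add]
  refine ENNReal.tsum_le_tsum fun i => ?_
  rw [sqNormOp_of_mem (A := G.toPMap A) (hψ i), sqNormOp_of_mem (hψ i)]
  simp_rw [← ofReal_norm_sq]
  rw [← ENNReal.ofReal_mul (by positivity), ← ENNReal.ofReal_mul (by positivity),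
    ← ENNReal.ofReal_add (by positivity) (by positivity)]
  exact ENNReal.ofReal_le_ofReal (h ⟨ψ i, hψ i⟩)

theorem eNorm_le_of_relBoundWith {G : PosOp H} {A : G.BG} {E : ℝ≥0} {a b : ℝ}
    (h : RelBoundWith G.sqrt.op A.1 a b) :
    G.eNorm E A ≤ ENNReal.ofReal √(a ^ 2 + b ^ 2 * E) := by
  refine eNorm_le fun ψ h1 hE => ?_
  have hψ := mem_sqrt_domain_of_tsum_ne_top (ne_top_of_le_ne_top ENNReal.coe_ne_top hE)
  rw [← ENNReal.ofReal_pow (Real.sqrt_nonneg _), Real.sq_sqrt (by positivity)]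
  calc ∑' i, sqNormOp (G.toPMap A) (ψ i)
      ≤ ENNReal.ofReal (a ^ 2) * ∑' i, ‖ψ i‖ₑ ^ 2 +
          ENNReal.ofReal (b ^ 2) * ∑' i, sqNormOp G.sqrt.op (ψ i) :=
        tsum_sqNormOp_le_of_relBoundWith h hψ
    _ ≤ ENNReal.ofReal (a ^ 2) * 1 + ENNReal.ofReal (b ^ 2) * E := by gcongr; exact h1.le
    _ = ENNReal.ofReal (a ^ 2 + b ^ 2 * E) := by
        rw [mul_one, ENNReal.ofReal_add (by positivity) (by positivity),
          ENNReal.ofReal_mul (by positivity), ENNReal.ofReal_coe_nnreal]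

theorem InfZero.eNorm_le_sqrt_max_mul {G : PosOp H} (hG : G.InfZero) (A : G.BG) {F : ℝ≥0∞}
    (hF : F ≠ ⊤) {E : ℝ≥0} (hE : 0 < E) :
    G.eNorm F A ≤ ENNReal.ofReal √(max 1 (F.toReal / E)) * G.eNorm E A := by
  lift F to ℝ≥0 using hF
  set m : ℝ≥0 := max 1 (F / E) with hm
  have hmF : F ≤ m * E := (div_le_iff₀ hE).1 (le_max_right _ _)
  have hm_real : (max 1 ((F : ℝ≥0∞).toReal / E) : ℝ) = m := by
    rw [hm]; push_cast; rfl
  refine eNorm_le fun ψ h1 h2 => ?_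
  rw [hm_real, mul_pow, ← ENNReal.ofReal_pow (Real.sqrt_nonneg _), Real.sq_sqrt m.coe_nonneg,
    ENNReal.ofReal_coe_nnreal]
  refine hG.tsum_sqNormOp_le_mul_eNorm_sq A (one_pos.trans_le (le_max_left _ _)).ne' ?_
    (h2.trans (by exact_mod_cast hmF)) (ne_top_of_le_ne_top ENNReal.coe_ne_top h2)
  rw [h1]
  exact_mod_cast le_max_left 1 (F / E)

theorem InfZero.norm_sq_le_of_eNorm_le {G : PosOp H} (hG : G.InfZero) {A : G.BG} {E : ℝ≥0}
    (hE : 0 < E) {c : ℝ} (hc : 0 ≤ c) (h : G.eNorm E A ≤ ENNReal.ofReal c)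
    (x : G.sqrt.op.domain) :
    ‖A.1 x‖ ^ 2 ≤ c ^ 2 * (‖(x : H)‖ ^ 2 + ‖G.sqrt.op x‖ ^ 2 / E) := by
  rcases eq_or_ne x 0 with rfl | hx
  · simp
  have hx0 : 0 < ‖(x : H)‖ := by simpa using hx
  have hE0 : (0 : ℝ) < E := hE
  lift ‖(x : H)‖ ^ 2 + ‖G.sqrt.op x‖ ^ 2 / E to ℝ≥0 using by positivity with N hN
  have hN0 : N ≠ 0 := by
    rw [← NNReal.coe_ne_zero, hN]
    positivity
  have hnorm : ‖(x : H)‖ ^ 2 ≤ N := hN ▸ le_add_of_nonneg_right (by positivity)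
  have henergy : ‖G.sqrt.op x‖ ^ 2 ≤ N * E := by
    rw [hN, add_mul, div_mul_cancel₀ _ hE0.ne']
    exact le_add_of_nonneg_left (by positivity)
  have key := hG.tsum_sqNormOp_le_mul_eNorm_sq (ι := Unit) (ψ := fun _ => (x : H)) (E := E) A hN0
  simp only [tsum_fintype, Finset.univ_unique, Finset.sum_singleton,
    sqNormOp_of_mem (A := G.toPMap A) x.2, sqNormOp_of_mem x.2, ← ofReal_norm_sq,
    ← ENNReal.coe_mul, ENNReal.ofReal_le_iff_le_toReal ENNReal.coe_ne_top, ENNReal.coe_toReal,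
    NNReal.coe_mul] at key
  have hA := (key hnorm henergy ENNReal.ofReal_ne_top).trans
    (mul_le_mul_right (pow_le_pow_left₀ zero_le h 2) (N : ℝ≥0∞))
  rwa [← ENNReal.ofReal_coe_nnreal, ← ENNReal.ofReal_pow hc, ← ENNReal.ofReal_mul N.coe_nonneg,
    ENNReal.ofReal_le_ofReal_iff (by positivity), mul_comm] at hA

end PosOp

/-! ## Slices of tensors -/

section Tensor

variable {H K : Type*} [NormedAddCommGroup H] [InnerProductSpace ℂ H]
  [NormedAddCommGroup K] [InnerProductSpace ℂ K]

/-- The bounded map `x ↦ x ⊗ y`; its adjoint is the slice map along `y`. -/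
def tensL (H : Type*) [NormedAddCommGroup H] [InnerProductSpace ℂ H] (y : K) :
    H →L[ℂ] HTensor H K :=
  UniformSpace.Completion.toComplL.comp ((TensorProduct.mkL ℂ H K).flip y)

/-- The bounded map `y ↦ x ⊗ y`. -/
def tensR (K : Type*) [NormedAddCommGroup K] [InnerProductSpace ℂ K] (x : H) :
    K →L[ℂ] HTensor H K :=
  UniformSpace.Completion.toComplL.comp (TensorProduct.mkL ℂ H K x)

theorem tensL_apply (x : H) (y : K) : tensL H y x = tens x y := rfl

theorem tensR_apply (x : H) (y : K) : tensR K x y = tens x y := rfl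

theorem inner_tens (x x' : H) (y y' : K) :
    ⟪tens x y, tens x' y'⟫_ℂ = ⟪x, x'⟫_ℂ * ⟪y, y'⟫_ℂ := by
  simp [tens]

theorem norm_tens (x : H) (y : K) : ‖tens x y‖ = ‖x‖ * ‖y‖ := by
  simp [tens]

theorem ampl_tens (A : H →L[ℂ] H) (x : H) (y : K) : ampl K A (tens x y) = tens (A x) y := by
  simp [ampl, tens]

theorem dense_span_tens :
    Dense (Submodule.span ℂ {ξ : HTensor H K | ∃ x y, ξ = tens x y} : Set (HTensor H K)) := by
  refine Dense.mono ?_ (UniformSpace.Completion.denseRange_coe (α := H ⊗[ℂ] K))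
  rintro _ ⟨t, rfl⟩
  induction t using TensorProduct.induction_on with
  | zero => exact Submodule.zero_mem _
  | tmul x y => exact Submodule.subset_span ⟨x, y, rfl⟩
  | add s t hs ht =>
    rw [UniformSpace.Completion.coe_add]
    exact Submodule.add_mem _ hs ht

theorem clm_ext_tens {F : Type*} [NormedAddCommGroup F] [NormedSpace ℂ F]
    {S T : HTensor H K →L[ℂ] F} (h : ∀ x y, S (tens x y) = T (tens x y)) : S = T := by
  refine ContinuousLinearMap.ext_on dense_span_tens ?_
  rintro _ ⟨x, y, rfl⟩
  exact h x y

theorem eq_zero_of_inner_tens {ξ : HTensor H K} (h : ∀ x y, ⟪tens x y, ξ⟫_ℂ = 0) : ξ = 0 := by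
  have : innerSL ℂ ξ = 0 := clm_ext_tens fun x y => by
    rw [innerSL_apply_apply, ← inner_conj_symm, h]; simp
  have h2 := congrArg (fun T => T ξ) this
  simpa using h2

theorem ampl_one : ampl K (1 : H →L[ℂ] H) = 1 :=
  clm_ext_tens fun x y => by rw [ampl_tens]; rfl

theorem ampl_mul (A B : H →L[ℂ] H) : ampl K (A * B) = ampl K A * ampl K B :=
  clm_ext_tens fun x y => by
    change _ = ampl K A (ampl K B (tens x y))
    simp only [ampl_tens]; rfl

variable [CompleteSpace H]

/-- The slice of a tensor along `y`, determined by `⟪x, slice y ξ⟫ = ⟪x ⊗ y, ξ⟫`. -/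
def slice (y : K) : HTensor H K →L[ℂ] H := ContinuousLinearMap.adjoint (tensL H y)

theorem inner_slice (x : H) (y : K) (ξ : HTensor H K) : ⟪x, slice y ξ⟫_ℂ = ⟪tens x y, ξ⟫_ℂ :=
  ContinuousLinearMap.adjoint_inner_right _ _ _

theorem slice_tens (x : H) (y y' : K) : slice y (tens x y') = ⟪y, y'⟫_ℂ • x :=
  ext_inner_left ℂ fun h => by
    rw [inner_slice, inner_tens, inner_smul_right, mul_comm]

theorem adjoint_ampl (A : H →L[ℂ] H) :
    ContinuousLinearMap.adjoint (ampl K A) = ampl K (ContinuousLinearMap.adjoint A) := by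
  refine clm_ext_tens fun x y => sub_eq_zero.1 (eq_zero_of_inner_tens fun x' y' => ?_)
  rw [inner_sub_right, ContinuousLinearMap.adjoint_inner_right, ampl_tens, ampl_tens, inner_tens,
    inner_tens, ContinuousLinearMap.adjoint_inner_right, sub_self]

theorem slice_ampl (A : H →L[ℂ] H) (y : K) (ξ : HTensor H K) :
    slice y (ampl K A ξ) = A (slice y ξ) :=
  ext_inner_left ℂ fun h => by
    rw [inner_slice, ← ContinuousLinearMap.adjoint_inner_left, adjoint_ampl, ampl_tens,
      ← inner_slice, ContinuousLinearMap.adjoint_inner_left]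

theorem slice_add (y y' : K) (ξ : HTensor H K) : slice (y + y') ξ = slice y ξ + slice y' ξ :=
  ext_inner_left ℂ fun h => by
    rw [inner_add_right, inner_slice, inner_slice, inner_slice, ← inner_add_left,
      ← tensR_apply, map_add]; rfl

theorem slice_smul (c : ℂ) (y : K) (ξ : HTensor H K) :
    slice (c • y) ξ = (starRingEnd ℂ) c • slice y ξ :=
  ext_inner_left ℂ fun h => by
    rw [inner_smul_right, inner_slice, inner_slice, ← tensR_apply, map_smul, inner_smul_left]; rfl

theorem norm_slice_le (y : K) (ξ : HTensor H K) : ‖slice y ξ‖ ≤ ‖y‖ * ‖ξ‖ := by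
  have h1 : ‖slice y ξ‖ ^ 2 = (⟪tens (slice y ξ) y, ξ⟫_ℂ).re := by
    rw [← inner_slice, re_inner_self_eq_norm_sq]
  have h2 : (⟪tens (slice y ξ) y, ξ⟫_ℂ).re ≤ ‖slice y ξ‖ * ‖y‖ * ‖ξ‖ := by
    rw [← norm_tens]; exact re_inner_le_norm (𝕜 := ℂ) _ _
  by_contra! hlt
  have : 0 < ‖slice y ξ‖ := lt_of_le_of_lt (by positivity) hlt
  nlinarith

/-- The isometry `x ↦ x ⊗ y`, for a unit vector `y`. -/
def tensIsometry (H : Type*) [NormedAddCommGroup H] [InnerProductSpace ℂ H] (y : K)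
    (hy : ‖y‖ = 1) : H →ₗᵢ[ℂ] HTensor H K :=
  ⟨(tensL H y : H →ₗ[ℂ] HTensor H K), fun x => by
    change ‖tens x y‖ = ‖x‖
    rw [norm_tens, hy, mul_one]⟩

variable [CompleteSpace K] {κ : Type*} (f : HilbertBasis κ ℂ K)

theorem eq_zero_of_slice_eq_zero {ξ : HTensor H K} (h : ∀ k, slice (f k) ξ = 0) : ξ = 0 := by
  refine eq_zero_of_inner_tens fun x y => ?_
  have h1 : ContinuousLinearMap.adjoint (tensR K x) ξ = 0 := by
    have h2 := enorm_sq_eq_tsum_enorm_inner f (ContinuousLinearMap.adjoint (tensR K x) ξ)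
    have h3 : ∀ k, ⟪f k, ContinuousLinearMap.adjoint (tensR K x) ξ⟫_ℂ = 0 := fun k => by
      rw [ContinuousLinearMap.adjoint_inner_right, tensR_apply, ← inner_slice, h k,
        inner_zero_right]
    simpa [h3] using h2
  rw [← tensR_apply, ← ContinuousLinearMap.adjoint_inner_right, h1, inner_zero_right]

theorem isHilbertSum_tens : IsHilbertSum ℂ (fun _ : κ => H)
    (fun k => tensIsometry H (f k) (f.orthonormal.1 k)) := by
  refine IsHilbertSum.mk ?_ ?_
  · intro i j hij x y
    change ⟪tens x (f i), tens y (f j)⟫_ℂ = 0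
    rw [inner_tens, f.orthonormal.2 hij, mul_zero]
  · rw [top_le_iff, Submodule.topologicalClosure_eq_top_iff, Submodule.eq_bot_iff]
    intro ξ hξ
    refine eq_zero_of_slice_eq_zero f fun k => ext_inner_left ℂ fun x => ?_
    rw [inner_slice, inner_zero_right]
    rw [Submodule.mem_orthogonal] at hξ
    exact hξ _ (Submodule.mem_iSup_of_mem k ⟨x, rfl⟩)

/-- The decomposition of `H ⊗ K` given by an orthonormal basis of `K`. -/
def sliceEquiv : HTensor H K ≃ₗᵢ[ℂ] lp (fun _ : κ => H) 2 :=
  (isHilbertSum_tens f).linearIsometryEquiv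

theorem hasSum_sliceEquiv (ξ : HTensor H K) :
    HasSum (fun k => tens (sliceEquiv f ξ k) (f k)) ξ := by
  have h := (isHilbertSum_tens (H := H) f).hasSum_linearIsometryEquiv_symm (sliceEquiv f ξ)
  rw [sliceEquiv, LinearIsometryEquiv.symm_apply_apply] at h
  exact h

theorem sliceEquiv_apply (ξ : HTensor H K) (k : κ) : sliceEquiv f ξ k = slice (f k) ξ := by
  classical
  have h := (hasSum_sliceEquiv f ξ).mapL (slice (f k))
  simp_rw [slice_tens, orthonormal_iff_ite.1 f.orthonormal, ite_smul, one_smul, zero_smul] at h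
  have h2 := hasSum_ite_eq k (sliceEquiv f ξ k)
  refine HasSum.unique (h2.congr_fun fun j => ?_) h
  by_cases hj : j = k
  · subst hj; simp
  · simp [hj, Ne.symm hj]

theorem hasSum_tens_slice (ξ : HTensor H K) :
    HasSum (fun k => tens (slice (f k) ξ) (f k)) ξ := by
  simpa only [sliceEquiv_apply] using hasSum_sliceEquiv f ξ

theorem hasSum_norm_slice_sq (ξ : HTensor H K) :
    HasSum (fun k => ‖slice (f k) ξ‖ ^ 2) (‖ξ‖ ^ 2) := by
  have h := lp.hasSum_norm (p := 2) (by norm_num) (sliceEquiv f ξ)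
  simpa [sliceEquiv_apply] using h

theorem hasSum_inner_slice (ξ η : HTensor H K) :
    HasSum (fun k => ⟪slice (f k) ξ, slice (f k) η⟫_ℂ) ⟪ξ, η⟫_ℂ := by
  have h := lp.hasSum_inner (𝕜 := ℂ) (sliceEquiv f ξ) (sliceEquiv f η)
  simpa [sliceEquiv_apply] using h

theorem enorm_sq_eq_tsum_slice (ξ : HTensor H K) :
    ‖ξ‖ₑ ^ 2 = ∑' k, ‖slice (f k) ξ‖ₑ ^ 2 := by
  have h := hasSum_norm_slice_sq f ξ
  rw [← ofReal_tsum_norm_sq h.summable, h.tsum_eq, ofReal_norm_sq]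

theorem ext_slice {ξ η : HTensor H K} (h : ∀ k, slice (f k) ξ = slice (f k) η) : ξ = η :=
  sub_eq_zero.1 (eq_zero_of_slice_eq_zero f fun k => by rw [map_sub, h, sub_self])

theorem exists_slice_eq {x : κ → H} (h : Summable fun k => ‖x k‖ ^ 2) :
    ∃ ξ : HTensor H K, ∀ k, slice (f k) ξ = x k :=
  ⟨(sliceEquiv f).symm ⟨x, memℓp_gen (by simpa using h)⟩, fun k => by
    rw [← sliceEquiv_apply, LinearIsometryEquiv.apply_symm_apply]⟩

end Tensor

section Amplification

variable {H K : Type*} [NormedAddCommGroup H] [InnerProductSpace ℂ H] [CompleteSpace H]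
  [NormedAddCommGroup K] [InnerProductSpace ℂ K]

/-- The closed graph of `S ⊗ I_K`. -/
abbrev amplGraph (K : Type*) [NormedAddCommGroup K] [InnerProductSpace ℂ K] (S : H →ₗ.[ℂ] H) :
    Submodule ℂ (HTensor H K × HTensor H K) :=
  (Submodule.span ℂ {p : HTensor H K × HTensor H K |
    ∃ (x : S.domain) (y : K), p = (tens (x : H) y, tens (S x) y)}).topologicalClosure

theorem slice_mem_graph_of_mem_amplGraph (S : PosOp H) {p : HTensor H K × HTensor H K}
    (hp : p ∈ amplGraph K S.op) (y : K) : (slice y p.1, slice y p.2) ∈ S.op.graph := by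
  let L : HTensor H K × HTensor H K →L[ℂ] H × H := (slice y).prodMap (slice y)
  have hcl : IsClosed (L ⁻¹' (S.op.graph : Set (H × H))) :=
    (IsSelfAdjoint.isClosed S.selfAdjoint).preimage L.continuous
  have hle : amplGraph K S.op ≤
      S.op.graph.comap (L : HTensor H K × HTensor H K →ₗ[ℂ] H × H) := by
    refine Submodule.topologicalClosure_minimal _ (Submodule.span_le.2 ?_) hcl
    rintro _ ⟨x, z, rfl⟩
    change (slice y (tens (x : H) z), slice y (tens (S.op x) z)) ∈ S.op.graph
    rw [slice_tens, slice_tens]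
    exact S.op.graph.smul_mem _ (S.op.mem_graph x)
  exact hle hp

theorem tens_mem_amplGraph (S : PosOp H) {x x' : H} (h : (x, x') ∈ S.op.graph) (y : K) :
    (tens x y, tens x' y) ∈ amplGraph K S.op := by
  refine Submodule.le_topologicalClosure _ (Submodule.subset_span ?_)
  have hx := LinearPMap.mem_domain_of_mem_graph h
  exact ⟨⟨x, hx⟩, y, by rw [(LinearPMap.image_iff hx).2 h]⟩

variable [CompleteSpace K]

theorem amplGraph_functional (S : PosOp H) (p : HTensor H K × HTensor H K)
    (hp : p ∈ amplGraph K S.op) (h0 : p.1 = 0) : p.2 = 0 := by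
  obtain ⟨w, f, -⟩ := exists_hilbertBasis ℂ K
  refine eq_zero_of_slice_eq_zero f fun k => ?_
  exact S.op.graph_fst_eq_zero_snd (slice_mem_graph_of_mem_amplGraph S hp (f k)) (by simp [h0])

theorem graph_amplPMap (S : PosOp H) : (amplPMap K S.op).graph = amplGraph K S.op :=
  Submodule.toLinearPMap_graph_eq _ (amplGraph_functional S)

theorem mem_amplGraph_of_slice {κ : Type*} (f : HilbertBasis κ ℂ K) (S : PosOp H)
    {ξ η : HTensor H K} (h : ∀ k, (slice (f k) ξ, slice (f k) η) ∈ S.op.graph) :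
    (ξ, η) ∈ amplGraph K S.op := by
  have h1 : HasSum (fun k => (tens (slice (f k) ξ) (f k), tens (slice (f k) η) (f k))) (ξ, η) :=
    (hasSum_tens_slice f ξ).prodMk (hasSum_tens_slice f η)
  refine (Submodule.isClosed_topologicalClosure _).mem_of_tendsto h1
    (Filter.Eventually.of_forall fun s => ?_)
  exact Submodule.sum_mem _ fun k _ => tens_mem_amplGraph S (h k) (f k)

theorem slice_mem_graph (S : PosOp H) (ξ : (amplPMap K S.op).domain) (y : K) :
    (slice y (ξ : HTensor H K), slice y (amplPMap K S.op ξ)) ∈ S.op.graph := by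
  have h := (amplPMap K S.op).mem_graph ξ
  rw [graph_amplPMap] at h
  exact slice_mem_graph_of_mem_amplGraph S h y

/-- The slice along `y`, as a map from `D(S ⊗ I_K)` to `D(S)`. -/
def domainSlice (S : PosOp H) (y : K) : (amplPMap K S.op).domain →ₗ[ℂ] S.op.domain :=
  ((slice (H := H) y).toLinearMap ∘ₗ (amplPMap K S.op).domain.subtype).codRestrict S.op.domain
    fun ξ => LinearPMap.mem_domain_of_mem_graph (slice_mem_graph S ξ y)

theorem coe_domainSlice (S : PosOp H) (y : K) (ξ : (amplPMap K S.op).domain) :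
    (domainSlice S y ξ : H) = slice y (ξ : HTensor H K) := rfl

theorem apply_domainSlice (S : PosOp H) (y : K) (ξ : (amplPMap K S.op).domain) :
    S.op (domainSlice S y ξ) = slice y (amplPMap K S.op ξ) :=
  ((LinearPMap.image_iff (domainSlice S y ξ).2).2 (slice_mem_graph S ξ y)).symm

theorem RelBoundWith.norm_apply_domainSlice_sq_le {S : PosOp H} {A : S.op.domain →ₗ[ℂ] H}
    {a b : ℝ} (h : RelBoundWith S.op A a b) (y : K) (ξ : (amplPMap K S.op).domain) :
    ‖A (domainSlice S y ξ)‖ ^ 2 ≤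
      a ^ 2 * ‖slice y (ξ : HTensor H K)‖ ^ 2 + b ^ 2 * ‖slice y (amplPMap K S.op ξ)‖ ^ 2 := by
  simpa only [coe_domainSlice, apply_domainSlice] using h (domainSlice S y ξ)

theorem hasSum_relBound_slice {κ : Type*} (f : HilbertBasis κ ℂ K) (S : PosOp H) (a b : ℝ)
    (ξ : (amplPMap K S.op).domain) :
    HasSum (fun k => a ^ 2 * ‖slice (f k) (ξ : HTensor H K)‖ ^ 2 +
        b ^ 2 * ‖slice (f k) (amplPMap K S.op ξ)‖ ^ 2)
      (a ^ 2 * ‖(ξ : HTensor H K)‖ ^ 2 + b ^ 2 * ‖amplPMap K S.op ξ‖ ^ 2) :=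
  ((hasSum_norm_slice_sq f (ξ : HTensor H K)).mul_left _).add
    ((hasSum_norm_slice_sq f (amplPMap K S.op ξ)).mul_left _)

theorem mem_amplPMap_domain {κ : Type*} (f : HilbertBasis κ ℂ K) (S : PosOp H) {ξ : HTensor H K}
    (h : ∑' k, sqNormOp S.op (slice (f k) ξ) ≠ ⊤) : ξ ∈ (amplPMap K S.op).domain := by
  have hmem : ∀ k, slice (f k) ξ ∈ S.op.domain := fun k =>
    mem_domain_of_sqNormOp_ne_top (ENNReal.ne_top_of_tsum_ne_top h k)
  have hs : Summable fun k => ‖S.op ⟨slice (f k) ξ, hmem k⟩‖ ^ 2 := by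
    simp_rw [fun k => sqNormOp_of_mem (hmem k)] at h
    exact summable_norm_sq_of_tsum_enorm_ne_top h
  obtain ⟨η, hη⟩ := exists_slice_eq f hs
  have hg : (ξ, η) ∈ (amplPMap K S.op).graph := by
    rw [graph_amplPMap]
    refine mem_amplGraph_of_slice f S fun k => ?_
    rw [hη]
    exact S.op.mem_graph ⟨_, hmem k⟩
  exact LinearPMap.mem_domain_of_mem_graph hg

theorem span_le_comap_ker_of_tens (S : PosOp H)
    {T : (amplPMap K S.op).domain →ₗ[ℂ] HTensor H K}
    (h0 : ∀ (x : S.op.domain) (y : K) (h : tens (x : H) y ∈ (amplPMap K S.op).domain),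
      T ⟨tens (x : H) y, h⟩ = 0) :
    Submodule.span ℂ {p : HTensor H K × HTensor H K |
        ∃ (x : S.op.domain) (y : K), p = (tens (x : H) y, tens (S.op x) y)} ≤
      (T.ker.map (amplPMap K S.op).domain.subtype).comap (LinearMap.fst ℂ _ _) := by
  rw [Submodule.span_le]
  rintro _ ⟨x, y, rfl⟩
  have hg := tens_mem_amplGraph S (S.op.mem_graph x) y
  rw [← graph_amplPMap] at hg
  exact ⟨⟨_, LinearPMap.mem_domain_of_mem_graph hg⟩, h0 x y _, rfl⟩

theorem eq_zero_of_isRelBounded_of_tens (S : PosOp H)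
    {T : (amplPMap K S.op).domain →ₗ[ℂ] HTensor H K} (hT : IsRelBounded (amplPMap K S.op) T)
    (h0 : ∀ (x : S.op.domain) (y : K) (h : tens (x : H) y ∈ (amplPMap K S.op).domain),
      T ⟨tens (x : H) y, h⟩ = 0) : T = 0 := by
  obtain ⟨a, b, -, -, hab⟩ := hT
  ext ξ
  have hξ := (amplPMap K S.op).mem_graph ξ
  rw [graph_amplPMap] at hξ
  obtain ⟨p, hp, hlim⟩ := mem_closure_iff_seq_limit.1 hξ
  rw [Prod.tendsto_iff] at hlim
  have hbound : Filter.Tendsto (fun n => (a ^ 2 * ‖(ξ : HTensor H K) - (p n).1‖ ^ 2 +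
      b ^ 2 * ‖amplPMap K S.op ξ - (p n).2‖ ^ 2)) Filter.atTop (𝓝 0) := by
    have e1 := ((hlim.1.const_sub (ξ : HTensor H K)).norm.pow 2).const_mul (a ^ 2)
    have e2 := ((hlim.2.const_sub (amplPMap K S.op ξ)).norm.pow 2).const_mul (b ^ 2)
    simpa using e1.add e2
  have hle : ∀ n, ‖T ξ‖ ^ 2 ≤ a ^ 2 * ‖(ξ : HTensor H K) - (p n).1‖ ^ 2 +
      b ^ 2 * ‖amplPMap K S.op ξ - (p n).2‖ ^ 2 := fun n => by
    obtain ⟨η, hTη, hη⟩ := span_le_comap_ker_of_tens S h0 (hp n)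
    have hηn : (η : HTensor H K) = (p n).1 := hη
    have hg : p n ∈ (amplPMap K S.op).graph := by
      rw [graph_amplPMap]; exact Submodule.le_topologicalClosure _ (hp n)
    have hSη : amplPMap K S.op η = (p n).2 :=
      (amplPMap K S.op).mem_graph_snd_inj ((amplPMap K S.op).mem_graph η) hg hηn
    have h := hab (ξ - η)
    rwa [map_sub, LinearMap.mem_ker.1 hTη, sub_zero, LinearPMap.map_sub, hSη,
      AddSubgroupClass.coe_sub, hηn] at h
  have hzero : ‖T ξ‖ ^ 2 ≤ 0 := ge_of_tendsto hbound (Filter.Eventually.of_forall hle)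
  simpa using hzero

theorem IsAmplExtension.unique (S : PosOp H) {A : S.op.domain →ₗ[ℂ] H}
    {T T' : (amplPMap K S.op).domain →ₗ[ℂ] HTensor H K} (hT : IsAmplExtension S.op A T)
    (hT' : IsAmplExtension S.op A T') : T = T' := by
  refine sub_eq_zero.1 (eq_zero_of_isRelBounded_of_tens S
    ((relBoundedOps (amplPMap K S.op)).sub_mem hT.1 hT'.1) fun x y h => ?_)
  rw [LinearMap.sub_apply, hT.2, hT'.2, sub_self]

theorem exists_isAmplExtension {κ : Type*} (f : HilbertBasis κ ℂ K) (G : PosOp H) (A : G.BG) :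
    ∃ T : (amplPMap K G.sqrt.op).domain →ₗ[ℂ] HTensor H K,
      IsAmplExtension G.sqrt.op A.1 T ∧
      ∀ ξ k, slice (f k) (T ξ) = A.1 (domainSlice G.sqrt (f k) ξ) := by
  obtain ⟨a, b, ha, hb, hA⟩ := A.2
  have hle := fun ξ k => hA.norm_apply_domainSlice_sq_le (f k) ξ
  have hbound := hasSum_relBound_slice f G.sqrt a b
  have hsummable : ∀ ξ : (amplPMap K G.sqrt.op).domain, Summable fun k =>
      ‖A.1 (domainSlice G.sqrt (f k) ξ)‖ ^ 2 := fun ξ =>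
    Summable.of_nonneg_of_le (fun _ => by positivity) (hle ξ) (hbound ξ).summable
  choose T₀ hT₀ using fun ξ => exists_slice_eq f (hsummable ξ)
  let T : (amplPMap K G.sqrt.op).domain →ₗ[ℂ] HTensor H K :=
    { toFun := T₀
      map_add' := fun ξ η => ext_slice f fun k => by simp only [map_add, hT₀]
      map_smul' := fun c ξ => ext_slice f fun k => by simp only [map_smul, hT₀, RingHom.id_apply] }
  refine ⟨T, ⟨⟨a, b, ha, hb, fun ξ => ?_⟩, fun x y h => ext_slice f fun k => ?_⟩, hT₀⟩
  · refine hasSum_le (fun k => ?_) (hasSum_norm_slice_sq f (T ξ)) (hbound ξ)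
    exact (congrArg (fun z => ‖z‖ ^ 2) (hT₀ ξ k)).trans_le (hle ξ k)
  · have hslice : domainSlice G.sqrt (f k) ⟨tens (x : H) y, h⟩ = ⟪f k, y⟫_ℂ • x :=
      Subtype.ext (slice_tens _ _ _)
    exact (hT₀ _ k).trans (by rw [hslice, map_smul, slice_tens])

theorem tendsto_ampl_cutoff (G : PosOp H) (A : G.BG)
    {T : (amplPMap K G.sqrt.op).domain →ₗ[ℂ] HTensor H K} (hT : IsAmplExtension G.sqrt.op A.1 T)
    (ξ : (amplPMap K G.sqrt.op).domain) :
    Filter.Tendsto (fun n => ampl K (G.cutoff A n) (ξ : HTensor H K)) Filter.atTop (𝓝 (T ξ)) := by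
  obtain ⟨w, f, -⟩ := exists_hilbertBasis ℂ K
  obtain ⟨T', hT', hsl⟩ := exists_isAmplExtension f G A
  obtain rfl := hT.unique G.sqrt hT'
  obtain ⟨a, b, -, -, hA⟩ := A.2
  let x := fun k => domainSlice G.sqrt (f k) ξ
  have hnorm : ∀ n, ∑' k, ‖A.1 (x k) - G.cutoff A n (x k)‖ ^ 2 =
      ‖T ξ - ampl K (G.cutoff A n) (ξ : HTensor H K)‖ ^ 2 := fun n => by
    rw [← (hasSum_norm_slice_sq f (T ξ - ampl K (G.cutoff A n) (ξ : HTensor H K))).tsum_eq]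
    simp_rw [map_sub, slice_ampl, hsl]
    rfl
  have hlim := tendsto_tsum_of_dominated_convergence (𝓕 := Filter.atTop)
    (f := fun n k => ‖A.1 (x k) - G.cutoff A n (x k)‖ ^ 2) (g := fun _ => 0)
    (hasSum_relBound_slice f G.sqrt a b ξ).summable
    (fun k => by simpa using ((G.tendsto_cutoff (x k) A).const_sub (A.1 (x k))).norm.pow 2)
    (Filter.Eventually.of_forall fun n k => by
      rw [Real.norm_of_nonneg (by positivity)]
      refine (G.norm_sub_cutoff_sq_le n (x k) hA).trans_eq ?_
      simp only [x, coe_domainSlice, apply_domainSlice])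
  simp_rw [hnorm, tsum_zero] at hlim
  rw [tendsto_iff_norm_sub_tendsto_zero]
  simpa [norm_sub_rev] using hlim.sqrt

end Amplification

/-! ## Existence of Stinespring representations -/

section LoewnerOrder

variable {H : Type*} [NormedAddCommGroup H] [InnerProductSpace ℂ H] {A B : H →L[ℂ] H}

theorem re_inner_le_of_le (h : A ≤ B) (x : H) : (⟪x, A x⟫_ℂ).re ≤ (⟪x, B x⟫_ℂ).re := by
  have h1 := ((ContinuousLinearMap.le_def A B).1 h).re_inner_nonneg_right x
  rw [sub_apply, inner_sub_right, map_sub] at h1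
  exact sub_nonneg.1 h1

theorem le_of_re_inner_le [CompleteSpace H] (hA : IsSelfAdjoint A) (hB : IsSelfAdjoint B)
    (h : ∀ x, (⟪x, A x⟫_ℂ).re ≤ (⟪x, B x⟫_ℂ).re) : A ≤ B := by
  rw [ContinuousLinearMap.le_def, ContinuousLinearMap.isPositive_def']
  refine ⟨hB.sub hA, fun x => ?_⟩
  rw [ContinuousLinearMap.reApplyInnerSelf_apply, inner_re_symm, sub_apply,
    inner_sub_right, map_sub]
  exact sub_nonneg.2 (h x)

theorem isLUB_of_tendsto_re_inner [CompleteSpace H] {σ : Type*} [Preorder σ] [IsDirectedOrder σ]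
    [Nonempty σ] {T : σ → H →L[ℂ] H} (hmono : Monotone T) (hT : ∀ s, IsSelfAdjoint (T s))
    (hA : IsSelfAdjoint A)
    (hlim : ∀ x, Filter.Tendsto (fun s => (⟪x, T s x⟫_ℂ).re) Filter.atTop
      (𝓝 (⟪x, A x⟫_ℂ).re)) :
    IsLUB (Set.range T) A := by
  refine ⟨?_, fun B hB => ?_⟩
  · rintro _ ⟨s, rfl⟩
    refine le_of_re_inner_le (hT s) hA fun x => ge_of_tendsto (hlim x) ?_
    filter_upwards [Filter.eventually_ge_atTop s] with t ht
    exact re_inner_le_of_le (hmono ht) x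
  · obtain ⟨s⟩ := ‹Nonempty σ›
    have hBsa : IsSelfAdjoint B := by
      simpa using (IsSelfAdjoint.of_nonneg (sub_nonneg.2 (hB ⟨s, rfl⟩))).add (hT s)
    exact le_of_re_inner_le hA hBsa fun x =>
      le_of_tendsto (hlim x) (.of_forall fun t => re_inner_le_of_le (hB ⟨t, rfl⟩) x)

end LoewnerOrder

section BasisProj

open InnerProductSpace (rankOne)

variable {H : Type*} [NormedAddCommGroup H] [InnerProductSpace ℂ H]

theorem rankOne_mul_rankOne (x y z t : H) :
    rankOne ℂ x y * rankOne ℂ z t = ⟪y, z⟫_ℂ • rankOne ℂ x t :=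
  InnerProductSpace.rankOne_comp_rankOne x y z t

variable {ι : Type*} (b : HilbertBasis ι ℂ H) (s : Finset ι)

/-- The orthogonal projection onto the span of finitely many basis vectors. Its strong convergence
to the identity is the net to which normality is applied. -/
def basisProj : H →L[ℂ] H := ∑ i ∈ s, rankOne ℂ (b i) (b i)

theorem basisProj_mul_self : basisProj b s * basisProj b s = basisProj b s := by
  classical
  simp only [basisProj, Finset.sum_mul, Finset.mul_sum, rankOne_mul_rankOne,
    orthonormal_iff_ite.1 b.orthonormal]
  refine Finset.sum_congr rfl fun i hi => ?_
  simp [ite_smul, hi]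

theorem basisProj_mul_mul (A : H →L[ℂ] H) : basisProj b s * A * basisProj b s =
    ∑ i ∈ s, ∑ j ∈ s, ⟪b i, A (b j)⟫_ℂ • rankOne ℂ (b i) (b j) := by
  simp only [basisProj, Finset.sum_mul, Finset.mul_sum]
  refine Finset.sum_comm.trans (Finset.sum_congr rfl fun i _ => Finset.sum_congr rfl fun j _ => ?_)
  have hA : A * rankOne ℂ (b j) (b j) = rankOne ℂ (A (b j)) (b j) :=
    InnerProductSpace.comp_rankOne _ _ A
  rw [mul_assoc, hA, rankOne_mul_rankOne]

theorem re_inner_basisProj (x : H) :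
    (⟪x, basisProj b s x⟫_ℂ).re = ∑ i ∈ s, ‖⟪b i, x⟫_ℂ‖ ^ 2 := by
  simp only [basisProj, sum_apply, InnerProductSpace.rankOne_apply, inner_sum,
    inner_smul_right, Complex.re_sum]
  refine Finset.sum_congr rfl fun i _ => ?_
  rw [mul_comm, inner_mul_inner_symm, Complex.ofReal_re]

theorem tendsto_re_inner_basisProj (x : H) :
    Filter.Tendsto (fun s => (⟪x, basisProj b s x⟫_ℂ).re) Filter.atTop (𝓝 (⟪x, x⟫_ℂ).re) := by
  simp_rw [re_inner_basisProj]
  refine (Complex.hasSum_re (b.hasSum_inner_mul_inner x x)).congr_fun fun i => ?_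
  rw [inner_mul_inner_symm, Complex.ofReal_re]

variable [CompleteSpace H]

theorem isSelfAdjoint_basisProj : IsSelfAdjoint (basisProj b s) := by
  simp only [isSelfAdjoint_iff, basisProj, star_sum, ContinuousLinearMap.star_eq_adjoint,
    InnerProductSpace.adjoint_rankOne]

theorem monotone_basisProj : Monotone (basisProj b) := fun s t h => by
  refine le_of_re_inner_le (isSelfAdjoint_basisProj b s) (isSelfAdjoint_basisProj b t) fun x => ?_
  rw [re_inner_basisProj, re_inner_basisProj]
  exact Finset.sum_le_sum_of_subset_of_nonneg h fun _ _ _ => by positivity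

theorem isLUB_basisProj : IsLUB (Set.range (basisProj b)) 1 :=
  isLUB_of_tendsto_re_inner (monotone_basisProj b) (fun s => isSelfAdjoint_basisProj b s)
    (.one _) (tendsto_re_inner_basisProj b)

theorem norm_basisProj_le_one : ‖basisProj b s‖ ≤ 1 :=
  IsStarProjection.norm_le _ ⟨basisProj_mul_self b s, isSelfAdjoint_basisProj b s⟩

end BasisProj

section Kolmogorov

theorem exists_eq_star_mul_self {A : Type*} [NonUnitalCStarAlgebra A] [PartialOrder A]
    [StarOrderedRing A] {a : A} (h : 0 ≤ a) : ∃ b, a = star b * b :=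
  CStarAlgebra.nonneg_iff_eq_star_mul_self.1 h

variable {H : Type u} {H' : Type v} {L : Type w}
  [NormedAddCommGroup H] [InnerProductSpace ℂ H] [CompleteSpace H]
  [NormedAddCommGroup H'] [InnerProductSpace ℂ H'] [CompleteSpace H']
  [NormedAddCommGroup L] [InnerProductSpace ℂ L] (Φ : (H →L[ℂ] H) →CP (H' →L[ℂ] H'))

theorem re_inner_map_le {A : H →L[ℂ] H} (hA : A ≤ 1) (x : H') :
    (⟪x, Φ A x⟫_ℂ).re ≤ ‖Φ 1‖ * ‖x‖ ^ 2 := by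
  refine (re_inner_le_of_le (OrderHomClass.mono Φ hA) x).trans ((Complex.re_le_norm _).trans ?_)
  refine (norm_inner_le_norm _ _).trans ?_
  rw [pow_two, mul_left_comm]
  exact mul_le_mul_of_nonneg_left ((Φ 1).le_opNorm x) (norm_nonneg x)

theorem exists_map_star_mul_eq_sum {n : Type*} [Fintype n] (a : n → H →L[ℂ] H) :
    ∃ N : n → n → H' →L[ℂ] H', ∀ i j, Φ (star (a i) * a j) = ∑ k, star (N k i) * N k j := by
  classical
  rcases isEmpty_or_nonempty n with hn | ⟨⟨k₀⟩⟩
  · exact ⟨fun i => isEmptyElim i, fun i => isEmptyElim i⟩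
  let B : CStarMatrix n n (H →L[ℂ] H) := CStarMatrix.ofMatrix fun k j => if k = k₀ then a j else 0
  have hB : ∀ i j, (star B * B) i j = star (a i) * a j := fun i j => by
    have hk : ∀ k j, B k j = if k = k₀ then a j else 0 := fun k j => rfl
    simp [CStarMatrix.mul_apply, CStarMatrix.star_apply, hk]
  have h0 : 0 ≤ (star B * B).map Φ := Φ.map_cstarMatrix_nonneg _ (star_mul_self_nonneg B)
  obtain ⟨N, hN⟩ := exists_eq_star_mul_self h0
  refine ⟨fun k j => N k j, fun i j => ?_⟩
  rw [← hB i j]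
  simpa [CStarMatrix.mul_apply, CStarMatrix.star_apply] using congrFun (congrFun hN i) j

theorem star_map_star_mul (a b : H →L[ℂ] H) : star (Φ (star a * b)) = Φ (star b * a) := by
  obtain ⟨N, hN⟩ := exists_map_star_mul_eq_sum Φ fun i : Bool => if i then a else b
  have hab := hN true false
  have hba := hN false true
  simp only [if_true, Bool.false_eq_true, if_false] at hab hba
  simp [hab, hba]

/-- The operator-valued kernel `(a, b) ↦ Φ(a* b)`, whose reproducing kernel space carries the
Stinespring representation of `Φ`. -/
def cpKernel : Matrix (H →L[ℂ] H) (H →L[ℂ] H) (H' →L[ℂ] H') := .of fun a b => Φ (star a * b)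

theorem posSemidef_cpKernel : (cpKernel Φ).PosSemidef := by
  have htfae := (RKHS.posSemidef_tfae (K := cpKernel Φ)).out 0 2
  refine htfae.2 ⟨?_, fun vv => ?_⟩
  · ext1 a b
    exact star_map_star_mul Φ b a
  obtain ⟨N, hN⟩ := exists_map_star_mul_eq_sum Φ fun i : vv.support => (i : H →L[ℂ] H)
  have hsq : (vv.sum fun x w => vv.sum fun x' w' => ⟪cpKernel Φ x' x w, w'⟫_ℂ) =
      ∑ k, ⟪∑ i : vv.support, N k i (vv i), ∑ i : vv.support, N k i (vv i)⟫_ℂ := by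
    simp_rw [sum_inner, inner_sum]
    rw [Finsupp.sum, ← Finset.sum_coe_sort, Finset.sum_comm]
    refine Finset.sum_congr rfl fun i _ => ?_
    rw [Finsupp.sum, ← Finset.sum_coe_sort, Finset.sum_comm]
    refine Finset.sum_congr rfl fun j _ => ?_
    simp only [cpKernel, Matrix.of_apply]
    rw [hN j i]
    simp [ContinuousLinearMap.star_eq_adjoint, ContinuousLinearMap.adjoint_inner_left]
  rw [hsq, map_sum]
  exact Finset.sum_nonneg fun k _ => inner_self_nonneg

/-- A Kolmogorov decomposition of the kernel `(a, b) ↦ Φ(a* b)`; for a Stinespring representation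
`V` the maps `q a = (a ⊗ 1) V` form one. -/
def IsKolmogorovDecomposition (q : (H →L[ℂ] H) → H' →L[ℂ] L) : Prop :=
  ∀ a b x y, ⟪q a x, q b y⟫_ℂ = ⟪x, Φ (star a * b) y⟫_ℂ

theorem exists_isKolmogorovDecomposition :
    ∃ (L : Type (max u v)) (_ : NormedAddCommGroup L) (_ : InnerProductSpace ℂ L)
      (_ : CompleteSpace L) (q : (H →L[ℂ] H) → H' →L[ℂ] L), IsKolmogorovDecomposition Φ q := by
  have : Fact (cpKernel Φ).PosSemidef := ⟨posSemidef_cpKernel Φ⟩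
  refine ⟨RKHS.OfKernel (cpKernel Φ), inferInstance, inferInstance, inferInstance,
    RKHS.kerFun (RKHS.OfKernel (cpKernel Φ)), fun a b x y => ?_⟩
  rw [← RKHS.kernel_inner, RKHS.OfKernel.kernel_ofKernel]
  change ⟪Φ (star b * a) x, y⟫_ℂ = _
  rw [← star_map_star_mul, ContinuousLinearMap.star_eq_adjoint,
    ContinuousLinearMap.adjoint_inner_left]

namespace IsKolmogorovDecomposition

variable {Φ} {q : (H →L[ℂ] H) → H' →L[ℂ] L} (hq : IsKolmogorovDecomposition Φ q)
include hq

theorem norm_apply_sq (a : H →L[ℂ] H) (x : H') :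
    ‖q a x‖ ^ 2 = (⟪x, Φ (star a * a) x⟫_ℂ).re := by
  rw [← re_inner_self_eq_norm_sq, hq]

theorem norm_apply_le (a : H →L[ℂ] H) (x : H') : ‖q a x‖ ≤ ‖a‖ * ‖q 1 x‖ := by
  refine le_of_sq_le_sq ?_ (by positivity)
  have hle : star a * a ≤ ((‖a‖ ^ 2 : ℝ) : ℂ) • (1 : H →L[ℂ] H) := by
    have h := CStarAlgebra.star_mul_le_algebraMap_norm_sq (a := a)
    rwa [Algebra.algebraMap_eq_smul_one, ← Complex.coe_smul] at h
  refine (hq.norm_apply_sq a x).trans_le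
    ((re_inner_le_of_le (OrderHomClass.mono Φ hle) x).trans_eq ?_)
  rw [map_smul, smul_apply, inner_smul_right, Complex.re_ofReal_mul, mul_pow, hq.norm_apply_sq,
    star_one, one_mul]

theorem norm_inner_map_mul_mul_sub_le {P : H →L[ℂ] H} (hP : IsSelfAdjoint P) (hP1 : ‖P‖ ≤ 1)
    (A : H →L[ℂ] H) (x y : H') :
    ‖⟪x, Φ (P * A * P) y⟫_ℂ - ⟪x, Φ A y⟫_ℂ‖ ≤
      ‖q (1 - P) x‖ * (‖A‖ * ‖q 1 y‖) + ‖A‖ * ‖q 1 x‖ * ‖q (1 - P) y‖ := by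
  have hsplit : ⟪x, Φ (P * A * P) y⟫_ℂ - ⟪x, Φ A y⟫_ℂ =
      -(⟪q (1 - P) x, q A y⟫_ℂ + ⟪q (star A * P) x, q (1 - P) y⟫_ℂ) := by
    rw [hq, hq, star_sub, star_one, star_mul, star_star, hP.star_eq, sub_mul, mul_sub, one_mul,
      mul_one]
    simp only [map_sub, sub_apply, inner_sub_right]
    ring
  have hnorm : ‖star A * P‖ ≤ ‖A‖ := by
    simpa using (norm_mul_le (star A) P).trans (mul_le_of_le_one_right (norm_nonneg _) hP1)
  rw [hsplit, norm_neg]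
  refine (norm_add_le _ _).trans (add_le_add ?_ ?_) <;> refine (norm_inner_le_norm _ _).trans ?_
  · exact mul_le_mul_of_nonneg_left (hq.norm_apply_le A y) (norm_nonneg _)
  · refine mul_le_mul_of_nonneg_right ((hq.norm_apply_le _ x).trans ?_) (norm_nonneg _)
    exact mul_le_mul_of_nonneg_right hnorm (norm_nonneg _)

end IsKolmogorovDecomposition

end Kolmogorov

section SeparableModel

variable {E : Type*} [NormedAddCommGroup E] [InnerProductSpace ℂ E]
  [TopologicalSpace.SeparableSpace E]

theorem countable_of_orthonormal {ι : Type*} {v : ι → E} (hv : Orthonormal ℂ v) :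
    Countable ι := by
  refine Pairwise.countable_of_isOpen_disjoint (s := fun i => Metric.ball (v i) (1 / 2)) ?_
    (fun i => Metric.isOpen_ball) (fun i => ⟨v i, Metric.mem_ball_self (by norm_num)⟩)
  intro i j hij
  refine Metric.ball_disjoint_ball ?_
  have hdist : ‖v i - v j‖ ^ 2 = 2 := by
    rw [norm_sub_sq (𝕜 := ℂ), hv.2 hij, hv.1, hv.1]
    norm_num
  rw [dist_eq_norm]
  nlinarith [norm_nonneg (v i - v j)]

variable (E) in
theorem exists_linearIsometry_separable [CompleteSpace E] :
    ∃ (K : Type w) (_ : NormedAddCommGroup K) (_ : InnerProductSpace ℂ K) (_ : CompleteSpace K)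
      (_ : TopologicalSpace.SeparableSpace K), Nonempty (E →ₗᵢ[ℂ] K) := by
  obtain ⟨s, f, -⟩ := exists_hilbertBasis ℂ E
  have : Countable s := countable_of_orthonormal f.orthonormal
  obtain ⟨g, hg⟩ := Countable.exists_injective_nat s
  let e : HilbertBasis (ULift.{w} ℕ) ℂ (lp (fun _ : ULift.{w} ℕ => ℂ) 2) := default
  have he : Orthonormal ℂ fun i : s => e (ULift.up (g i)) :=
    e.orthonormal.comp _ (ULift.up_injective.comp hg)
  refine ⟨lp (fun _ : ULift.{w} ℕ => ℂ) 2, inferInstance, inferInstance, inferInstance, ?_,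
    ⟨he.orthogonalFamily.linearIsometry.comp f.repr.toLinearIsometry⟩⟩
  have hsep := ((Set.countable_range e).isSeparable.span (R := ℂ)).closure
  rw [← Submodule.topologicalClosure_coe, e.dense_span] at hsep
  exact TopologicalSpace.isSeparable_univ_iff.1 hsep

end SeparableModel

section BlockDecomposition

open InnerProductSpace (rankOne)

variable {H : Type u} {H' : Type v}
  [NormedAddCommGroup H] [InnerProductSpace ℂ H] [CompleteSpace H]
  [NormedAddCommGroup H'] [InnerProductSpace ℂ H'] [CompleteSpace H']
  {K : Type*} [NormedAddCommGroup K] [InnerProductSpace ℂ K]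
  (Φ : (H →L[ℂ] H) →CP (H' →L[ℂ] H')) {ι : Type*} (b : HilbertBasis ι ℂ H)

/-- The maps `p i = (⟨b i| ⊗ 1) V` obtained from a Stinespring representation `V` and an
orthonormal basis `b`, characterised by their inner products. -/
def IsBlockDecomposition (p : ι → H' →L[ℂ] K) : Prop :=
  ∀ i j x y, ⟪p i x, p j y⟫_ℂ = ⟪x, Φ (rankOne ℂ (b i) (b j)) y⟫_ℂ

theorem exists_isBlockDecomposition [TopologicalSpace.SeparableSpace H]
    [TopologicalSpace.SeparableSpace H'] :
    ∃ (K : Type w) (_ : NormedAddCommGroup K) (_ : InnerProductSpace ℂ K) (_ : CompleteSpace K)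
      (_ : TopologicalSpace.SeparableSpace K) (p : ι → H' →L[ℂ] K),
      IsBlockDecomposition Φ b p := by
  rcases isEmpty_or_nonempty ι with hι | ⟨⟨i₀⟩⟩
  · obtain ⟨K, _, _, _, _, -⟩ := exists_linearIsometry_separable.{w} H
    exact ⟨K, _, _, ‹_›, ‹_›, fun i : ι => isEmptyElim i, fun i => isEmptyElim i⟩
  obtain ⟨L, _, _, _, q, hq⟩ := exists_isKolmogorovDecomposition Φ
  have : Countable ι := countable_of_orthonormal b.orthonormal
  let M : Submodule ℂ L :=
    (Submodule.span ℂ (⋃ i, Set.range (q (rankOne ℂ (b i₀) (b i))))).topologicalClosure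
  have hsep : TopologicalSpace.IsSeparable (M : Set L) := by
    rw [Submodule.topologicalClosure_coe]
    refine (TopologicalSpace.IsSeparable.span (R := ℂ) ?_).closure
    exact TopologicalSpace.IsSeparable.iUnion fun i =>
      TopologicalSpace.isSeparable_range (q _).continuous
  have : TopologicalSpace.SeparableSpace M := hsep.separableSpace
  have : CompleteSpace M := (Submodule.isClosed_topologicalClosure _).completeSpace_coe
  obtain ⟨K, _, _, _, _, ⟨U⟩⟩ := exists_linearIsometry_separable.{w} M
  have hmem : ∀ i x, q (rankOne ℂ (b i₀) (b i)) x ∈ M := fun i x =>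
    Submodule.le_topologicalClosure _ (Submodule.subset_span (Set.mem_iUnion.2 ⟨i, x, rfl⟩))
  refine ⟨K, _, _, ‹_›, ‹_›,
    fun i => U.toContinuousLinearMap.comp ((q (rankOne ℂ (b i₀) (b i))).codRestrict M (hmem i)),
    fun i j x y => ?_⟩
  change ⟪U _, U _⟫_ℂ = _
  rw [LinearIsometry.inner_map_map]
  refine (hq _ _ x y).trans ?_
  rw [ContinuousLinearMap.star_eq_adjoint, InnerProductSpace.adjoint_rankOne,
    rankOne_mul_rankOne, inner_self_eq_norm_sq_to_K, b.orthonormal.1]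
  simp

namespace IsBlockDecomposition

variable {Φ} {b} {p : ι → H' →L[ℂ] K} (hp : IsBlockDecomposition Φ b p)
include hp

theorem inner_sum_tens_ampl (s : Finset ι) (A : H →L[ℂ] H) (x y : H') :
    ⟪∑ i ∈ s, tens (b i) (p i x), ampl K A (∑ i ∈ s, tens (b i) (p i y))⟫_ℂ =
      ⟪x, Φ (basisProj b s * A * basisProj b s) y⟫_ℂ := by
  simp only [basisProj_mul_mul, map_sum, map_smul, sum_apply,
    smul_apply, inner_sum, sum_inner, ampl_tens, inner_tens, hp _ _ _ _,
    inner_smul_right]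
  exact Finset.sum_comm

theorem norm_sum_tens_sq (s : Finset ι) (x : H') :
    ‖∑ i ∈ s, tens (b i) (p i x)‖ ^ 2 = (⟪x, Φ (basisProj b s) x⟫_ℂ).re := by
  have h := hp.inner_sum_tens_ampl s 1 x x
  rw [ampl_one, mul_one, basisProj_mul_self] at h
  rw [← h, one_apply_eq_self, re_inner_self_eq_norm_sq]

theorem norm_sum_tens_sq_le (s : Finset ι) (x : H') :
    ‖∑ i ∈ s, tens (b i) (p i x)‖ ^ 2 ≤ ‖Φ 1‖ * ‖x‖ ^ 2 :=
  (hp.norm_sum_tens_sq s x).trans_le (re_inner_map_le Φ ((isLUB_basisProj b).1 ⟨s, rfl⟩) x)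

theorem summable_tens [CompleteSpace K] (x : H') : Summable fun i => tens (b i) (p i x) := by
  let J : ι → K →ₗᵢ[ℂ] HTensor H K := fun i =>
    ⟨(tensR K (b i) : K →ₗ[ℂ] HTensor H K), fun y => by
      change ‖tens (b i) y‖ = ‖y‖
      rw [norm_tens, b.orthonormal.1 i, one_mul]⟩
  have hJ : OrthogonalFamily ℂ (fun _ : ι => K) J := fun i j hij x y => by
    change ⟪tens (b i) x, tens (b j) y⟫_ℂ = 0
    rw [inner_tens, b.orthonormal.2 hij, zero_mul]
  refine (hJ.summable_iff_norm_sq_summable fun i => p i x).2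
    (summable_of_sum_le (c := ‖Φ 1‖ * ‖x‖ ^ 2) (fun _ => by positivity) fun s => ?_)
  rw [← hJ.norm_sum (fun i => p i x) s]
  exact hp.norm_sum_tens_sq_le s x

theorem exists_hasSum_tens [CompleteSpace K] :
    ∃ V : H' →L[ℂ] HTensor H K, ∀ x, HasSum (fun i => tens (b i) (p i x)) (V x) := by
  have hs := fun x => (hp.summable_tens x).hasSum
  let V : H' →ₗ[ℂ] HTensor H K :=
    { toFun := fun x => ∑' i, tens (b i) (p i x)
      map_add' := fun x y => by
        refine (((hs x).add (hs y)).congr_fun fun i => ?_).tsum_eq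
        rw [map_add, ← tensR_apply, map_add]; rfl
      map_smul' := fun c x => by
        refine (((hs x).const_smul c).congr_fun fun i => ?_).tsum_eq
        rw [map_smul, ← tensR_apply, map_smul]; rfl }
  refine ⟨V.mkContinuous (√‖Φ 1‖) fun x => ?_, hs⟩
  refine le_of_tendsto (hs x).norm (.of_forall fun s => le_of_sq_le_sq ?_ (by positivity))
  rw [mul_pow, Real.sq_sqrt (norm_nonneg _)]
  exact hp.norm_sum_tens_sq_le s x

theorem tendsto_re_inner_map_basisProj [CompleteSpace K] (hΦ : IsNormalMap Φ) (x : H') :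
    Filter.Tendsto (fun s => (⟪x, Φ (basisProj b s) x⟫_ℂ).re) Filter.atTop
      (𝓝 (⟪x, Φ 1 x⟫_ℂ).re) := by
  obtain ⟨V, hV⟩ := hp.exists_hasSum_tens
  have hlim : ∀ x, Filter.Tendsto (fun s => (⟪x, Φ (basisProj b s) x⟫_ℂ).re) Filter.atTop
      (𝓝 (⟪x, ((ContinuousLinearMap.adjoint V).comp V) x⟫_ℂ).re) := fun x => by
    rw [ContinuousLinearMap.comp_apply, ContinuousLinearMap.adjoint_inner_right,
      re_inner_self_eq_norm_sq]
    simp_rw [← hp.norm_sum_tens_sq]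
    exact (hV x).norm.pow 2
  have hΦP : ∀ s, IsSelfAdjoint (Φ (basisProj b s)) := fun s => by
    have h := star_map_star_mul Φ (basisProj b s) (basisProj b s)
    rwa [(isSelfAdjoint_basisProj b s).star_eq, basisProj_mul_self] at h
  have hLUB := hΦ (Set.range (basisProj b)) (Set.range_nonempty _)
    (directedOn_range.2 (monotone_basisProj b).directed_le) 1 (isLUB_basisProj b)
  rw [← Set.range_comp] at hLUB
  rw [hLUB.unique (isLUB_of_tendsto_re_inner
    ((OrderHomClass.mono Φ).comp (monotone_basisProj b)) hΦP
    (ContinuousLinearMap.isPositive_adjoint_comp_self V).isSelfAdjoint hlim)]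
  exact hlim x

theorem tendsto_inner_map_mul_mul [CompleteSpace K] (hΦ : IsNormalMap Φ) (A : H →L[ℂ] H)
    (x y : H') :
    Filter.Tendsto (fun s => ⟪x, Φ (basisProj b s * A * basisProj b s) y⟫_ℂ) Filter.atTop
      (𝓝 ⟪x, Φ A y⟫_ℂ) := by
  obtain ⟨L, _, _, _, q, hq⟩ := exists_isKolmogorovDecomposition Φ
  have hq0 : ∀ x, Filter.Tendsto (fun s => ‖q (1 - basisProj b s) x‖) Filter.atTop (𝓝 0) := by
    intro x
    have hsq : ∀ s, ‖q (1 - basisProj b s) x‖ ^ 2 =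
        (⟪x, Φ 1 x⟫_ℂ).re - (⟪x, Φ (basisProj b s) x⟫_ℂ).re := fun s => by
      rw [hq.norm_apply_sq, star_sub, star_one, (isSelfAdjoint_basisProj b s).star_eq, mul_sub,
        sub_mul, sub_mul, basisProj_mul_self]
      simp
    have h := ((hp.tendsto_re_inner_map_basisProj hΦ x).const_sub (⟪x, Φ 1 x⟫_ℂ).re).sqrt
    simp_rw [← hsq, sub_self, Real.sqrt_zero] at h
    simpa using h
  rw [tendsto_iff_norm_sub_tendsto_zero]
  refine squeeze_zero (fun _ => norm_nonneg _) (fun s => hq.norm_inner_map_mul_mul_sub_le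
    (isSelfAdjoint_basisProj b s) (norm_basisProj_le_one b s) A x y) ?_
  simpa using ((hq0 x).mul_const (‖A‖ * ‖q 1 y‖)).add ((hq0 y).const_mul (‖A‖ * ‖q 1 x‖))

theorem exists_isStinespring [CompleteSpace K] (hΦ : IsNormalMap Φ) :
    ∃ V : H' →L[ℂ] HTensor H K, IsStinespring Φ V := by
  obtain ⟨V, hV⟩ := hp.exists_hasSum_tens
  refine ⟨V, fun A => ?_⟩
  ext y
  refine ext_inner_left ℂ fun x => ?_
  rw [ContinuousLinearMap.comp_apply, ContinuousLinearMap.adjoint_inner_right]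
  refine tendsto_nhds_unique (hp.tendsto_inner_map_mul_mul hΦ A x y) ?_
  simp_rw [← hp.inner_sum_tens_ampl]
  exact (hV x).inner (((ampl K A).continuous.tendsto _).comp (hV y))

end IsBlockDecomposition

variable {Φ} in
theorem exists_isStinespring [TopologicalSpace.SeparableSpace H]
    [TopologicalSpace.SeparableSpace H'] (hΦ : IsNormalMap Φ) :
    ∃ (K : Type w) (_ : NormedAddCommGroup K) (_ : InnerProductSpace ℂ K) (_ : CompleteSpace K)
      (_ : TopologicalSpace.SeparableSpace K) (V : H' →L[ℂ] HTensor H K), IsStinespring Φ V := by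
  obtain ⟨K, _, _, _, _, p, hp⟩ := exists_isBlockDecomposition Φ (onb H)
  obtain ⟨V, hV⟩ := hp.exists_isStinespring hΦ
  exact ⟨K, _, _, ‹_›, ‹_›, V, hV⟩

end BlockDecomposition

/-! ## Output energy -/

section OutputEnergy

variable {H H' : Type*} [NormedAddCommGroup H] [InnerProductSpace ℂ H]
  [NormedAddCommGroup H'] [InnerProductSpace ℂ H'] [CompleteSpace H']

theorem summable_inner_clm_apply {ι : Type*} {ψ : ι → H} (h : ∑' i, ‖ψ i‖ₑ ^ 2 ≠ ⊤)
    (A : H →L[ℂ] H) : Summable fun i => ⟪ψ i, A (ψ i)⟫_ℂ := by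
  refine Summable.of_norm_bounded
    ((summable_norm_sq_of_tsum_enorm_ne_top h).mul_left ‖A‖) fun i => ?_
  calc ‖⟪ψ i, A (ψ i)⟫_ℂ‖ ≤ ‖ψ i‖ * ‖A (ψ i)‖ := norm_inner_le_norm _ _
    _ ≤ ‖ψ i‖ * (‖A‖ * ‖ψ i‖) := by gcongr; exact A.le_opNorm _
    _ = ‖A‖ * ‖ψ i‖ ^ 2 := by ring

variable [CompleteSpace H]

theorem predual_eq {Φ : (H →L[ℂ] H) →CP (H' →L[ℂ] H')} {ρ : H' →L[ℂ] H'} {σ : H →L[ℂ] H}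
    (hσ : IsPosTraceClass σ) (h : ∀ A : H →L[ℂ] H, opTrace (σ * A) = opTrace (Φ A * ρ)) :
    predual Φ ρ = σ := by
  have hex : ∃ σ : H →L[ℂ] H, IsPosTraceClass σ ∧
      ∀ A : H →L[ℂ] H, opTrace (σ * A) = opTrace (Φ A * ρ) := ⟨σ, hσ, h⟩
  rw [predual, dif_pos hex]
  exact eq_of_opTrace_mul_eq fun A => (hex.choose_spec.2 A).trans (h A).symm

theorem exists_isState {ι : Type*} {φ : ι → H} (h1 : ∑' i, ‖φ i‖ₑ ^ 2 = 1) :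
    ∃ ρ : H →L[ℂ] H, IsState ρ ∧ Decomposes φ ρ := by
  obtain ⟨ρ, hρ, hd⟩ := exists_decomposes (ψ := φ) (by rw [h1]; exact ENNReal.one_ne_top)
  exact ⟨ρ, ⟨hρ, by rw [hd.posTrace_eq, h1]⟩, hd⟩

variable {K : Type*} [NormedAddCommGroup K] [InnerProductSpace ℂ K]
  {Φ : (H →L[ℂ] H) →CP (H' →L[ℂ] H')} {V : H' →L[ℂ] HTensor H K}

namespace IsStinespring

theorem inner_map (hV : IsStinespring Φ V) (A : H →L[ℂ] H) (x y : H') :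
    ⟪x, Φ A y⟫_ℂ = ⟪V x, ampl K A (V y)⟫_ℂ := by
  rw [hV A, ContinuousLinearMap.comp_apply, ContinuousLinearMap.adjoint_inner_right]
  rfl

theorem norm_map_one (hV : IsStinespring Φ V) : ‖Φ 1‖ = ‖V‖ ^ 2 := by
  have h : Φ 1 = (ContinuousLinearMap.adjoint V).comp V := by
    rw [hV 1, ampl_one]; rfl
  rw [h, ContinuousLinearMap.norm_adjoint_comp_self, sq]

theorem enorm_apply_sq_le (hV : IsStinespring Φ V) (hsub : Φ 1 ≤ 1) (x : H') :
    ‖V x‖ₑ ^ 2 ≤ ‖x‖ₑ ^ 2 := by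
  rw [← ofReal_norm_sq, ← ofReal_norm_sq, ← re_inner_self_eq_norm_sq, ← re_inner_self_eq_norm_sq]
  refine ENNReal.ofReal_le_ofReal ?_
  simpa [hV.inner_map, ampl_one] using re_inner_le_of_le hsub x

theorem enorm_adjoint_sq_le (hV : IsStinespring Φ V) (η : HTensor H K) :
    ‖ContinuousLinearMap.adjoint V η‖ₑ ^ 2 ≤ ENNReal.ofReal ‖Φ 1‖ * ‖η‖ₑ ^ 2 := by
  rw [hV.norm_map_one, ← ofReal_norm_sq, ← ofReal_norm_sq, ← ENNReal.ofReal_mul (by positivity),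
    ← mul_pow]
  refine ENNReal.ofReal_le_ofReal (pow_le_pow_left₀ (norm_nonneg _) ?_ 2)
  refine (ContinuousLinearMap.le_opNorm _ _).trans_eq ?_
  rw [LinearIsometryEquiv.norm_map]

end IsStinespring

/-- The energy `∑ₖ ‖√G V_k x‖²` of the image of `|x⟩⟨x|` under the predual map, where
`V_k = (I ⊗ ⟨f_k|) V`. -/
def outForm {H' K κ : Type*} [NormedAddCommGroup H'] [InnerProductSpace ℂ H']
    [NormedAddCommGroup K] [InnerProductSpace ℂ K] (f : HilbertBasis κ ℂ K) (G : PosOp H)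
    (V : H' →L[ℂ] HTensor H K) (x : H') : ℝ≥0∞ :=
  ∑' k, sqNormOp G.sqrt.op (slice (f k) (V x))

variable {κ : Type*} (f : HilbertBasis κ ℂ K)

section OutForm

variable {H' : Type*} [NormedAddCommGroup H'] [InnerProductSpace ℂ H']
  (V : H' →L[ℂ] HTensor H K) (G : PosOp H)

theorem outForm_zero : outForm f G V 0 = 0 := by
  simp [outForm, sqNormOp_zero]

theorem outForm_sqrt_smul (t : ℝ≥0) (x : H') :
    outForm f G V (((NNReal.sqrt t : ℝ) : ℂ) • x) = t * outForm f G V x := by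
  simp_rw [outForm, map_smul, tsum_sqNormOp_sqrt_smul]

theorem tsum_sqNormOp_slice {ι : Type*} (φ : ι → H') :
    ∑' p : ι × κ, sqNormOp G.sqrt.op (slice (f p.2) (V (φ p.1))) = ∑' i, outForm f G V (φ i) :=
  ENNReal.tsum_prod (f := fun i k => sqNormOp G.sqrt.op (slice (f k) (V (φ i))))

theorem tsum_enorm_slice [CompleteSpace K] {ι : Type*} (φ : ι → H') :
    ∑' p : ι × κ, ‖slice (f p.2) (V (φ p.1))‖ₑ ^ 2 = ∑' i, ‖V (φ i)‖ₑ ^ 2 := by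
  rw [ENNReal.tsum_prod (f := fun i k => ‖slice (f k) (V (φ i))‖ₑ ^ 2)]
  simp_rw [← enorm_sq_eq_tsum_slice f]

end OutForm

variable [CompleteSpace K]

namespace IsStinespring

theorem decomposes_predual (hV : IsStinespring Φ V) {ι : Type*} {φ : ι → H'}
    {ρ : H' →L[ℂ] H'} (hρ : ρ.IsPositive) (hd : Decomposes φ ρ) (h1 : ∑' i, ‖φ i‖ₑ ^ 2 ≠ ⊤) :
    (predual Φ ρ).IsPositive ∧
      Decomposes (fun p : ι × κ => slice (f p.2) (V (φ p.1))) (predual Φ ρ) := by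
  have h2 : ∑' p : ι × κ, ‖slice (f p.2) (V (φ p.1))‖ₑ ^ 2 ≠ ⊤ := by
    rw [tsum_enorm_slice]
    exact tsum_enorm_clm_ne_top h1 V
  obtain ⟨σ, hσ, hdσ⟩ := exists_decomposes h2
  have htrace : ∀ A : H →L[ℂ] H, opTrace (σ * A) = opTrace (Φ A * ρ) := fun A => by
    rw [hdσ.opTrace_mul_right hσ h2, hd.opTrace_mul_left hρ h1,
      (summable_inner_clm_apply h2 A).tsum_prod]
    refine tsum_congr fun i => ?_
    rw [hV.inner_map, ← (hasSum_inner_slice f _ _).tsum_eq]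
    simp_rw [slice_ampl]
  rw [predual_eq ⟨hσ, by rwa [hdσ.posTrace_eq]⟩ htrace]
  exact ⟨hσ, hdσ⟩

theorem energy_predual (hV : IsStinespring Φ V) (G : PosOp H) {ι : Type*}
    {φ : ι → H'} {ρ : H' →L[ℂ] H'} (hρ : ρ.IsPositive) (hd : Decomposes φ ρ)
    (h1 : ∑' i, ‖φ i‖ₑ ^ 2 ≠ ⊤) :
    G.energy (predual Φ ρ) = ∑' i, outForm f G V (φ i) := by
  obtain ⟨h2, h3⟩ := hV.decomposes_predual f hρ hd h1
  rw [h3.energy_eq h2, tsum_sqNormOp_slice]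

end IsStinespring

variable {G : PosOp H} {G' : PosOp H'}

theorem IsLimited.tsum_outForm_ne_top (hL : IsLimited G G' Φ) (hV : IsStinespring Φ V)
    {ι : Type*} {φ : ι → H'} (h1 : ∑' i, ‖φ i‖ₑ ^ 2 = 1)
    (hS : ∑' i, sqNormOp G'.sqrt.op (φ i) ≠ ⊤) : ∑' i, outForm f G V (φ i) ≠ ⊤ := by
  obtain ⟨ρ, hρ, hd⟩ := exists_isState h1
  have h := hL ρ hρ (by rw [hd.energy_eq hρ.1]; exact hS.lt_top)
  rw [hV.energy_predual f G hρ.1 hd (by rw [h1]; exact ENNReal.one_ne_top)] at h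
  exact h.ne

namespace IsStinespring

theorem isLimited (hV : IsStinespring Φ V)
    (h : ∀ φ : onbIndex H' → H', ∑' i, ‖φ i‖ₑ ^ 2 = 1 →
      ∑' i, sqNormOp G'.sqrt.op (φ i) ≠ ⊤ → ∑' i, outForm f G V (φ i) ≠ ⊤) :
    IsLimited G G' Φ := by
  intro ρ hρ hE
  have hd := decomposes_sqrt hρ.1
  have h1 : ∑' i, ‖CFC.sqrt ρ (onb H' i)‖ₑ ^ 2 = 1 := by rw [← hd.posTrace_eq, hρ.2]
  rw [hV.energy_predual f G hρ.1 hd (by rw [h1]; exact ENNReal.one_ne_top)]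
  exact (h _ h1 hE.ne).lt_top

theorem tsum_outForm_le_of_eq_one (hV : IsStinespring Φ V) {E : ℝ≥0}
    {ι : Type*} {φ : ι → H'} (h1 : ∑' i, ‖φ i‖ₑ ^ 2 = 1)
    (hE : ∑' i, sqNormOp G'.sqrt.op (φ i) ≤ E) :
    ∑' i, outForm f G V (φ i) ≤ outEnergy G G' Φ E := by
  obtain ⟨ρ, hρ, hd⟩ := exists_isState h1
  rw [← hV.energy_predual f G hρ.1 hd (by rw [h1]; exact ENNReal.one_ne_top)]
  exact le_iSup₂_of_le ρ hρ (le_iSup_of_le (by rw [hd.energy_eq hρ.1]; exact hE) le_rfl)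

theorem outEnergy_le (hV : IsStinespring Φ V) {E : ℝ≥0} {c : ℝ≥0∞}
    (h : ∀ φ : onbIndex H' → H', ∑' i, ‖φ i‖ₑ ^ 2 = 1 →
      ∑' i, sqNormOp G'.sqrt.op (φ i) ≤ E → ∑' i, outForm f G V (φ i) ≤ c) :
    outEnergy G G' Φ E ≤ c := by
  refine iSup_le fun ρ => iSup₂_le fun hρ hE => ?_
  have hd := decomposes_sqrt hρ.1
  have h1 : ∑' i, ‖CFC.sqrt ρ (onb H' i)‖ₑ ^ 2 = 1 := by rw [← hd.posTrace_eq, hρ.2]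
  rw [hV.energy_predual f G hρ.1 hd (by rw [h1]; exact ENNReal.one_ne_top)]
  exact h _ h1 hE

theorem tsum_outForm_le (hV : IsStinespring Φ V) (hG' : G'.InfZero) {E : ℝ≥0}
    (hE0 : 0 < E) {ι : Type*} {φ : ι → H'} (h1 : ∑' i, ‖φ i‖ₑ ^ 2 ≤ 1)
    (hE : ∑' i, sqNormOp G'.sqrt.op (φ i) ≤ E) :
    ∑' i, outForm f G V (φ i) ≤ outEnergy G G' Φ E := by
  refine ENNReal.le_of_forall_lt_one_mul_le fun t ht => ?_
  lift t to ℝ≥0 using ne_top_of_lt ht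
  have htE : (t : ℝ≥0∞) * ∑' i, sqNormOp G'.sqrt.op (φ i) < E := by
    calc (t : ℝ≥0∞) * ∑' i, sqNormOp G'.sqrt.op (φ i) ≤ t * E := by gcongr
      _ < 1 * E := ENNReal.mul_lt_mul_left (by simpa using hE0.ne') ENNReal.coe_ne_top ht
      _ = E := one_mul _
  obtain ⟨χ, hχ1, hχ2⟩ := hG'.exists_normalized (E := E)
    (ψ := fun i => ((NNReal.sqrt t : ℝ) : ℂ) • φ i)
    (by rw [tsum_enorm_sqrt_smul]; exact mul_le_one' ht.le h1)
    (by rwa [tsum_sqNormOp_sqrt_smul])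
  calc t * ∑' i, outForm f G V (φ i)
      = ∑' i, outForm f G V (((NNReal.sqrt t : ℝ) : ℂ) • φ i) := by
        simp_rw [outForm_sqrt_smul, ENNReal.tsum_mul_left]
    _ ≤ ∑' s, outForm f G V
          (Sum.elim (fun i => ((NNReal.sqrt t : ℝ) : ℂ) • φ i) (fun _ : Unit => χ) s) := by
        rw [tsum_sumElim_unit (outForm f G V)]
        exact le_self_add
    _ ≤ outEnergy G G' Φ E := hV.tsum_outForm_le_of_eq_one f hχ1 hχ2

theorem tsum_outForm_le_mul (hV : IsStinespring Φ V) (hG' : G'.InfZero) {E N : ℝ≥0}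
    (hE0 : 0 < E) (hN : N ≠ 0) {ι : Type*} {φ : ι → H'} (h1 : ∑' i, ‖φ i‖ₑ ^ 2 ≤ N)
    (hE : ∑' i, sqNormOp G'.sqrt.op (φ i) ≤ N * E) :
    ∑' i, outForm f G V (φ i) ≤ N * outEnergy G G' Φ E := by
  have hN' : (N : ℝ≥0∞) ≠ 0 := ENNReal.coe_ne_zero.2 hN
  have key := hV.tsum_outForm_le (G := G) f hG' hE0
    (φ := fun i => ((NNReal.sqrt N⁻¹ : ℝ) : ℂ) • φ i)
  simp_rw [outForm_sqrt_smul] at key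
  rw [tsum_enorm_sqrt_smul, tsum_sqNormOp_sqrt_smul, ENNReal.tsum_mul_left,
    ENNReal.coe_inv hN, ENNReal.inv_mul_le_iff hN' ENNReal.coe_ne_top, mul_one,
    ENNReal.inv_mul_le_iff hN' ENNReal.coe_ne_top,
    ENNReal.inv_mul_le_iff hN' ENNReal.coe_ne_top] at key
  exact key h1 hE

theorem outEnergy_le_mul (hV : IsStinespring Φ V) (hG' : G'.InfZero) {E F : ℝ≥0}
    (hE : 0 < E) (hEF : E ≤ F) :
    outEnergy G G' Φ F ≤ ((F / E : ℝ≥0) : ℝ≥0∞) * outEnergy G G' Φ E := by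
  obtain ⟨s, f, -⟩ := exists_hilbertBasis ℂ K
  refine hV.outEnergy_le f fun φ h1 hφ => hV.tsum_outForm_le_mul f hG' hE
    (div_pos (hE.trans_le hEF) hE).ne' ?_ ?_
  · rw [h1]
    exact_mod_cast (one_le_div hE).2 hEF
  · rwa [← ENNReal.coe_mul, div_mul_cancel₀ _ hE.ne']

theorem outForm_le (hV : IsStinespring Φ V) (hG' : G'.InfZero) {E : ℝ≥0}
    (hE : 0 < E) (x : G'.sqrt.op.domain) :
    outForm f G V (x : H') ≤
      ENNReal.ofReal (‖(x : H')‖ ^ 2 + ‖G'.sqrt.op x‖ ^ 2 / E) * outEnergy G G' Φ E := by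
  rcases eq_or_ne x 0 with rfl | hx
  · simp [outForm_zero]
  have hx0 : 0 < ‖(x : H')‖ := by simpa using hx
  have hE0 : (0 : ℝ) < E := hE
  lift ‖(x : H')‖ ^ 2 + ‖G'.sqrt.op x‖ ^ 2 / E to ℝ≥0 using by positivity with N hN
  have hN0 : N ≠ 0 := by
    rw [← NNReal.coe_ne_zero, hN]
    positivity
  have hnorm : ‖(x : H')‖ ^ 2 ≤ N := hN ▸ le_add_of_nonneg_right (by positivity)
  have henergy : ‖G'.sqrt.op x‖ ^ 2 ≤ N * E := by
    rw [hN, add_mul, div_mul_cancel₀ _ hE0.ne']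
    exact le_add_of_nonneg_left (by positivity)
  have key := hV.tsum_outForm_le_mul (ι := Unit) (φ := fun _ => (x : H')) (G := G) f hG' hE hN0
  simp only [tsum_fintype, Finset.univ_unique, Finset.sum_singleton, sqNormOp_of_mem x.2,
    ← ofReal_norm_sq, ← ENNReal.coe_mul, ENNReal.ofReal_le_iff_le_toReal ENNReal.coe_ne_top,
    ENNReal.coe_toReal, NNReal.coe_mul] at key
  rw [ENNReal.ofReal_coe_nnreal]
  exact key hnorm henergy

theorem exists_le_tsum_outForm (hV : IsStinespring Φ V) {E : ℝ≥0} {c : ℝ≥0∞}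
    (h : c < outEnergy G G' Φ E) : ∃ φ : onbIndex H' → H', ∑' i, ‖φ i‖ₑ ^ 2 = 1 ∧
      ∑' i, sqNormOp G'.sqrt.op (φ i) ≤ E ∧ c ≤ ∑' i, outForm f G V (φ i) := by
  by_contra! hcon
  exact h.not_ge (hV.outEnergy_le f fun φ h1 h2 => (hcon φ h1 h2).le)

end IsStinespring

theorem tsum_inv_two_pow_succ : ∑' n : ℕ, (((2⁻¹ : ℝ≥0) ^ (n + 1) : ℝ≥0) : ℝ≥0∞) = 1 := by
  simp only [ENNReal.coe_pow, ENNReal.coe_inv_two]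
  rw [ENNReal.tsum_geometric_add_one 2⁻¹, ENNReal.one_sub_inv_two, inv_inv]
  exact ENNReal.inv_mul_cancel two_ne_zero ENNReal.ofNat_ne_top

theorem tsum_prod_sqrt_smul {α ι X : Type*} [SMul ℂ X] {t : α → ℝ≥0} {g : X → ℝ≥0∞}
    (hg : ∀ n x, g (((NNReal.sqrt (t n) : ℝ) : ℂ) • x) = t n * g x) (φ : α → ι → X) :
    ∑' p : α × ι, g (((NNReal.sqrt (t p.1) : ℝ) : ℂ) • φ p.1 p.2) =
      ∑' n, t n * ∑' i, g (φ n i) := by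
  rw [ENNReal.tsum_prod (f := fun n i => g (((NNReal.sqrt (t n) : ℝ) : ℂ) • φ n i))]
  simp_rw [hg, ENNReal.tsum_mul_left]

-- If states of energy at most `E` had output energies at least `2 ^ (n + 1)`, their mixture with
-- weights `2 ^ -(n + 1)` would be a state of energy at most `E` and infinite output energy.
theorem IsLimited.outEnergy_lt_top (hL : IsLimited G G' Φ) (hV : IsStinespring Φ V) (E : ℝ≥0) :
    outEnergy G G' Φ E < ⊤ := by
  obtain ⟨s, f, -⟩ := exists_hilbertBasis ℂ K
  by_contra htop
  rw [not_lt, top_le_iff] at htop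
  choose φ hnorm henergy hout using fun n : ℕ => hV.exists_le_tsum_outForm (c := 2 ^ (n + 1))
    (G := G) (G' := G') (E := E) f
    (by rw [htop]; exact ENNReal.pow_lt_top ENNReal.ofNat_lt_top)
  let t : ℕ → ℝ≥0 := fun n => 2⁻¹ ^ (n + 1)
  refine hL.tsum_outForm_ne_top f hV
    (φ := fun p : ℕ × onbIndex H' => ((NNReal.sqrt (t p.1) : ℝ) : ℂ) • φ p.1 p.2) ?_ ?_ ?_
  · rw [tsum_prod_sqrt_smul (g := fun x => ‖x‖ₑ ^ 2) fun n x => enorm_sqrt_smul _ _]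
    simp_rw [hnorm, mul_one]
    exact tsum_inv_two_pow_succ
  · rw [tsum_prod_sqrt_smul fun n x => sqNormOp_sqrt_smul _ _ _]
    refine ne_top_of_le_ne_top (b := (E : ℝ≥0∞)) ENNReal.coe_ne_top ?_
    calc ∑' n, t n * ∑' i, sqNormOp G'.sqrt.op (φ n i) ≤ ∑' n, (t n : ℝ≥0∞) * E :=
          ENNReal.tsum_le_tsum fun n => by gcongr; exact henergy n
      _ = E := by rw [ENNReal.tsum_mul_right, tsum_inv_two_pow_succ, one_mul]
  · rw [tsum_prod_sqrt_smul fun n x => outForm_sqrt_smul f V G _ _, ← top_le_iff,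
      ← ENNReal.tsum_const_eq_top_of_ne_zero (α := ℕ) one_ne_zero]
    refine ENNReal.tsum_le_tsum fun n => ?_
    calc (1 : ℝ≥0∞) = t n * 2 ^ (n + 1) := by
          simp only [t, ENNReal.coe_pow, ENNReal.coe_inv_two]
          rw [← mul_pow, ENNReal.inv_mul_cancel two_ne_zero ENNReal.ofNat_ne_top, one_pow]
      _ ≤ _ := by gcongr; exact hout n

end OutputEnergy

/-! ## The induced map on `√G`-bounded operators -/

section Induced

variable {H H' : Type*} [NormedAddCommGroup H] [InnerProductSpace ℂ H] [CompleteSpace H]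
  [NormedAddCommGroup H'] [InnerProductSpace ℂ H'] [CompleteSpace H']
  {K : Type*} [NormedAddCommGroup K] [InnerProductSpace ℂ K]
  {Φ : (H →L[ℂ] H) →CP (H' →L[ℂ] H')} {V : H' →L[ℂ] HTensor H K}
  {G : PosOp H} {G' : PosOp H'}

theorem IsAmplExtension.add {A B : G.BG} {T T' : (amplPMap K G.sqrt.op).domain →ₗ[ℂ] HTensor H K}
    (hT : IsAmplExtension G.sqrt.op A.1 T) (hT' : IsAmplExtension G.sqrt.op B.1 T') :
    IsAmplExtension G.sqrt.op (A + B).1 (T + T') := by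
  refine ⟨(relBoundedOps (amplPMap K G.sqrt.op)).add_mem hT.1 hT'.1, fun x y h => ?_⟩
  have e : (A + B).1 x = A.1 x + B.1 x := rfl
  rw [LinearMap.add_apply, hT.2, hT'.2, e, ← tensL_apply, ← tensL_apply, ← tensL_apply, map_add]

theorem IsAmplExtension.smul {A : G.BG} {T : (amplPMap K G.sqrt.op).domain →ₗ[ℂ] HTensor H K}
    (c : ℂ) (hT : IsAmplExtension G.sqrt.op A.1 T) :
    IsAmplExtension G.sqrt.op (c • A).1 (c • T) := by
  refine ⟨(relBoundedOps (amplPMap K G.sqrt.op)).smul_mem c hT.1, fun x y h => ?_⟩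
  have e : (c • A).1 x = c • A.1 x := rfl
  rw [LinearMap.smul_apply, hT.2, e, ← tensL_apply, ← tensL_apply, map_smul]

theorem isAmplExtension_incl (A : H →L[ℂ] H) : IsAmplExtension G.sqrt.op (G.incl A).1
    (boundedRestrict (amplPMap K G.sqrt.op) (ampl K A)).1 :=
  ⟨(boundedRestrict (amplPMap K G.sqrt.op) (ampl K A)).2, fun x y _ => ampl_tens A (x : H) y⟩

variable [CompleteSpace K]

theorem IsAmplExtension.enorm_sq_eq {κ : Type*} (f : HilbertBasis κ ℂ K) {A : G.BG}
    {T : (amplPMap K G.sqrt.op).domain →ₗ[ℂ] HTensor H K} (hT : IsAmplExtension G.sqrt.op A.1 T)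
    (ξ : (amplPMap K G.sqrt.op).domain) :
    ‖T ξ‖ₑ ^ 2 = ∑' k, sqNormOp (G.toPMap A) (slice (f k) (ξ : HTensor H K)) := by
  obtain ⟨T', hT', hslice⟩ := exists_isAmplExtension f G A
  obtain rfl := hT.unique G.sqrt hT'
  rw [enorm_sq_eq_tsum_slice f]
  refine tsum_congr fun k => ?_
  rw [hslice, ← coe_domainSlice, sqNormOp_of_mem (A := G.toPMap A) (domainSlice G.sqrt (f k) ξ).2]
  rfl

theorem IsAmplExtension.enorm_sq_le {κ : Type*} (f : HilbertBasis κ ℂ K) {A : G.BG}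
    {T : (amplPMap K G.sqrt.op).domain →ₗ[ℂ] HTensor H K} (hT : IsAmplExtension G.sqrt.op A.1 T)
    {a b : ℝ} (hA : RelBoundWith G.sqrt.op A.1 a b) (ξ : (amplPMap K G.sqrt.op).domain) :
    ‖T ξ‖ₑ ^ 2 ≤ ENNReal.ofReal (a ^ 2) * ‖(ξ : HTensor H K)‖ₑ ^ 2 +
      ENNReal.ofReal (b ^ 2) * ∑' k, sqNormOp G.sqrt.op (slice (f k) (ξ : HTensor H K)) := by
  rw [hT.enorm_sq_eq f, enorm_sq_eq_tsum_slice f (ξ : HTensor H K)]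
  exact PosOp.tsum_sqNormOp_le_of_relBoundWith (ψ := fun k => slice (f k) (ξ : HTensor H K)) hA
    fun k => (domainSlice G.sqrt (f k) ξ).2

namespace IsLimited

theorem map_mem_amplPMap_domain (hL : IsLimited G G' Φ) (hV : IsStinespring Φ V)
    (hG' : G'.InfZero) (x : G'.sqrt.op.domain) : V (x : H') ∈ (amplPMap K G.sqrt.op).domain := by
  obtain ⟨s, f, -⟩ := exists_hilbertBasis ℂ K
  exact mem_amplPMap_domain f G.sqrt (ne_top_of_le_ne_top
    (ENNReal.mul_ne_top ENNReal.ofReal_ne_top (hL.outEnergy_lt_top hV 1).ne)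
    (hV.outForm_le f hG' one_pos x))

theorem norm_adjoint_sq_le (hL : IsLimited G G' Φ) (hV : IsStinespring Φ V)
    (hsub : Φ 1 ≤ 1) (hG' : G'.InfZero) {A : G.BG}
    {T : (amplPMap K G.sqrt.op).domain →ₗ[ℂ] HTensor H K} (hT : IsAmplExtension G.sqrt.op A.1 T)
    {a b : ℝ} (hA : RelBoundWith G.sqrt.op A.1 a b) {E : ℝ≥0} (hE : 0 < E)
    (x : G'.sqrt.op.domain) (hx : V (x : H') ∈ (amplPMap K G.sqrt.op).domain) :
    ‖ContinuousLinearMap.adjoint V (T ⟨V (x : H'), hx⟩)‖ ^ 2 ≤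
      √(‖Φ 1‖ * (a ^ 2 + b ^ 2 * (outEnergy G G' Φ E).toReal)) ^ 2 * ‖(x : H')‖ ^ 2 +
      (√((outEnergy G G' Φ E).toReal / E * ‖Φ 1‖) * b) ^ 2 * ‖G'.sqrt.op x‖ ^ 2 := by
  obtain ⟨s, f, -⟩ := exists_hilbertBasis ℂ K
  have hY := hL.outEnergy_lt_top hV E
  lift outEnergy G G' Φ E to ℝ≥0 using hY.ne with Y hYE
  rw [ENNReal.coe_toReal]
  have key : ‖ContinuousLinearMap.adjoint V (T ⟨V (x : H'), hx⟩)‖ₑ ^ 2 ≤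
      ENNReal.ofReal ‖Φ 1‖ * (ENNReal.ofReal (a ^ 2) * ‖(x : H')‖ₑ ^ 2 +
        ENNReal.ofReal (b ^ 2) *
          (ENNReal.ofReal (‖(x : H')‖ ^ 2 + ‖G'.sqrt.op x‖ ^ 2 / E) * Y)) := by
    refine (hV.enorm_adjoint_sq_le _).trans ?_
    gcongr
    exact (hT.enorm_sq_le f hA _).trans (add_le_add
      (mul_le_mul_right (hV.enorm_apply_sq_le hsub x) _)
      (mul_le_mul_right (hYE ▸ hV.outForm_le f hG' hE x) _))
  rw [← ofReal_norm_sq, ← ofReal_norm_sq, ← ENNReal.ofReal_coe_nnreal,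
    ← ENNReal.ofReal_mul (by positivity), ← ENNReal.ofReal_mul (by positivity),
    ← ENNReal.ofReal_mul (by positivity), ← ENNReal.ofReal_add (by positivity) (by positivity),
    ← ENNReal.ofReal_mul (by positivity), ENNReal.ofReal_le_ofReal_iff (by positivity)] at key
  rw [Real.sq_sqrt (by positivity), mul_pow, Real.sq_sqrt (by positivity)]
  refine key.trans_eq ?_
  ring

theorem exists_isInducedBy (hL : IsLimited G G' Φ) (hV : IsStinespring Φ V)
    (hsub : Φ 1 ≤ 1) (hG' : G'.InfZero) : ∃ Ψ : G.BG →ₗ[ℂ] G'.BG, IsInducedBy G G' V Ψ := by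
  obtain ⟨s, f, -⟩ := exists_hilbertBasis ℂ K
  choose T hT _ using fun A : G.BG => exists_isAmplExtension f G A
  have hmem := hL.map_mem_amplPMap_domain hV hG'
  have hT_add : ∀ A B, T (A + B) = T A + T B := fun A B =>
    (hT (A + B)).unique G.sqrt ((hT A).add (hT B))
  have hT_smul : ∀ (c : ℂ) A, T (c • A) = c • T A := fun c A =>
    (hT (c • A)).unique G.sqrt ((hT A).smul c)
  let W : G'.sqrt.op.domain →ₗ[ℂ] (amplPMap K G.sqrt.op).domain :=
    LinearMap.codRestrict _ ((V : H' →ₗ[ℂ] HTensor H K).domRestrict _) hmem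
  let Ψ : G.BG →ₗ[ℂ] G'.BG :=
    { toFun := fun A => ⟨(ContinuousLinearMap.adjoint V : HTensor H K →ₗ[ℂ] H') ∘ₗ T A ∘ₗ W, by
        obtain ⟨a, b, -, hb, hA⟩ := A.2
        exact ⟨_, _, Real.sqrt_nonneg _, by positivity, fun x =>
          hL.norm_adjoint_sq_le hV hsub hG' (hT A) hA one_pos x (hmem x)⟩⟩
      map_add' := fun A B => by
        ext x
        simp [hT_add]
      map_smul' := fun c A => by
        ext x
        simp [hT_smul] }
  exact ⟨Ψ, fun A => ⟨T A, hT A, fun x => ⟨hmem x, rfl⟩⟩⟩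

theorem eNorm_outEnergy_le (hL : IsLimited G G' Φ) (hV : IsStinespring Φ V)
    (hG : G.InfZero) (A : G.BG) {E : ℝ≥0} (hE : 0 < E) :
    ENNReal.ofReal (√‖Φ 1‖) * G.eNorm (outEnergy G G' Φ E) A ≤
      ENNReal.ofReal (√(max 1 ((outEnergy G G' Φ E).toReal / E) * ‖Φ 1‖)) * G.eNorm E A := by
  rw [mul_comm (max _ _), Real.sqrt_mul (norm_nonneg _), ENNReal.ofReal_mul (Real.sqrt_nonneg _),
    mul_assoc]
  gcongr
  exact hG.eNorm_le_sqrt_max_mul A (hL.outEnergy_lt_top hV E).ne hE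

theorem exists_tendsto_outEnergy_div (hL : IsLimited G G' Φ) (hV : IsStinespring Φ V)
    (hG' : G'.InfZero) : ∃ k : ℝ, Filter.Tendsto
      (fun E : ℝ≥0 => (outEnergy G G' Φ E).toReal / (E : ℝ)) Filter.atTop (𝓝 k) := by
  have hmono : ∀ E F : ℝ≥0, 0 < E → E ≤ F →
      (outEnergy G G' Φ F).toReal / F ≤ (outEnergy G G' Φ E).toReal / E := fun E F hE hEF => by
    have h := ENNReal.toReal_mono
      (ENNReal.mul_ne_top ENNReal.coe_ne_top (hL.outEnergy_lt_top hV E).ne)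
      (hV.outEnergy_le_mul (G := G) hG' hE hEF)
    rw [ENNReal.toReal_mul, ENNReal.coe_toReal, NNReal.coe_div] at h
    have hF : (0 : ℝ) < F := hE.trans_le hEF
    rw [div_le_iff₀ hF]
    exact h.trans_eq (by ring)
  let g : ℝ≥0 → ℝ := fun E => (outEnergy G G' Φ (max E 1)).toReal / (max E 1 : ℝ≥0)
  have hg : Antitone g := fun E F hEF =>
    hmono _ _ (one_pos.trans_le (le_max_right _ _)) (max_le_max_right 1 hEF)
  refine ⟨_, (tendsto_atTop_ciInf hg ⟨0, ?_⟩).congr' ?_⟩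
  · rintro _ ⟨E, rfl⟩
    exact div_nonneg ENNReal.toReal_nonneg NNReal.zero_le_coe
  · filter_upwards [Filter.eventually_ge_atTop 1] with E hE
    simp only [g, max_eq_left hE]

end IsLimited

theorem bddBelow_relBound {X Y : Type*} [NormedAddCommGroup X] [InnerProductSpace ℂ X]
    [NormedAddCommGroup Y] [InnerProductSpace ℂ Y] (S : X →ₗ.[ℂ] X) (A : S.domain →ₗ[ℂ] Y) :
    BddBelow {b : ℝ | 0 ≤ b ∧ ∃ a : ℝ, 0 ≤ a ∧ RelBoundWith S A a b} :=
  ⟨0, fun _ hb => hb.1⟩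

theorem PosOp.bound_nonneg (G : PosOp H) (A : G.BG) : 0 ≤ G.bound A :=
  Real.sInf_nonneg fun _ hb => hb.1

namespace IsInducedBy

theorem tendsto (hV : IsStinespring Φ V) {Ψ : G.BG →ₗ[ℂ] G'.BG}
    (hΨ : IsInducedBy G G' V Ψ) (A : G.BG) (x : G'.sqrt.op.domain) :
    Filter.Tendsto (fun n => Φ (G.cutoff A n) (x : H')) Filter.atTop (𝓝 ((Ψ A).1 x)) := by
  obtain ⟨T, hT, h⟩ := hΨ A
  obtain ⟨hx, he⟩ := h x
  rw [he]
  simp_rw [fun n => hV (G.cutoff A n)]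
  exact ((ContinuousLinearMap.adjoint V).continuous.tendsto _).comp
    (tendsto_ampl_cutoff G A hT ⟨_, hx⟩)

theorem eq {K' : Type*} [NormedAddCommGroup K'] [InnerProductSpace ℂ K']
    [CompleteSpace K'] {V' : H' →L[ℂ] HTensor H K'} (hV : IsStinespring Φ V)
    (hV' : IsStinespring Φ V') {Ψ Ψ' : G.BG →ₗ[ℂ] G'.BG} (hΨ : IsInducedBy G G' V Ψ)
    (hΨ' : IsInducedBy G G' V' Ψ') : Ψ = Ψ' := by
  ext A x
  exact tendsto_nhds_unique (hΨ.tendsto hV A x) (hΨ'.tendsto hV' A x)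

theorem iff_eq {K' : Type*} [NormedAddCommGroup K'] [InnerProductSpace ℂ K']
    [CompleteSpace K'] {V' : H' →L[ℂ] HTensor H K'} (hL : IsLimited G G' Φ)
    (hV : IsStinespring Φ V) (hV' : IsStinespring Φ V') (hsub : Φ 1 ≤ 1) (hG' : G'.InfZero)
    {Ψ Ψ' : G.BG →ₗ[ℂ] G'.BG} (hΨ : IsInducedBy G G' V Ψ) :
    IsInducedBy G G' V' Ψ' ↔ Ψ' = Ψ := by
  refine ⟨fun hΨ' => hΨ'.eq hV' hV hΨ, ?_⟩
  rintro rfl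
  obtain ⟨Ψ'', hΨ''⟩ := hL.exists_isInducedBy hV' hsub hG'
  rwa [hΨ.eq hV hV' hΨ'']

theorem map_incl (hV : IsStinespring Φ V) {Ψ : G.BG →ₗ[ℂ] G'.BG}
    (hΨ : IsInducedBy G G' V Ψ) (A : H →L[ℂ] H) : Ψ (G.incl A) = G'.incl (Φ A) := by
  obtain ⟨T, hT, h⟩ := hΨ (G.incl A)
  ext x
  obtain ⟨hx, he⟩ := h x
  rw [he, hT.unique G.sqrt (isAmplExtension_incl A), hV A]
  rfl

theorem relBoundWith (hL : IsLimited G G' Φ) (hV : IsStinespring Φ V)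
    (hsub : Φ 1 ≤ 1) (hG' : G'.InfZero) {Ψ : G.BG →ₗ[ℂ] G'.BG} (hΨ : IsInducedBy G G' V Ψ)
    {A : G.BG} {a b : ℝ} (hA : RelBoundWith G.sqrt.op A.1 a b) {E : ℝ≥0} (hE : 0 < E) :
    RelBoundWith G'.sqrt.op (Ψ A).1
      √(‖Φ 1‖ * (a ^ 2 + b ^ 2 * (outEnergy G G' Φ E).toReal))
      (√((outEnergy G G' Φ E).toReal / E * ‖Φ 1‖) * b) := by
  obtain ⟨T, hT, h⟩ := hΨ A
  intro x
  obtain ⟨hx, he⟩ := h x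
  rw [he]
  exact hL.norm_adjoint_sq_le hV hsub hG' hT hA hE x hx

theorem sqNormOp_le {κ : Type*} (f : HilbertBasis κ ℂ K) (hV : IsStinespring Φ V)
    {Ψ : G.BG →ₗ[ℂ] G'.BG} (hΨ : IsInducedBy G G' V Ψ) (A : G.BG) {x : H'}
    (hx : x ∈ G'.sqrt.op.domain) :
    sqNormOp (G'.toPMap (Ψ A)) x ≤
      ENNReal.ofReal ‖Φ 1‖ * ∑' k, sqNormOp (G.toPMap A) (slice (f k) (V x)) := by
  obtain ⟨T, hT, h⟩ := hΨ A
  obtain ⟨hVx, he⟩ := h ⟨x, hx⟩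
  rw [sqNormOp_of_mem (A := G'.toPMap (Ψ A)) hx, ← hT.enorm_sq_eq f ⟨V x, hVx⟩]
  exact (congrArg (fun y => ‖y‖ₑ ^ 2) he).trans_le (hV.enorm_adjoint_sq_le _)

theorem eNorm_le (hL : IsLimited G G' Φ) (hV : IsStinespring Φ V)
    (hsub : Φ 1 ≤ 1) (hG : G.InfZero) {Ψ : G.BG →ₗ[ℂ] G'.BG} (hΨ : IsInducedBy G G' V Ψ)
    (A : G.BG) (E : ℝ≥0) :
    G'.eNorm E (Ψ A) ≤ ENNReal.ofReal (√‖Φ 1‖) * G.eNorm (outEnergy G G' Φ E) A := by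
  obtain ⟨s, f, -⟩ := exists_hilbertBasis ℂ K
  refine PosOp.eNorm_le fun φ h1 hE => ?_
  have hφ := mem_sqrt_domain_of_tsum_ne_top (ne_top_of_le_ne_top ENNReal.coe_ne_top hE)
  have hY := (tsum_sqNormOp_slice f V G φ).trans_le (hV.tsum_outForm_le_of_eq_one f h1 hE)
  rw [mul_pow, ← ENNReal.ofReal_pow (Real.sqrt_nonneg _), Real.sq_sqrt (norm_nonneg _)]
  calc ∑' i, sqNormOp (G'.toPMap (Ψ A)) (φ i)
      ≤ ∑' i, ENNReal.ofReal ‖Φ 1‖ * ∑' k, sqNormOp (G.toPMap A) (slice (f k) (V (φ i))) :=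
        ENNReal.tsum_le_tsum fun i => hΨ.sqNormOp_le f hV A (hφ i)
    _ = ENNReal.ofReal ‖Φ 1‖ *
          ∑' p : onbIndex H' × s, sqNormOp (G.toPMap A) (slice (f p.2) (V (φ p.1))) := by
        rw [ENNReal.tsum_mul_left,
          ENNReal.tsum_prod (f := fun i k => sqNormOp (G.toPMap A) (slice (f k) (V (φ i))))]
    _ ≤ ENNReal.ofReal ‖Φ 1‖ * G.eNorm (outEnergy G G' Φ E) A ^ 2 := by
        gcongr
        refine hG.tsum_sqNormOp_le_eNorm_sq A ?_ hY
          (ne_top_of_le_ne_top (hL.outEnergy_lt_top hV E).ne hY)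
        rw [tsum_enorm_slice, ← h1]
        exact ENNReal.tsum_le_tsum fun i => hV.enorm_apply_sq_le hsub _

theorem isENormContinuous (hL : IsLimited G G' Φ) (hV : IsStinespring Φ V)
    (hsub : Φ 1 ≤ 1) (hG : G.InfZero) {Ψ : G.BG →ₗ[ℂ] G'.BG} (hΨ : IsInducedBy G G' V Ψ)
    {E : ℝ≥0} (hE : 0 < E) : IsENormContinuous G G' Φ E := by
  intro A ε hε
  set c : ℝ≥0∞ := ENNReal.ofReal (√(max 1 ((outEnergy G G' Φ E).toReal / E) * ‖Φ 1‖)) + 1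
  have hct : c ≠ ⊤ := ENNReal.add_ne_top.2 ⟨ENNReal.ofReal_ne_top, ENNReal.one_ne_top⟩
  have hc0 : c ≠ 0 := (zero_lt_one.trans_le le_add_self).ne'
  refine ⟨ε / c, ENNReal.div_pos hε.ne' hct, fun B hB => ?_⟩
  rw [ENNReal.lt_div_iff_mul_lt (.inl hc0) (.inl hct), mul_comm] at hB
  rw [← map_sub, ← hΨ.map_incl hV]
  calc _ ≤ _ := (hΨ.eNorm_le hL hV hsub hG _ E).trans (hL.eNorm_outEnergy_le hV hG _ hE)
    _ ≤ c * G.eNorm E (G.incl (B - A)) := by gcongr; exact le_self_add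
    _ < ε := hB

theorem bound_le (hL : IsLimited G G' Φ) (hV : IsStinespring Φ V)
    (hsub : Φ 1 ≤ 1) (hG' : G'.InfZero) {Ψ : G.BG →ₗ[ℂ] G'.BG} (hΨ : IsInducedBy G G' V Ψ)
    {k : ℝ} (hk : Filter.Tendsto (fun E : ℝ≥0 => (outEnergy G G' Φ E).toReal / (E : ℝ))
      Filter.atTop (𝓝 k)) (A : G.BG) : G'.bound (Ψ A) ≤ √(k * ‖Φ 1‖) * G.bound A := by
  have hb : ∀ b ∈ {b : ℝ | 0 ≤ b ∧ ∃ a : ℝ, 0 ≤ a ∧ RelBoundWith G.sqrt.op A.1 a b},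
      G'.bound (Ψ A) ≤ √(k * ‖Φ 1‖) * b := by
    rintro b ⟨hb0, a, -, hA⟩
    refine ge_of_tendsto ((hk.mul_const ‖Φ 1‖).sqrt.mul_const b) ?_
    filter_upwards [Filter.eventually_gt_atTop 0] with E hE
    exact csInf_le (bddBelow_relBound _ _) ⟨by positivity, _, Real.sqrt_nonneg _,
      hΨ.relBoundWith hL hV hsub hG' hA hE⟩
  have hne : {b : ℝ | 0 ≤ b ∧ ∃ a : ℝ, 0 ≤ a ∧ RelBoundWith G.sqrt.op A.1 a b}.Nonempty := by
    obtain ⟨a, b, ha, hb, h⟩ := A.2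
    exact ⟨b, hb, a, ha, h⟩
  rcases (Real.sqrt_nonneg (k * ‖Φ 1‖)).eq_or_lt with h0 | hpos
  · obtain ⟨b, hbm⟩ := hne
    simpa [← h0] using hb b hbm
  · rw [← div_le_iff₀' hpos]
    exact le_csInf hne fun b hbm => (div_le_iff₀' hpos).2 (hb b hbm)

theorem bound_eq_zero (hL : IsLimited G G' Φ) (hV : IsStinespring Φ V)
    (hsub : Φ 1 ≤ 1) (hG' : G'.InfZero) {Ψ : G.BG →ₗ[ℂ] G'.BG} (hΨ : IsInducedBy G G' V Ψ)
    {A : G.BG} (hA : G.bound A = 0) : G'.bound (Ψ A) = 0 := by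
  obtain ⟨k, hk⟩ := hL.exists_tendsto_outEnergy_div hV hG'
  refine le_antisymm ?_ (G'.bound_nonneg _)
  simpa [hA] using hΨ.bound_le hL hV hsub hG' hk A

end IsInducedBy

end Induced

/-! ## Energy bounds from continuity -/

section Converse

open InnerProductSpace (rankOne)

section RankOne

variable {H H' : Type*} [NormedAddCommGroup H] [InnerProductSpace ℂ H]
  [NormedAddCommGroup H'] [InnerProductSpace ℂ H']

variable [CompleteSpace H] [CompleteSpace H'] {Φ : (H →L[ℂ] H) →CP (H' →L[ℂ] H')}
  {G : PosOp H} {G' : PosOp H'} {E : ℝ≥0}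

namespace PosOp

/-- The square of the graph norm of `√G`, the energy being measured in units of `E > 0`. -/
def graphNormSq (G : PosOp H) (E : ℝ≥0) (x : G.sqrt.op.domain) : ℝ≥0 :=
  ‖(x : H)‖₊ ^ 2 + ‖G.sqrt.op x‖₊ ^ 2 / E

theorem coe_graphNormSq (G : PosOp H) (hE : 0 < E) (x : G.sqrt.op.domain) :
    (G.graphNormSq E x : ℝ≥0∞) = ‖(x : H)‖ₑ ^ 2 + sqNormOp G.sqrt.op (x : H) / E := by
  rw [sqNormOp_of_mem x.2, graphNormSq, ENNReal.coe_add, ENNReal.coe_div hE.ne']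
  rfl

theorem eNorm_incl_rankOne_le (G : PosOp H) (E : ℝ≥0) (η : H) (d : G.sqrt.op.domain) :
    G.eNorm E (G.incl (rankOne ℂ η (G.sqrt.op d))) ≤ ENNReal.ofReal (‖η‖ * ‖(d : H)‖ * √E) := by
  have hbound : RelBoundWith G.sqrt.op (G.incl (rankOne ℂ η (G.sqrt.op d))).1
      0 (‖η‖ * ‖(d : H)‖) := fun x => by
    have happly : (G.incl (rankOne ℂ η (G.sqrt.op d))).1 x = ⟪(d : H), G.sqrt.op x⟫_ℂ • η := by
      rw [← G.sqrt.graph_inner_symm (G.sqrt.op.mem_graph d) (G.sqrt.op.mem_graph x)]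
      rfl
    rw [happly, norm_smul, zero_pow two_ne_zero, zero_mul, zero_add, ← mul_pow, mul_comm, mul_assoc]
    gcongr
    exact norm_inner_le_norm _ _
  refine (eNorm_le_of_relBoundWith hbound).trans_eq ?_
  rw [zero_pow two_ne_zero, zero_add, Real.sqrt_mul (by positivity), Real.sqrt_sq (by positivity)]

end PosOp

namespace IsENormContinuous

theorem exists_norm_map_le (hE : 0 < E) (hc : IsENormContinuous G G' Φ E) (hG' : G'.InfZero) :
    ∃ r : ℝ≥0, 0 < r ∧ ∀ A : H →L[ℂ] H, G.eNorm E (G.incl A) ≤ r → ∀ x : G'.sqrt.op.domain,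
      ‖Φ A (x : H')‖ ≤ NNReal.sqrt (G'.graphNormSq E x) := by
  obtain ⟨δ, hδ, h⟩ := hc 0 1 one_pos
  simp only [map_zero, sub_zero] at h
  obtain ⟨r, hr0, hrδ⟩ := ENNReal.lt_iff_exists_nnreal_btwn.1 hδ
  refine ⟨r, by simpa using hr0, fun A hA x => ?_⟩
  have hle := hG'.norm_sq_le_of_eNorm_le hE zero_le_one
    (by simpa using (h A (hA.trans_lt hrδ)).le) x
  rw [one_pow, one_mul] at hle
  rw [Real.coe_sqrt]
  exact Real.le_sqrt_of_sq_le hle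

theorem exists_norm_map_rankOne_le (hE : 0 < E) (hc : IsENormContinuous G G' Φ E)
    (hG' : G'.InfZero) : ∃ C : ℝ≥0, ∀ (η : H) (d : G.sqrt.op.domain) (x : G'.sqrt.op.domain),
      ‖Φ (rankOne ℂ η (G.sqrt.op d)) (x : H')‖ ≤
        C * ‖η‖ * ‖(d : H)‖ * NNReal.sqrt (G'.graphNormSq E x) := by
  obtain ⟨r, hr, h⟩ := hc.exists_norm_map_le hE hG'
  refine ⟨NNReal.sqrt E / r, fun η d x => ?_⟩
  set t : ℝ := ‖η‖ * ‖(d : H)‖ * √E with ht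
  have ht0 : 0 ≤ t := by positivity
  rcases ht0.eq_or_lt with h0 | hpos
  · have hzero : rankOne ℂ η (G.sqrt.op d) = 0 := by
      have hsqrt : √(E : ℝ) ≠ 0 := (Real.sqrt_pos.2 hE).ne'
      rcases mul_eq_zero.1 ((mul_eq_zero.1 h0.symm).resolve_right hsqrt) with hη | hd
      · rw [norm_eq_zero.1 hη, map_zero, zero_apply]
      · rw [show d = 0 from Subtype.ext (norm_eq_zero.1 hd), LinearPMap.map_zero, map_zero]
    rw [hzero, map_zero, zero_apply, norm_zero]
    positivity
  · have hscaled := h (rankOne ℂ (((r / t : ℝ) : ℂ) • η) (G.sqrt.op d)) (by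
      refine (G.eNorm_incl_rankOne_le E _ d).trans_eq ?_
      rw [norm_smul, Complex.norm_real, Real.norm_of_nonneg (by positivity), mul_assoc, mul_assoc,
        ← mul_assoc ‖η‖, ← ht, div_mul_cancel₀ _ hpos.ne', ENNReal.ofReal_coe_nnreal]) x
    rw [map_smul, smul_apply, map_smul, smul_apply, norm_smul, Complex.norm_real,
      Real.norm_of_nonneg (by positivity), ← le_div_iff₀' (by positivity)] at hscaled
    refine hscaled.trans_eq ?_
    simp only [NNReal.coe_div, Real.coe_sqrt, ht]
    field_simp

end IsENormContinuous

end RankOne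

section Environment

variable {H H' K : Type*} [NormedAddCommGroup H] [InnerProductSpace ℂ H]
  [NormedAddCommGroup H'] [InnerProductSpace ℂ H']
  [NormedAddCommGroup K] [InnerProductSpace ℂ K] [CompleteSpace K]

theorem adjoint_tensR_tens (η x : H) (y : K) :
    ContinuousLinearMap.adjoint (tensR K η) (tens x y) = ⟪η, x⟫_ℂ • y :=
  ext_inner_left ℂ fun k => by
    rw [ContinuousLinearMap.adjoint_inner_right, tensR_apply, inner_tens, inner_smul_right]

theorem ampl_rankOne (h η : H) :
    ampl K (rankOne ℂ h η) = (tensR K h).comp (ContinuousLinearMap.adjoint (tensR K η)) :=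
  clm_ext_tens fun x y => by
    rw [ampl_tens, ContinuousLinearMap.comp_apply, adjoint_tensR_tens, map_smul, tensR_apply,
      InnerProductSpace.rankOne_apply, ← tensL_apply, map_smul, tensL_apply]

/-- The subspace of the environment `K` that is reached by `V`: the span of the vectors
`(⟨η| ⊗ I) V x`. -/
def environment (V : H' →L[ℂ] HTensor H K) : Submodule ℂ K :=
  Submodule.span ℂ {κ | ∃ η x, κ = ContinuousLinearMap.adjoint (tensR K η) (V x)}

variable [CompleteSpace H] {V : H' →L[ℂ] HTensor H K}

theorem inner_ampl_rankOne (η h : H) (ξ ζ : HTensor H K) :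
    ⟪ξ, ampl K (rankOne ℂ η h) ζ⟫_ℂ =
      ⟪h, slice (ContinuousLinearMap.adjoint (tensR K η) ξ) ζ⟫_ℂ := by
  rw [inner_slice, ← tensR_apply, ← ContinuousLinearMap.comp_apply, ← ampl_rankOne,
    ← InnerProductSpace.adjoint_rankOne, ← adjoint_ampl, ContinuousLinearMap.adjoint_inner_right]

theorem slice_eq_zero_of_mem_environment_orthogonal {κ : K} (hκ : κ ∈ (environment V)ᗮ) (x : H') :
    slice κ (V x) = 0 :=
  ext_inner_left ℂ fun η => by
    rw [inner_slice, inner_zero_right, ← tensR_apply, ← ContinuousLinearMap.adjoint_inner_right]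
    exact (Submodule.mem_orthogonal' _ _).1 hκ _ (Submodule.subset_span ⟨η, x, rfl⟩)

theorem exists_mem_slice_eq {L : Submodule ℂ K} [L.HasOrthogonalProjection]
    (hL : environment V ≤ L) (κ : K) : ∃ p ∈ L, ∀ x, slice κ (V x) = slice p (V x) := by
  obtain ⟨p, hp, q, hq, rfl⟩ := L.exists_add_mem_mem_orthogonal κ
  refine ⟨p, hp, fun x => ?_⟩
  rw [slice_add, slice_eq_zero_of_mem_environment_orthogonal (Submodule.orthogonal_le hL hq),
    add_zero]

end Environment

theorem continuous_slice_left {H K : Type*} [NormedAddCommGroup H] [InnerProductSpace ℂ H]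
    [CompleteSpace H] [NormedAddCommGroup K] [InnerProductSpace ℂ K] (ξ : HTensor H K) :
    Continuous fun y : K => slice y ξ :=
  AddMonoidHomClass.continuous_of_bound
    (AddMonoidHom.mk' (fun y : K => slice y ξ) fun y y' => slice_add y y' ξ) ‖ξ‖ fun y => by
      rw [mul_comm]; exact norm_slice_le y ξ

variable {H H' K : Type*} [NormedAddCommGroup H] [InnerProductSpace ℂ H] [CompleteSpace H]
  [NormedAddCommGroup H'] [InnerProductSpace ℂ H'] [CompleteSpace H']
  [NormedAddCommGroup K] [InnerProductSpace ℂ K]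
  {Φ : (H →L[ℂ] H) →CP (H' →L[ℂ] H')} {V : H' →L[ℂ] HTensor H K}
  {G : PosOp H} {G' : PosOp H'} {E : ℝ≥0}

namespace IsStinespring

theorem ampl_apply_eq_zero (hV : IsStinespring Φ V) {Q : H →L[ℂ] H} (hQ : IsStarProjection Q)
    (h0 : Φ Q = 0) (x : H') : ampl K Q (V x) = 0 := by
  have hsq : ampl K Q (ampl K Q (V x)) = ampl K Q (V x) := by
    rw [← mul_apply_eq_comp, ← ampl_mul, hQ.isIdempotentElem.eq]
  rw [← inner_self_eq_zero (𝕜 := ℂ), ← ContinuousLinearMap.adjoint_inner_right, adjoint_ampl,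
    ← ContinuousLinearMap.star_eq_adjoint, hQ.isSelfAdjoint.star_eq, hsq, ← hV.inner_map, h0,
    zero_apply, inner_zero_right]

theorem apply_slice_eq (hV : IsStinespring Φ V) {P : H →L[ℂ] H} (hP : IsStarProjection P)
    (h1 : Φ 1 = Φ P) (κ : K) (x : H') : P (slice κ (V x)) = slice κ (V x) := by
  have h := slice_ampl (1 - P) κ (V x)
  rw [hV.ampl_apply_eq_zero hP.one_sub (by rw [map_sub, h1, sub_self]), map_zero, sub_apply,
    one_apply_eq_self] at h
  exact (sub_eq_zero.1 h.symm).symm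

variable [CompleteSpace K]

theorem isLimited_of_outForm_le {κ : Type*} (f : HilbertBasis κ ℂ K)
    (hV : IsStinespring Φ V) (hE : 0 < E) {C : ℝ≥0}
    (h : ∀ x : G'.sqrt.op.domain, outForm f G V (x : H') ≤ C * G'.graphNormSq E x) :
    IsLimited G G' Φ := by
  refine hV.isLimited f fun φ h1 hS => ?_
  have hφ := mem_sqrt_domain_of_tsum_ne_top hS
  have hle : ∑' i, outForm f G V (φ i) ≤
      C * (1 + (∑' i, sqNormOp G'.sqrt.op (φ i)) / E) := by
    rw [← h1, div_eq_mul_inv, ← ENNReal.tsum_mul_right, ← ENNReal.tsum_add, ← ENNReal.tsum_mul_left]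
    refine ENNReal.tsum_le_tsum fun i => (h ⟨φ i, hφ i⟩).trans_eq ?_
    rw [G'.coe_graphNormSq hE, div_eq_mul_inv]
  exact ne_top_of_le_ne_top (ENNReal.mul_ne_top ENNReal.coe_ne_top (ENNReal.add_ne_top.2
    ⟨ENNReal.one_ne_top, ENNReal.div_ne_top hS (ENNReal.coe_ne_zero.2 hE.ne')⟩)) hle

end IsStinespring

variable [CompleteSpace K]

namespace IsENormContinuous

-- Duality with the rank-one operators `|η⟩⟨√G d|`, whose `E`-norm is at most `‖η‖ ‖d‖ √E`.
theorem exists_sqNormOp_slice_adjoint_tensR_le (hE : 0 < E) (hc : IsENormContinuous G G' Φ E)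
    (hV : IsStinespring Φ V) (hG' : G'.InfZero) (η : H) (y : H') :
    ∃ c : ℝ≥0, ∀ x : G'.sqrt.op.domain,
      sqNormOp G.sqrt.op (slice (ContinuousLinearMap.adjoint (tensR K η) (V y)) (V (x : H'))) ≤
        c * G'.graphNormSq E x := by
  obtain ⟨C, hC⟩ := hc.exists_norm_map_rankOne_le hE hG'
  refine ⟨(‖y‖₊ * (C * ‖η‖₊)) ^ 2, fun x => ?_⟩
  rw [← NNReal.sq_sqrt (G'.graphNormSq E x), ← ENNReal.coe_mul, ← mul_pow, ENNReal.coe_pow]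
  refine G.sqrt.sqNormOp_le_of_norm_inner_le fun d => ?_
  rw [← inner_ampl_rankOne, ← hV.inner_map]
  calc ‖⟪y, Φ (rankOne ℂ η (G.sqrt.op d)) (x : H')⟫_ℂ‖
      ≤ ‖y‖ * (C * ‖η‖ * ‖(d : H)‖ * NNReal.sqrt (G'.graphNormSq E x)) :=
        (norm_inner_le_norm _ _).trans (by gcongr; exact hC η d x)
    _ = _ := by
        push_cast
        ring

theorem exists_sqNormOp_slice_le (hE : 0 < E) (hc : IsENormContinuous G G' Φ E)
    (hV : IsStinespring Φ V) (hG' : G'.InfZero) {κ : K} (hκ : κ ∈ environment V) :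
    ∃ c : ℝ≥0, ∀ x : G'.sqrt.op.domain,
      sqNormOp G.sqrt.op (slice κ (V (x : H'))) ≤ c * G'.graphNormSq E x := by
  induction hκ using Submodule.span_induction with
  | mem κ hκ =>
    obtain ⟨η, y, rfl⟩ := hκ
    exact hc.exists_sqNormOp_slice_adjoint_tensR_le hE hV hG' η y
  | zero =>
    refine ⟨0, fun x => ?_⟩
    rw [slice_eq_zero_of_mem_environment_orthogonal (Submodule.zero_mem _), sqNormOp_zero]
    exact zero_le
  | add κ κ' _ _ h h' =>
    obtain ⟨c, h⟩ := h
    obtain ⟨c', h'⟩ := h'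
    refine ⟨2 * (c + c'), fun x => ?_⟩
    rw [slice_add]
    refine (sqNormOp_add_le _ _ _).trans ?_
    push_cast
    rw [mul_assoc, add_mul]
    gcongr
    exacts [h x, h' x]
  | smul t κ _ h =>
    obtain ⟨c, h⟩ := h
    refine ⟨‖t‖₊ ^ 2 * c, fun x => ?_⟩
    rw [slice_smul, sqNormOp_smul]
    push_cast
    rw [mul_assoc]
    gcongr
    · simp
    · exact h x

theorem isLimited_of_finiteDimensional [FiniteDimensional ℂ K] (hE : 0 < E)
    (hc : IsENormContinuous G G' Φ E) (hV : IsStinespring Φ V) (hG' : G'.InfZero) :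
    IsLimited G G' Φ := by
  let f := (stdOrthonormalBasis ℂ K).toHilbertBasis
  have hslice : ∀ k, ∃ c : ℝ≥0, ∀ x : G'.sqrt.op.domain,
      sqNormOp G.sqrt.op (slice (f k) (V (x : H'))) ≤ c * G'.graphNormSq E x := fun k => by
    obtain ⟨p, hp, hslice_eq⟩ := exists_mem_slice_eq (le_refl (environment V)) (f k)
    simpa only [hslice_eq] using hc.exists_sqNormOp_slice_le hE hV hG' hp
  choose c hle using hslice
  refine hV.isLimited_of_outForm_le f hE (C := ∑ k, c k) fun x => ?_
  rw [outForm, tsum_fintype, ENNReal.ofNNReal_finsetSum, Finset.sum_mul]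
  exact Finset.sum_le_sum fun k _ => hle k x

theorem slice_mem_range_inf_domain (hE : 0 < E) (hc : IsENormContinuous G G' Φ E)
    (hV : IsStinespring Φ V) (hG' : G'.InfZero) {P : H →L[ℂ] H} (hP : IsStarProjection P)
    [FiniteDimensional ℂ P.range] (h1 : Φ 1 = Φ P) (κ : K) (x : G'.sqrt.op.domain) :
    slice κ (V (x : H')) ∈ P.range ⊓ G.sqrt.op.domain := by
  have := Submodule.finiteDimensional_inf_left P.range G.sqrt.op.domain
  have hclosed := (P.range ⊓ G.sqrt.op.domain).closed_of_finiteDimensional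
  obtain ⟨p, hp, hslice_eq⟩ := exists_mem_slice_eq (environment V).le_topologicalClosure κ
  rw [hslice_eq]
  refine closure_minimal (t := {p | slice p (V (x : H')) ∈ P.range ⊓ G.sqrt.op.domain})
    (fun p hp => ?_) (hclosed.preimage (continuous_slice_left _)) hp
  obtain ⟨c, hle⟩ := hc.exists_sqNormOp_slice_le hE hV hG' hp
  exact ⟨⟨_, hV.apply_slice_eq hP h1 p x⟩, mem_domain_of_sqNormOp_ne_top
    (ne_top_of_le_ne_top (ENNReal.mul_ne_top ENNReal.coe_ne_top ENNReal.coe_ne_top) (hle x))⟩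

-- Every slice lies in `ran P ∩ D(√G)`, on which `√G` is bounded since the dimension is finite.
theorem isLimited_of_finiteDimensional_range (hE : 0 < E) (hc : IsENormContinuous G G' Φ E)
    (hV : IsStinespring Φ V) (hG' : G'.InfZero) {P : H →L[ℂ] H}
    (hP : IsStarProjection P) [FiniteDimensional ℂ P.range] (h1 : Φ 1 = Φ P) :
    IsLimited G G' Φ := by
  obtain ⟨s, f, -⟩ := exists_hilbertBasis ℂ K
  have hmem := hc.slice_mem_range_inf_domain hE hV hG' hP h1
  have := Submodule.finiteDimensional_inf_left P.range G.sqrt.op.domain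
  let S : ↥(P.range ⊓ G.sqrt.op.domain) →L[ℂ] H := LinearMap.toContinuousLinearMap
    (G.sqrt.op.toFun ∘ₗ Submodule.inclusion inf_le_right)
  refine hV.isLimited_of_outForm_le f hE (C := (‖S‖₊ * ‖V‖₊) ^ 2) fun x => ?_
  calc outForm f G V (x : H')
      ≤ ∑' k, ‖S‖ₑ ^ 2 * ‖slice (f k) (V (x : H'))‖ₑ ^ 2 := by
        refine ENNReal.tsum_le_tsum fun k => ?_
        rw [sqNormOp_of_mem (hmem (f k) x).2, ← mul_pow]
        gcongr
        exact S.le_opENorm ⟨_, hmem (f k) x⟩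
    _ = ‖S‖ₑ ^ 2 * ‖V (x : H')‖ₑ ^ 2 := by
        rw [ENNReal.tsum_mul_left, ← enorm_sq_eq_tsum_slice f]
    _ ≤ ‖S‖ₑ ^ 2 * (‖V‖ₑ * ‖(x : H')‖ₑ) ^ 2 := by
        gcongr
        exact V.le_opENorm _
    _ = ((‖S‖₊ * ‖V‖₊) ^ 2 : ℝ≥0) * ‖(x : H')‖ₑ ^ 2 := by
        rw [ENNReal.coe_pow, ENNReal.coe_mul, ← enorm_eq_nnnorm, ← enorm_eq_nnnorm, mul_pow,
          mul_pow, mul_assoc]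
    _ ≤ ((‖S‖₊ * ‖V‖₊) ^ 2 : ℝ≥0) * G'.graphNormSq E x := by
        rw [G'.coe_graphNormSq hE]
        gcongr
        exact le_self_add

end IsENormContinuous

end Converse

end

theorem theorem2_general {H : Type u} {H' : Type v}
    [NormedAddCommGroup H] [InnerProductSpace ℂ H] [CompleteSpace H]
    [TopologicalSpace.SeparableSpace H]
    [NormedAddCommGroup H'] [InnerProductSpace ℂ H'] [CompleteSpace H']
    [TopologicalSpace.SeparableSpace H']
    (Φ : (H →L[ℂ] H) →CP (H' →L[ℂ] H')) (hnormal : IsNormalMap Φ) (hsub : Φ 1 ≤ 1)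
    (G : PosOp H) (G' : PosOp H') (hG : G.InfZero) (hG' : G'.InfZero) :
    (IsLimited G G' Φ →
      (∀ E : ℝ≥0, 0 < E → IsENormContinuous G G' Φ E) ∧
      (∀ E : ℝ≥0, 0 < E → outEnergy G G' Φ E < ⊤) ∧
      (∃ (K : Type w) (_ : NormedAddCommGroup K) (_ : InnerProductSpace ℂ K)
        (_ : CompleteSpace K) (_ : TopologicalSpace.SeparableSpace K)
        (V : H' →L[ℂ] HTensor H K), IsStinespring Φ V) ∧
      ∃ Ψ : G.BG →ₗ[ℂ] G'.BG,
        (∀ (K : Type w) [NormedAddCommGroup K] [InnerProductSpace ℂ K] [CompleteSpace K]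
          (V : H' →L[ℂ] HTensor H K), IsStinespring Φ V →
          ∀ Ψ' : G.BG →ₗ[ℂ] G'.BG, IsInducedBy G G' V Ψ' ↔ Ψ' = Ψ) ∧
        (∀ A : H →L[ℂ] H, Ψ (G.incl A) = G'.incl (Φ A)) ∧
        (∀ (A : G.BG) (E : ℝ≥0), 0 < E →
          G'.eNorm E (Ψ A) ≤
            ENNReal.ofReal (√‖Φ 1‖) * G.eNorm (outEnergy G G' Φ E) A ∧
          ENNReal.ofReal (√‖Φ 1‖) * G.eNorm (outEnergy G G' Φ E) A ≤
            ENNReal.ofReal (√(max 1 ((outEnergy G G' Φ E).toReal / E) * ‖Φ 1‖)) * G.eNorm E A) ∧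
        (∃ k : ℝ, Filter.Tendsto (fun E : ℝ≥0 => (outEnergy G G' Φ E).toReal / (E : ℝ))
            Filter.atTop (𝓝 k) ∧
          ∀ A : G.BG, G'.bound (Ψ A) ≤ √(k * ‖Φ 1‖) * G.bound A) ∧
        (∀ A : G.BG, G.bound A = 0 → G'.bound (Ψ A) = 0)) ∧
    ((HasFiniteChoiRank Φ ∨ ∃ P : H →L[ℂ] H, IsStarProjection P ∧
        FiniteDimensional ℂ P.range ∧ Φ 1 = Φ P) →
      (∃ E : ℝ≥0, 0 < E ∧ IsENormContinuous G G' Φ E) →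
      IsLimited G G' Φ) := by
  refine ⟨fun hL => ?_, fun hcase ⟨E, hE, hc⟩ => ?_⟩
  · obtain ⟨K, _, _, _, _, V, hV⟩ := exists_isStinespring.{u, v, w} hnormal
    obtain ⟨Ψ, hΨ⟩ := hL.exists_isInducedBy hV hsub hG'
    obtain ⟨k, hk⟩ := hL.exists_tendsto_outEnergy_div hV hG'
    exact ⟨fun E hE => hΨ.isENormContinuous hL hV hsub hG hE,
      fun E _ => hL.outEnergy_lt_top hV E,
      ⟨K, _, _, ‹_›, ‹_›, V, hV⟩,
      Ψ,
      fun K' _ _ _ V' hV' Ψ' => hΨ.iff_eq hL hV hV' hsub hG',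
      hΨ.map_incl hV,
      fun A E hE => ⟨hΨ.eNorm_le hL hV hsub hG A E, hL.eNorm_outEnergy_le hV hG A hE⟩,
      ⟨k, hk, hΨ.bound_le hL hV hsub hG' hk⟩,
      fun A hA => hΨ.bound_eq_zero hL hV hsub hG' hA⟩
  · rcases hcase with ⟨K, _, _, V, _, hV, -⟩ | ⟨P, hP, hfin, h1⟩
    · have : CompleteSpace K := FiniteDimensional.complete ℂ K
      exact hc.isLimited_of_finiteDimensional hE hV hG'
    · obtain ⟨K, _, _, _, _, V, hV⟩ := exists_isStinespring.{u, v, 0} hnormal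
      exact hc.isLimited_of_finiteDimensional_range hE hV hG' hP h1

theorem theorem2 {H : Type u} {H' : Type v}
    [NormedAddCommGroup H] [InnerProductSpace ℂ H] [CompleteSpace H]
    [TopologicalSpace.SeparableSpace H]
    [NormedAddCommGroup H'] [InnerProductSpace ℂ H'] [CompleteSpace H']
    [TopologicalSpace.SeparableSpace H']
    (Φ : (H →L[ℂ] H) →CP (H' →L[ℂ] H')) (hnormal : IsNormalMap Φ) (hsub : Φ 1 ≤ 1)
    (G : PosOp H) (G' : PosOp H') (hG : G.InfZero) (hG' : G'.InfZero) :
    -- Part A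
    (IsLimited G G' Φ →
      (∀ E : ℝ≥0, 0 < E → IsENormContinuous G G' Φ E) ∧
      (∀ E : ℝ≥0, 0 < E → outEnergy G G' Φ E < ⊤) ∧
      -- Stinespring representations exist, and all of them define the same operator `Ψ`
      (∃ (K : Type w) (_ : NormedAddCommGroup K) (_ : InnerProductSpace ℂ K)
        (_ : CompleteSpace K) (_ : TopologicalSpace.SeparableSpace K)
        (V : H' →L[ℂ] HTensor H K), IsStinespring Φ V) ∧
      ∃ Ψ : G.BG →ₗ[ℂ] G'.BG,
        (∀ (K : Type w) [NormedAddCommGroup K] [InnerProductSpace ℂ K] [CompleteSpace K]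
          [TopologicalSpace.SeparableSpace K] (V : H' →L[ℂ] HTensor H K), IsStinespring Φ V →
          ∀ Ψ' : G.BG →ₗ[ℂ] G'.BG, IsInducedBy G G' V Ψ' ↔ Ψ' = Ψ) ∧
        (∀ A : H →L[ℂ] H, Ψ (G.incl A) = G'.incl (Φ A)) ∧
        (∀ (A : G.BG) (E : ℝ≥0), 0 < E →
          G'.eNorm E (Ψ A) ≤
            ENNReal.ofReal (√‖Φ 1‖) * G.eNorm (outEnergy G G' Φ E) A ∧
          ENNReal.ofReal (√‖Φ 1‖) * G.eNorm (outEnergy G G' Φ E) A ≤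
            ENNReal.ofReal (√(max 1 ((outEnergy G G' Φ E).toReal / E) * ‖Φ 1‖)) * G.eNorm E A) ∧
        (∃ k : ℝ, Filter.Tendsto (fun E : ℝ≥0 => (outEnergy G G' Φ E).toReal / (E : ℝ))
            Filter.atTop (𝓝 k) ∧
          ∀ A : G.BG, G'.bound (Ψ A) ≤ √(k * ‖Φ 1‖) * G.bound A) ∧
        (∀ A : G.BG, G.bound A = 0 → G'.bound (Ψ A) = 0)) ∧
    -- Part B
    (G'.IsDiscrete →
      (HasFiniteChoiRank Φ ∨
        (G.IsDiscrete ∧ ∃ P : H →L[ℂ] H, IsStarProjection P ∧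
          FiniteDimensional ℂ P.range ∧ Φ 1 = Φ P)) →
      (∃ E : ℝ≥0, 0 < E ∧ IsENormContinuous G G' Φ E) →
      IsLimited G G' Φ) := by
  obtain ⟨hA, hB⟩ := theorem2_general Φ hnormal hsub G G' hG hG'
  refine ⟨fun hL => ?_, fun _ hcase => hB (hcase.imp_right And.right)⟩
  obtain ⟨hc, hY, hV, Ψ, hΨ, h⟩ := hA hL
  exact ⟨hc, hY, hV, Ψ, fun K _ _ _ _ => hΨ K, h⟩
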